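/- **Setting.** Let $G$ be a compact Lie group with Lie algebra $\mathfrak g$ and Killing form $B_{\mathfrak g}$, and let $M=G/K$ be a homogeneous space of $G$ (a smooth manifold $M$ with a smooth transitive action of $G$ whose orbit maps are submersions; $K$ is the stabilizer of a point $o$, with Lie algebra $\mathfrak k$). Let $\mathfrak m=\mathfrak k^{\perp}$ be the orthogonal complement of $\mathfrak k$ for $B_{\mathfrak g}$, identified with $T_oM$. Suppose that $M$ carries the standard homogeneous Riemannian metric $g=g_B$, that is, the $G$-invariant metric which is $-B_{\mathfrak g}|_{\mathfrak m\times\mathfrak m}$ on $T_oM\cong\mathfrak m$. Let $T^c$ be the $G$-invariant tensor field with $T^c(X,Y)=-[X,Y]_{\mathfrak m}$ for $X,Y\in\mathfrak m\cong T_oM$ (the torsion of the canonical connection of $G/K$ for $\mathfrak g=\mathfrak k\oplus\mathfrak m$), and for $\alpha\in\mathbb R$ let $\nabla^{\alpha}$ be the metric connection on $TM$ with torsion $T^{\alpha}=\alpha\, T^c$; it is unique, hence $G$-invariant. For a connection $\nabla$, let $R$ be its curvature $R(X,Y)=\nabla_X\nabla_Y-\nabla_Y\nabla_X-\nabla_{[X,Y]}$,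 $\mathrm{Ric}(Y,Z)=\mathrm{tr}\,(X\mapsto R(X,Y)Z)$ its Ricci tensor, $\mathrm{Ric}_S$ the symmetric part of $\mathrm{Ric}$, $\mathrm{Sca}$ the $g$-trace of $\mathrm{Ric}$, and $n=\dim M$. The manifold $(M,g)$ is called *$\nabla$-Einstein* (with skew-torsion) if $\nabla$ is metric, its torsion $T$ is a 3-form, i.e. $g(T(X,Y),Z)$ is totally skew-symmetric, and $$\mathrm{Ric}_S=\frac{\mathrm{Sca}}{n}\,g .$$ **Theorem.** 1. Suppose that $\mathfrak g$ is simple ($G$ need not be connected), that $M$ is simply connected, that $M=G/K$ is isotropy irreducible (the isotropy representation of $K$ on $T_oM\neq 0$ is irreducible over $\mathbb R$), and that $M=G/K$ is not a symmetric space of Type I, i.e. $[\mathfrak m,\mathfrak m]\not\subseteq\mathfrak k$. Then $(M,g)$ is $\nabla^{\alpha}$-Einstein for every $\alpha\in\mathbb R$. 2. The same conclusion holds for the non-simple case: if $H$ is a compact simply connected simple Lie group, $q\ge 2$, $G=H\times\cdots\times H$ ($q$ factors), and $K=\Delta H$ is the diagonal subgroup, then $M=G/\Delta H=(G/\Delta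 Z)/(\Delta H/\Delta Z)$ ($Z$ the centre of $H$), with its standard metric, is $\nabla^{\alpha}$-Einstein for every $\alpha\in\mathbb R$. -/

import Mathlib

open Bundle
open scoped Manifold ContDiff

noncomputable section

namespace StdHom

/-! ### Curvature of a connection with torsion on a Riemannian manifold -/

section Curvature

variable {E : Type*} [NormedAddCommGroup E] [NormedSpace ℝ E]
  {M : Type*} [TopologicalSpace M] [ChartedSpace E M] [IsManifold 𝓘(ℝ, E) ∞ M]

/-- A (Koszul) connection on the tangent bundle of `M`. -/
abbrev AffineConnection (E : Type*) [NormedAddCommGroup E] [NormedSpace ℝ E]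
    (M : Type*) [TopologicalSpace M] [ChartedSpace E M] [IsManifold 𝓘(ℝ, E) ∞ M] :=
  CovariantDerivative 𝓘(ℝ, E) E (TangentSpace 𝓘(ℝ, E) : M → Type _)

/-- The curvature `R(u, v) w = ∇_U ∇_V W - ∇_V ∇_U W - ∇_[U, V] W` at the point `p`, where
`U, V, W` are vector fields, smooth near `p`, which extend the tangent vectors `u, v, w`. (For a
smooth connection the value does not depend on the extensions. Recall that `nabla W x (V x)`
stands for `(∇_V W)(x)`.) -/
def curvature (nabla : AffineConnection E M) (p : M) (u v w : TangentSpace 𝓘(ℝ, E) p) :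
    TangentSpace 𝓘(ℝ, E) p :=
  let U : (x : M) → TangentSpace 𝓘(ℝ, E) x := FiberBundle.extend E u
  let V : (x : M) → TangentSpace 𝓘(ℝ, E) x := FiberBundle.extend E v
  let W : (x : M) → TangentSpace 𝓘(ℝ, E) x := FiberBundle.extend E w
  nabla (fun x ↦ nabla W x (V x)) p u - nabla (fun x ↦ nabla W x (U x)) p v
    - nabla W p (VectorField.mlieBracket 𝓘(ℝ, E) U V p)

instance finiteDimensional_tangentSpace [FiniteDimensional ℝ E] (p : M) :
    FiniteDimensional ℝ (TangentSpace 𝓘(ℝ, E) p) :=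
  inferInstanceAs (FiniteDimensional ℝ E)

/-- A smooth Riemannian metric on `M`; `g.inner p u v` is the scalar product of `u` and `v`. -/
abbrev Metric (E : Type*) [NormedAddCommGroup E] [NormedSpace ℝ E]
    (M : Type*) [TopologicalSpace M] [ChartedSpace E M] [IsManifold 𝓘(ℝ, E) ∞ M] :=
  ContMDiffRiemannianMetric 𝓘(ℝ, E) ∞ E (TangentSpace 𝓘(ℝ, E) : M → Type _)

variable [FiniteDimensional ℝ E] [CompleteSpace E]

/-- The Ricci tensor `Ric(v, w) = tr (u ↦ R(u, v) w)`; the trace is computed in a basis of the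
tangent space. -/
def ricci (nabla : AffineConnection E M) (p : M) (v w : TangentSpace 𝓘(ℝ, E) p) : ℝ :=
  let b := Module.finBasis ℝ (TangentSpace 𝓘(ℝ, E) p)
  ∑ i, b.repr (curvature nabla p (b i) v w) i

/-- The symmetric part of the Ricci tensor. -/
def ricciSymm (nabla : AffineConnection E M) (p : M) (v w : TangentSpace 𝓘(ℝ, E) p) : ℝ :=
  (ricci nabla p v w + ricci nabla p w v) / 2

/-- The scalar curvature, i.e. the trace of the Ricci tensor with respect to the metric: in a basis
`(bᵢ)` of the tangent space it is `∑ i j, gⁱʲ Ric(bᵢ, bⱼ)`, with `(gⁱʲ)` the inverse of the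
matrix of `g`. -/
def scalarCurvature (g : Metric E M) (nabla : AffineConnection E M) (p : M) : ℝ :=
  let b := Module.finBasis ℝ (TangentSpace 𝓘(ℝ, E) p)
  ∑ i, ∑ j, (Matrix.of fun k l ↦ g.inner p (b k) (b l))⁻¹ i j * ricci nabla p (b i) (b j)

/-- The connection `∇` is metric: `v ⟨σ, τ⟩ = ⟨∇_v σ, τ⟩ + ⟨σ, ∇_v τ⟩` for all tangent vectors `v`
and vector fields `σ, τ`. -/
def IsMetric (g : Metric E M) (nabla : AffineConnection E M) : Prop :=
  ∀ (p : M) (v : TangentSpace 𝓘(ℝ, E) p) (σ τ : (x : M) → TangentSpace 𝓘(ℝ, E) x),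
    MDifferentiableAt 𝓘(ℝ, E) 𝓘(ℝ, E).tangent (fun x ↦ (⟨x, σ x⟩ : TangentBundle 𝓘(ℝ, E) M)) p →
    MDifferentiableAt 𝓘(ℝ, E) 𝓘(ℝ, E).tangent (fun x ↦ (⟨x, τ x⟩ : TangentBundle 𝓘(ℝ, E) M)) p →
    mvfderiv 𝓘(ℝ, E) (fun x ↦ g.inner x (σ x) (τ x)) p v =
      g.inner p (nabla σ p v) (τ p) + g.inner p (σ p) (nabla τ p v)

/-- `(M, g, ∇, T)` is a `∇`-Einstein manifold with skew-torsion: `∇` is a metric connection, its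
torsion `T` is a 3-form (it is always skew in its first two arguments), and
`Ric_S = (Sca / n) g`, where `n = dim M`. -/
structure IsNablaEinstein (g : Metric E M) (nabla : AffineConnection E M) : Prop where
  metric : IsMetric g nabla
  skew : ∀ (p : M) (u v w : TangentSpace 𝓘(ℝ, E) p),
    g.inner p (nabla.torsion p u v) w = - g.inner p (nabla.torsion p u w) v
  einstein : ∀ (p : M) (u v : TangentSpace 𝓘(ℝ, E) p),
    ricciSymm nabla p u v =
      scalarCurvature g nabla p / (Module.finrank ℝ E : ℝ) * g.inner p u v

end Curvature

/-! ### Homogeneous spaces -/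

section Homogeneous

variable (EG : Type*) [NormedAddCommGroup EG] [NormedSpace ℝ EG] [CompleteSpace EG]
  (G : Type*) [TopologicalSpace G] [ChartedSpace EG G] [Group G] [LieGroup 𝓘(ℝ, EG) ∞ G]
  (E : Type*) [NormedAddCommGroup E] [NormedSpace ℝ E]

instance lieGroup_minSmoothness : LieGroup 𝓘(ℝ, EG) (minSmoothness ℝ 3) G :=
  LieGroup.of_le (n := ∞) (by
    rw [minSmoothness_of_isRCLikeNormedField]; exact ENat.LEInfty.out)

section Point

variable {M : Type*} [TopologicalSpace M] [ChartedSpace E M] [MulAction G M] (p : M)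

/-- The evaluation `X ↦ X*_p` of the fundamental vector fields of the action at `p`, i.e. the
differential at `1` of the orbit map `g ↦ g • p`. -/
def fundamental : GroupLieAlgebra 𝓘(ℝ, EG) G →ₗ[ℝ] TangentSpace 𝓘(ℝ, E) p :=
  (mfderiv 𝓘(ℝ, EG) 𝓘(ℝ, E) (fun g : G ↦ g • p) (1 : G)).toLinearMap

/-- The isotropy algebra `𝔨` at `p`: the Lie algebra of the stabilizer of `p`. -/
def isotropyAlgebra : Submodule ℝ (GroupLieAlgebra 𝓘(ℝ, EG) G) :=
  LinearMap.ker (fundamental EG G E p)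

/-- The complement `𝔪` of the isotropy algebra `𝔨` at `p` in the standard reductive decomposition:
the orthogonal space of `𝔨` for the Killing form. -/
def reductiveComplement : Submodule ℝ (GroupLieAlgebra 𝓘(ℝ, EG) G) :=
  (killingForm ℝ (GroupLieAlgebra 𝓘(ℝ, EG) G)).orthogonal (isotropyAlgebra EG G E p)

open Classical in
/-- The element `X` of `𝔪` with `X*_p = u`: the inverse of the identification of `𝔪` with the
tangent space at `p`. -/
def horizontalLift (u : TangentSpace 𝓘(ℝ, E) p) : GroupLieAlgebra 𝓘(ℝ, EG) G :=
  if h : ∃ X ∈ reductiveComplement EG G E p, fundamental EG G E p X = u then h.choose else 0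

/-- The torsion `T^c(X, Y) = - [X, Y]_𝔪` (for `X, Y ∈ 𝔪`) of the canonical connection, at every
point `p`, under the identification of `𝔪` with the tangent space at `p`. The `𝔨`-component
of `[X, Y]` need not be removed, since the fundamental vector fields of `𝔨` vanish at `p`. -/
def canonicalTorsion (u v : TangentSpace 𝓘(ℝ, E) p) : TangentSpace 𝓘(ℝ, E) p :=
  - fundamental EG G E p ⁅horizontalLift EG G E p u, horizontalLift EG G E p v⁆

end Point

variable (M : Type*) [TopologicalSpace M] [ChartedSpace E M] [MulAction G M]

/-- `M` is a homogeneous space of `G`, i.e. `M = G/K` as a smooth manifold: the action is smooth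
and transitive, and the orbit maps `G → M` are submersions. -/
structure IsHomogeneousSpace : Prop where
  smooth : ContMDiffSMul 𝓘(ℝ, EG) 𝓘(ℝ, E) ∞ G M
  transitive : MulAction.IsPretransitive G M
  submersion : ∀ p : M, Function.Surjective (fundamental EG G E p)

/-- The isotropy representation of the stabilizer of each point `p` on the tangent space at `p` is
irreducible over `ℝ`. The equation in the hypothesis on `W` says that `g • p = p` and that the
isotropy action of `g` sends `w` to `w'`. -/
def IsIsotropyIrreducible : Prop :=
  ∀ p : M, Nontrivial (TangentSpace 𝓘(ℝ, E) p) ∧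
    ∀ W : Submodule ℝ (TangentSpace 𝓘(ℝ, E) p),
      (∀ g : G, ∀ w ∈ W, ∀ w' : TangentSpace 𝓘(ℝ, E) p,
        tangentMap 𝓘(ℝ, E) 𝓘(ℝ, E) (fun x : M ↦ g • x) ⟨p, w⟩ = ⟨p, w'⟩ → w' ∈ W) →
      W = ⊥ ∨ W = ⊤

/-- `M = G/K` is a symmetric space of `G`, for the standard decomposition: `[𝔪, 𝔪] ⊆ 𝔨`. For
`G` compact with simple Lie algebra and `M` simply connected these are the symmetric spaces of
Type I. -/
def IsSymmetricPair : Prop :=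
  ∀ p : M, ∀ X ∈ reductiveComplement EG G E p, ∀ Y ∈ reductiveComplement EG G E p,
    ⁅X, Y⁆ ∈ isotropyAlgebra EG G E p

/-- The metric of `M = G/K` is the standard metric (Killing metric): under the identification of
`𝔪` with the tangent space at `p` it is the restriction to `𝔪` of the negative of the Killing
form. -/
def IsStandardMetric [IsManifold 𝓘(ℝ, E) ∞ M] (g : Metric E M) : Prop :=
  ∀ p : M, ∀ X ∈ reductiveComplement EG G E p, ∀ Y ∈ reductiveComplement EG G E p,
    g.inner p (fundamental EG G E p X) (fundamental EG G E p Y) =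
      - killingForm ℝ (GroupLieAlgebra 𝓘(ℝ, EG) G) X Y

/-- `∇` is the connection `∇^α`: the smooth metric connection with torsion `α T^c`. A metric
connection is determined by its torsion, so there is only one, and it is `G`-invariant because
the metric and `T^c` are. -/
structure IsNablaAlpha [FiniteDimensional ℝ E] [CompleteSpace E] [IsManifold 𝓘(ℝ, E) ∞ M]
    (g : Metric E M) (α : ℝ) (nabla : AffineConnection E M) : Prop where
  smooth : CovariantDerivative.ContMDiffCovariantDerivative nabla ∞
  metric : IsMetric g nabla
  torsion_eq : ∀ (p : M) (u v : TangentSpace 𝓘(ℝ, E) p),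
    nabla.torsion p u v = α • canonicalTorsion EG G E p u v

end Homogeneous

/-- The isomorphism `e` of groups identifies the Lie group `G` with the Lie group `H × ⋯ × H`
(`q` factors): the projections and the inclusions of the factors are smooth. -/
structure IsLieGroupPower (EG : Type*) [NormedAddCommGroup EG] [NormedSpace ℝ EG]
    (EH : Type*) [NormedAddCommGroup EH] [NormedSpace ℝ EH] {q : ℕ}
    {G : Type*} [TopologicalSpace G] [ChartedSpace EG G] [Group G]
    {H : Type*} [TopologicalSpace H] [ChartedSpace EH H] [Group H]
    (e : G ≃* (Fin q → H)) : Prop where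
  smooth_proj : ∀ i, ContMDiff 𝓘(ℝ, EG) 𝓘(ℝ, EH) ∞ (fun g : G ↦ e g i)
  smooth_incl : ∀ i, ContMDiff 𝓘(ℝ, EH) 𝓘(ℝ, EG) ∞ (fun h : H ↦ e.symm (Pi.mulSingle i h))

end StdHom

end

/-! Let `B` be the Killing form. For a compact group whose Lie algebra has trivial centre, `-B` is
an `Ad`-invariant scalar product (`negKilling_pos`). Hence at each point `p` the Lie algebra is the
orthogonal sum of the isotropy algebra and its complement `𝔪`, the evaluation `F` of fundamental
fields maps `𝔪` isomorphically onto the tangent space, and the inverse `θ` turns vector fields into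
functions with values in one fixed vector space.

Let `P` be the projection onto `𝔪`, which moves with the point. Its derivative is given by brackets
(`dP_apply`), and so is `dθ` (`dθ_apply`). It follows that `∇_v W = F (d(θ W) v + a [θ v, θ W])` is
metric with torsion `(1 + 2a) F [θ u, θ v]`. A metric connection is determined by its torsion
(`eq_cov`), so this is `∇^α` for `1 + 2a = -α`. Its curvature is algebraic in `θ u, θ v, θ w`
(`θ_curvature`), and tracing and symmetrizing give, with `X = θ v` and `Y = θ w` (`ricciSymm_eq`),
`Ric_S(v, w) = (1/2 + a + a²) tr(P ad X P ad Y) - 1/2 tr(ad X ad Y)`.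

The last term is `g / 2`. So the Einstein equation holds for every `α` once `tr(P ad X P ad Y)` is a
multiple of `B` on `𝔪`, a condition in which `α` does not occur. In the irreducible case this is
Schur's lemma (`exists_trace_eq_of_irreducible`). For `H × ⋯ × H` modulo the diagonal, `P = 1 - J`
with `J` the averaging over the `q` factors, `ad X` is block diagonal with blocks of sum zero, and
the trace equals `(1 - 2/q) B(X, Y)` (`trace_compress_blockDiag`). -/

noncomputable section

namespace StdHom

/-! ### Calculus of vector-valued functions and Lie brackets on a manifold. -/

section Calculus

set_option linter.unusedSectionVars false

open VectorField
open scoped Topology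

variable {E : Type*} [NormedAddCommGroup E] [NormedSpace ℝ E]
  {M : Type*} [TopologicalSpace M] [ChartedSpace E M]
  {V W Z : Type*} [NormedAddCommGroup V] [NormedSpace ℝ V] [NormedAddCommGroup W] [NormedSpace ℝ W]
  [NormedAddCommGroup Z] [NormedSpace ℝ Z] [IsManifold 𝓘(ℝ, E) ∞ M]

/-- The vector field `U` is differentiable at `p`. -/
abbrev FieldDiffAt (U : (x : M) → TangentSpace 𝓘(ℝ, E) x) (p : M) : Prop :=
  MDifferentiableAt 𝓘(ℝ, E) 𝓘(ℝ, E).tangent (fun x ↦ (⟨x, U x⟩ : TangentBundle 𝓘(ℝ, E) M)) p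

/-- The vector field `U` is smooth near `p`. -/
abbrev FieldSmoothAt (U : (x : M) → TangentSpace 𝓘(ℝ, E) x) (p : M) : Prop :=
  ContMDiffAt 𝓘(ℝ, E) 𝓘(ℝ, E).tangent ∞ (fun x ↦ (⟨x, U x⟩ : TangentBundle 𝓘(ℝ, E) M)) p

lemma FieldSmoothAt.fieldDiffAt
    {U : (x : M) → TangentSpace 𝓘(ℝ, E) x} {p : M} (h : FieldSmoothAt U p) : FieldDiffAt U p :=
  h.mdifferentiableAt (by simp)

/-- The derivative of a vector-valued function. -/
abbrev D (f : M → V) (x : M) (v : TangentSpace 𝓘(ℝ, E) x) : V := mvfderiv 𝓘(ℝ, E) f x v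

/-- The one product rule from which the Leibniz rules for the scalar product, the Lie bracket and
the application of `P` are deduced. -/
lemma D_bilin (B : V →L[ℝ] W →L[ℝ] Z) {f : M → V} {h : M → W} {x : M}
    (hf : MDifferentiableAt 𝓘(ℝ, E) 𝓘(ℝ, V) f x) (hh : MDifferentiableAt 𝓘(ℝ, E) 𝓘(ℝ, W) h x)
    (v : TangentSpace 𝓘(ℝ, E) x) :
    D (fun y ↦ B (f y) (h y)) x v = B (D f x v) (h x) + B (f x) (D h x v) := by
  have h1 : HasFDerivWithinAt (f ∘ (extChartAt 𝓘(ℝ, E) x).symm) (mvfderiv 𝓘(ℝ, E) f x)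
      (Set.range 𝓘(ℝ, E)) (extChartAt 𝓘(ℝ, E) x x) := hf.hasMFDerivAt.2
  have h2 : HasFDerivWithinAt (h ∘ (extChartAt 𝓘(ℝ, E) x).symm) (mvfderiv 𝓘(ℝ, E) h x)
      (Set.range 𝓘(ℝ, E)) (extChartAt 𝓘(ℝ, E) x x) := hh.hasMFDerivAt.2
  have h3 := B.hasFDerivWithinAt_of_bilinear h1 h2
  have key : HasMFDerivAt 𝓘(ℝ, E) 𝓘(ℝ, Z) (fun y ↦ B (f y) (h y)) x
      (B.precompR E (f x) (mvfderiv 𝓘(ℝ, E) h x) + B.precompL E (mvfderiv 𝓘(ℝ, E) f x) (h x)) := by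
    refine ⟨B.isBoundedBilinearMap.continuous.continuousAt.comp
        (f := fun y ↦ (f y, h y)) (hf.continuousAt.prodMk hh.continuousAt), ?_⟩
    rw [Function.comp_apply, Function.comp_apply, extChartAt_to_inv] at h3
    exact h3
  have h4 := congrArg (fun A : E →L[ℝ] Z ↦ A v) key.mfderiv
  rw [add_comm]
  exact h4

lemma mdifferentiableAt_bilin (B : V →L[ℝ] W →L[ℝ] Z) {f : M → V} {h : M → W} {x : M}
    (hf : MDifferentiableAt 𝓘(ℝ, E) 𝓘(ℝ, V) f x) (hh : MDifferentiableAt 𝓘(ℝ, E) 𝓘(ℝ, W) h x) :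
    MDifferentiableAt 𝓘(ℝ, E) 𝓘(ℝ, Z) (fun y ↦ B (f y) (h y)) x := by
  have hB : MDifferentiableAt 𝓘(ℝ, V × W) 𝓘(ℝ, Z) (fun q : V × W ↦ B q.1 q.2) (f x, h x) :=
    (B.isBoundedBilinearMap.differentiableAt _).mdifferentiableAt
  exact hB.comp x (hf.prodMk_space hh)

lemma contMDiffAt_bilin (B : V →L[ℝ] W →L[ℝ] Z) {f : M → V} {h : M → W} {x : M} {n : ℕ∞ω}
    (hf : ContMDiffAt 𝓘(ℝ, E) 𝓘(ℝ, V) n f x) (hh : ContMDiffAt 𝓘(ℝ, E) 𝓘(ℝ, W) n h x) :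
    ContMDiffAt 𝓘(ℝ, E) 𝓘(ℝ, Z) n (fun y ↦ B (f y) (h y)) x := by
  have hB : ContMDiffAt 𝓘(ℝ, V × W) 𝓘(ℝ, Z) n (fun q : V × W ↦ B q.1 q.2) (f x, h x) :=
    (B.isBoundedBilinearMap.contDiff.contDiffAt).contMDiffAt
  exact hB.comp x (hf.prodMk_space hh)

lemma D_congr {f h : M → V} {x : M} (e : f =ᶠ[𝓝 x] h) (v : TangentSpace 𝓘(ℝ, E) x) :
    D f x v = D h x v := by
  simp only [D, mvfderiv, e.mfderiv_eq]
  rfl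

lemma D_clm (A : V →L[ℝ] W) {f : M → V} {x : M} (hf : MDifferentiableAt 𝓘(ℝ, E) 𝓘(ℝ, V) f x)
    (v : TangentSpace 𝓘(ℝ, E) x) : D (fun y ↦ A (f y)) x v = A (D f x v) := by
  have := D_bilin (ContinuousLinearMap.apply ℝ W (E := V)) hf
    (mdifferentiableAt_const (c := A)) v
  simpa [D, mvfderiv_const] using this

lemma contMDiffAt_D {f : M → V} {U : (x : M) → TangentSpace 𝓘(ℝ, E) x} {p : M}
    (hf : ContMDiffAt 𝓘(ℝ, E) 𝓘(ℝ, V) ∞ f p) (hU : FieldSmoothAt U p) :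
    ContMDiffAt 𝓘(ℝ, E) 𝓘(ℝ, V) ∞ (fun x ↦ D f x (U x)) p := by
  have h1 := ContMDiffAt.mfderiv_const (m := ∞) hf (by simp)
  have h2 := ContMDiffAt.clm_apply_of_inCoordinates h1 hU hf
  exact (contMDiff_snd_tangentBundle_modelSpace V 𝓘(ℝ, V)).contMDiffAt.comp p h2

lemma D_comp_chart {h : E → V} {p x : M} (hx : x ∈ (extChartAt 𝓘(ℝ, E) p).source)
    (hh : DifferentiableAt ℝ h (extChartAt 𝓘(ℝ, E) p x)) (v : TangentSpace 𝓘(ℝ, E) x) :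
    D (fun y ↦ h (extChartAt 𝓘(ℝ, E) p y)) x v =
      fderiv ℝ h (extChartAt 𝓘(ℝ, E) p x) (mfderiv 𝓘(ℝ, E) 𝓘(ℝ, E) (extChartAt 𝓘(ℝ, E) p) x v) := by
  have h1 : MDifferentiableAt 𝓘(ℝ, E) 𝓘(ℝ, E) (extChartAt 𝓘(ℝ, E) p) x :=
    mdifferentiableAt_extChartAt (by simpa using hx)
  have := mfderiv_comp x hh.mdifferentiableAt h1
  simp only [D, mvfderiv]
  change (mfderiv 𝓘(ℝ, E) 𝓘(ℝ, V) (h ∘ (extChartAt 𝓘(ℝ, E) p)) x) v = _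
  rw [this, mfderiv_eq_fderiv]
  rfl

/-- The expression of a vector field in the chart at `p`. -/
def chartField (p : M) (U : (x : M) → TangentSpace 𝓘(ℝ, E) x) (y : E) : E :=
  mfderiv 𝓘(ℝ, E) 𝓘(ℝ, E) (extChartAt 𝓘(ℝ, E) p) ((extChartAt 𝓘(ℝ, E) p).symm y)
    (U ((extChartAt 𝓘(ℝ, E) p).symm y))

/-- The bracket on a manifold is defined by pulling fields back along the inverse chart. The
derivatives of the chart and of its inverse are mutually inverse, so near the base point this
pullback is the push-forward by the chart. -/
lemma mpullbackWithin_eventuallyEq_chartField (p : M) (U : (x : M) → TangentSpace 𝓘(ℝ, E) x) :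
    (mpullbackWithin 𝓘(ℝ, E) 𝓘(ℝ, E) (extChartAt 𝓘(ℝ, E) p).symm U (Set.range 𝓘(ℝ, E)) : E → E)
      =ᶠ[𝓝 (extChartAt 𝓘(ℝ, E) p p)] chartField p U := by
  filter_upwards [extChartAt_target_mem_nhds (I := 𝓘(ℝ, E)) p] with y hy
  have h1 := mfderiv_extChartAt_comp_mfderivWithin_extChartAt_symm hy
  have h2 := mfderivWithin_extChartAt_symm_comp_mfderiv_extChartAt hy
  simp only [mpullbackWithin, chartField]
  rw [ContinuousLinearMap.inverse_eq h2 h1]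
  rfl

lemma differentiableAt_chartField [CompleteSpace E] {p : M}
    {U : (x : M) → TangentSpace 𝓘(ℝ, E) x} (hU : FieldDiffAt U p) :
    DifferentiableAt ℝ (chartField p U) (extChartAt 𝓘(ℝ, E) p p) := by
  have h : MDifferentiableWithinAt 𝓘(ℝ, E) 𝓘(ℝ, E).tangent
      (fun x ↦ (⟨x, U x⟩ : TangentBundle 𝓘(ℝ, E) M)) Set.univ p := hU.mdifferentiableWithinAt
  have h2 := h.differentiableWithinAt_mpullbackWithin_vectorField
  have h3 : (extChartAt 𝓘(ℝ, E) p).symm ⁻¹' Set.univ ∩ Set.range 𝓘(ℝ, E) = Set.univ := by simp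
  rw [h3] at h2
  exact (mpullbackWithin_eventuallyEq_chartField p U).differentiableAt_iff.1
    (differentiableWithinAt_univ.1 h2)

/-- No correction term appears because the preferred chart at `p` has identity derivative at `p`. -/
lemma mlieBracket_eq_lieBracket_chartField {p : M}
    (U V : (x : M) → TangentSpace 𝓘(ℝ, E) x) :
    mlieBracket 𝓘(ℝ, E) U V p =
      lieBracket ℝ (chartField p U) (chartField p V) (extChartAt 𝓘(ℝ, E) p p) := by
  have h3 : (extChartAt 𝓘(ℝ, E) p).symm ⁻¹' Set.univ ∩ Set.range 𝓘(ℝ, E) = Set.univ := by simp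
  have h4 : mlieBracket 𝓘(ℝ, E) U V p = _ := mlieBracketWithin_apply (s := Set.univ)
  rw [mfderiv_extChartAt_self, h3] at h4
  have h6 := congrFun (lieBracketWithin_univ (𝕜 := ℝ)
    (V := (mpullbackWithin 𝓘(ℝ, E) 𝓘(ℝ, E) (extChartAt 𝓘(ℝ, E) p).symm U
      (Set.range 𝓘(ℝ, E)) : E → E))
    (W := (mpullbackWithin 𝓘(ℝ, E) 𝓘(ℝ, E) (extChartAt 𝓘(ℝ, E) p).symm V
      (Set.range 𝓘(ℝ, E)) : E → E))) (extChartAt 𝓘(ℝ, E) p p)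
  have h5 := Filter.EventuallyEq.lieBracket_vectorField_eq (𝕜 := ℝ)
    (mpullbackWithin_eventuallyEq_chartField p U) (mpullbackWithin_eventuallyEq_chartField p V)
  exact (h4.trans (congrArg (fun A : E →L[ℝ] E ↦ A _) ContinuousLinearMap.inverse_id)).trans
    (h6.trans h5)

lemma chartField_apply {p x : M} (hx : x ∈ (extChartAt 𝓘(ℝ, E) p).source)
    (U : (x : M) → TangentSpace 𝓘(ℝ, E) x) :
    chartField p U (extChartAt 𝓘(ℝ, E) p x) =
      mfderiv 𝓘(ℝ, E) 𝓘(ℝ, E) (extChartAt 𝓘(ℝ, E) p) x (U x) := by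
  have key : ∀ x', x' = x → (mfderiv 𝓘(ℝ, E) 𝓘(ℝ, E) (extChartAt 𝓘(ℝ, E) p) x' (U x') : E) =
      mfderiv 𝓘(ℝ, E) 𝓘(ℝ, E) (extChartAt 𝓘(ℝ, E) p) x (U x) := by
    rintro x' rfl; rfl
  exact key _ ((extChartAt 𝓘(ℝ, E) p).left_inv hx)

/-- An identity of germs, not only at `p`, since both sides are differentiated once more in
`D_mlieBracket`. -/
lemma D_eventuallyEq_fderiv {f : M → V} {p : M}
    (hf : ContMDiffAt 𝓘(ℝ, E) 𝓘(ℝ, V) ∞ f p) (U : (x : M) → TangentSpace 𝓘(ℝ, E) x) :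
    (fun x ↦ D f x (U x)) =ᶠ[𝓝 p] fun x ↦
      fderiv ℝ (f ∘ (extChartAt 𝓘(ℝ, E) p).symm) (extChartAt 𝓘(ℝ, E) p x)
        (chartField p U (extChartAt 𝓘(ℝ, E) p x)) := by
  have h1 : ∀ᶠ x in 𝓝 p, ContMDiffAt 𝓘(ℝ, E) 𝓘(ℝ, V) 1 f x :=
    contMDiffAt_iff_contMDiffAt_nhds (by simp) |>.1 (hf.of_le (m := 1) (by simp))
  have hs := extChartAt_source_mem_nhds (I := 𝓘(ℝ, E)) p
  filter_upwards [h1, hs] with x hx hxs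
  have h2 : DifferentiableAt ℝ (f ∘ (extChartAt 𝓘(ℝ, E) p).symm) (extChartAt 𝓘(ℝ, E) p x) := by
    have h3 : MDifferentiableAt 𝓘(ℝ, E) 𝓘(ℝ, E) (extChartAt 𝓘(ℝ, E) p).symm
        (extChartAt 𝓘(ℝ, E) p x) := by
      have := contMDiffOn_extChartAt_symm (I := 𝓘(ℝ, E)) (n := 1) p
      exact (this.contMDiffAt ((isOpen_extChartAt_target p).mem_nhds
        ((extChartAt 𝓘(ℝ, E) p).map_source hxs))).mdifferentiableAt (by simp)
    refine (MDifferentiableAt.comp (extChartAt 𝓘(ℝ, E) p x) ?_ h3).differentiableAt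
    rw [(extChartAt 𝓘(ℝ, E) p).left_inv hxs]
    exact hx.mdifferentiableAt (by simp)
  rw [chartField_apply hxs, ← D_comp_chart hxs h2]
  refine (D_congr ?_ _).symm
  filter_upwards [(isOpen_extChartAt_source (I := 𝓘(ℝ, E)) p).mem_nhds hxs] with y hy
  simp only [Function.comp_apply, (extChartAt 𝓘(ℝ, E) p).left_inv hy]

/-- The Lie bracket of vector fields is the commutator of derivations. -/
lemma D_mlieBracket [CompleteSpace E] {f : M → V} {p : M}
    (hf : ContMDiffAt 𝓘(ℝ, E) 𝓘(ℝ, V) ∞ f p) {U W : (x : M) → TangentSpace 𝓘(ℝ, E) x}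
    (hU : FieldDiffAt U p) (hW : FieldDiffAt W p) :
    D f p (mlieBracket 𝓘(ℝ, E) U W p) =
      D (fun x ↦ D f x (W x)) p (U p) - D (fun x ↦ D f x (U x)) p (W p) := by
  have hp := mem_extChartAt_source (I := 𝓘(ℝ, E)) p
  set φ := extChartAt 𝓘(ℝ, E) p
  set F : E → V := f ∘ φ.symm
  have hF : ContDiffAt ℝ ∞ F (φ p) := by
    have h1 : ContMDiffAt 𝓘(ℝ, E) 𝓘(ℝ, E) ∞ φ.symm (φ p) :=
      (contMDiffOn_extChartAt_symm (I := 𝓘(ℝ, E)) p).contMDiffAt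
        (extChartAt_target_mem_nhds p)
    refine (ContMDiffAt.comp (φ p) ?_ h1).contDiffAt
    rwa [φ.left_inv hp]
  have key : ∀ {Y Y' : (x : M) → TangentSpace 𝓘(ℝ, E) x}, FieldDiffAt Y p →
      D (fun x ↦ D f x (Y x)) p (Y' p) =
        fderiv ℝ (fun y ↦ fderiv ℝ F y (chartField p Y y)) (φ p) (chartField p Y' (φ p)) := by
    intro Y Y' hY
    have h2 : DifferentiableAt ℝ (fun y ↦ fderiv ℝ F y (chartField p Y y)) (φ p) :=
      DifferentiableAt.clm_apply
        ((hF.fderiv_right (m := 1) (by rw [one_add_one_eq_two]; exact ENat.LEInfty.out)).differentiableAt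
          (by simp))
        (differentiableAt_chartField hY)
    rw [D_congr (D_eventuallyEq_fderiv hf Y), chartField_apply hp]
    exact D_comp_chart hp h2 _
  have h0 := (D_eventuallyEq_fderiv hf (mlieBracket 𝓘(ℝ, E) U W)).eq_of_nhds
  beta_reduce at h0
  rw [key hW, key hU, h0, chartField_apply hp, mfderiv_extChartAt_self]
  -- The vector-space case `fderiv_apply_lieBracket`, i.e. the symmetry of the second derivative of
  -- `F`.
  exact (congrArg _ (mlieBracket_eq_lieBracket_chartField U W)).trans
    (fderiv_apply_lieBracket hF
      (by rw [minSmoothness_of_isRCLikeNormedField]; exact ENat.LEInfty.out)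
      (differentiableAt_chartField hW)
      (differentiableAt_chartField hU))

variable {E' : Type*} [NormedAddCommGroup E'] [NormedSpace ℝ E']
  {M' : Type*} [TopologicalSpace M'] [ChartedSpace E' M'] [IsManifold 𝓘(ℝ, E') ∞ M']

lemma D_comp {h : M' → V} {f : M → M'} {p : M}
    (hh : MDifferentiableAt 𝓘(ℝ, E') 𝓘(ℝ, V) h (f p))
    (hf : MDifferentiableAt 𝓘(ℝ, E) 𝓘(ℝ, E') f p) (v : TangentSpace 𝓘(ℝ, E) p) :
    D (fun x ↦ h (f x)) p v = D h (f p) (mfderiv 𝓘(ℝ, E) 𝓘(ℝ, E') f p v) := by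
  have := mfderiv_comp p hh hf
  exact congrArg (fun A : E →L[ℝ] V ↦ A v) this

/-- If the vector fields `U`, `W` are `f`-related to `U'`, `W'`, so are the Lie brackets. -/
lemma mfderiv_mlieBracket_of_related [CompleteSpace E] [CompleteSpace E'] {f : M → M'} {p : M}
    (hf : ContMDiffAt 𝓘(ℝ, E) 𝓘(ℝ, E') ∞ f p)
    {U W : (x : M) → TangentSpace 𝓘(ℝ, E) x} {U' W' : (x : M') → TangentSpace 𝓘(ℝ, E') x}
    (hU : FieldDiffAt U p) (hW : FieldDiffAt W p) (hU' : FieldSmoothAt U' (f p))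
    (hW' : FieldSmoothAt W' (f p))
    (eU : ∀ᶠ x in 𝓝 p, mfderiv 𝓘(ℝ, E) 𝓘(ℝ, E') f x (U x) = U' (f x))
    (eW : ∀ᶠ x in 𝓝 p, mfderiv 𝓘(ℝ, E) 𝓘(ℝ, E') f x (W x) = W' (f x)) :
    mfderiv 𝓘(ℝ, E) 𝓘(ℝ, E') f p (mlieBracket 𝓘(ℝ, E) U W p) =
      mlieBracket 𝓘(ℝ, E') U' W' (f p) := by
  -- Both sides are tested on the chart at `f p`; its derivative there is the identity, so it
  -- detects tangent vectors.
  let ψ : M' → E' := fun z ↦ extChartAt 𝓘(ℝ, E') (f p) z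
  have hψs : ContMDiffAt 𝓘(ℝ, E') 𝓘(ℝ, E') ∞ ψ (f p) := contMDiffAt_extChartAt
  have hψn : ∀ᶠ x in 𝓝 p, MDifferentiableAt 𝓘(ℝ, E') 𝓘(ℝ, E') ψ (f x) :=
    hf.continuousAt.eventually (((contMDiffAt_iff_contMDiffAt_nhds (by simp)).1
      (hψs.of_le (m := 1) (by simp))).mono fun x hx ↦ hx.mdifferentiableAt (by simp))
  have hfn : ∀ᶠ x in 𝓝 p, MDifferentiableAt 𝓘(ℝ, E) 𝓘(ℝ, E') f x :=
    (((contMDiffAt_iff_contMDiffAt_nhds (by simp)).1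
      (hf.of_le (m := 1) (by simp))).mono fun x hx ↦ hx.mdifferentiableAt (by simp))
  have hf1 := hfn.self_of_nhds
  have key : ∀ {Y : (x : M) → TangentSpace 𝓘(ℝ, E) x} {Y' : (x : M') → TangentSpace 𝓘(ℝ, E') x},
      FieldSmoothAt Y' (f p) → (∀ᶠ x in 𝓝 p, mfderiv 𝓘(ℝ, E) 𝓘(ℝ, E') f x (Y x) = Y' (f x)) →
      ∀ v, D (fun x ↦ D (fun y ↦ ψ (f y)) x (Y x)) p v =
        D (fun z ↦ D ψ z (Y' z)) (f p) (mfderiv 𝓘(ℝ, E) 𝓘(ℝ, E') f p v) := by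
    intro Y Y' hY' eY v
    rw [← D_comp ((contMDiffAt_D hψs hY').mdifferentiableAt (by simp)) hf1]
    refine D_congr ?_ v
    filter_upwards [hψn, hfn, eY] with x h1 h2 h3
    rw [D_comp h1 h2, h3]
  have h1 := D_mlieBracket (hψs.comp p hf) hU hW
  have h2 := D_mlieBracket hψs hU'.fieldDiffAt hW'.fieldDiffAt
  rw [Function.comp_def, D_comp hψn.self_of_nhds hf1, key hW' eW, key hU' eU,
    eU.self_of_nhds, eW.self_of_nhds, ← h2] at h1
  have h3 : ∀ v : TangentSpace 𝓘(ℝ, E') (f p), D ψ (f p) v = v := by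
    intro v
    exact congrArg (fun A : E' →L[ℝ] E' ↦ A v) (mfderiv_extChartAt_self (I := 𝓘(ℝ, E')) (x := f p))
  rw [h3] at h1
  exact h1.trans (h3 _)

end Calculus

end StdHom
end

noncomputable section

namespace StdHom

/-! ### The tangent bundle inside a Lie algebra of Killing fields: derivatives of `P` and `θ`. -/

section KillingFrame

set_option linter.unusedSectionVars false

open VectorField
open scoped Topology

variable {E : Type*} [NormedAddCommGroup E] [NormedSpace ℝ E]
  {M : Type*} [TopologicalSpace M] [ChartedSpace E M] [IsManifold 𝓘(ℝ, E) ∞ M]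

/-- A Lie algebra of vector fields on `M`, spanning every tangent space, with an invariant scalar
product `ip` from which the metric `g` is induced: the tangent space at `x` is identified by `θ`
with the orthogonal complement of the kernel of the evaluation `F` at `x`. -/
structure KillingFrame (g : Metric E M) (V : Type*) [NormedAddCommGroup V] [NormedSpace ℝ V] where
  br : V →L[ℝ] V →L[ℝ] V
  ip : V →L[ℝ] V →L[ℝ] ℝ
  F : ∀ x : M, V →L[ℝ] TangentSpace 𝓘(ℝ, E) x
  θ : ∀ x : M, TangentSpace 𝓘(ℝ, E) x →L[ℝ] V
  br_skew : ∀ X Y, br X Y = - br Y X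
  jacobi : ∀ X Y Z, br (br X Y) Z = br X (br Y Z) - br Y (br X Z)
  ip_symm : ∀ X Y, ip X Y = ip Y X
  ip_br : ∀ X Y Z, ip (br X Y) Z = - ip Y (br X Z)
  ip_nondeg : ∀ X, (∀ Y, ip X Y = 0) → X = 0
  F_θ : ∀ x u, F x (θ x u) = u
  ip_θ : ∀ x u Y, ip (θ x u) Y = g.inner x u (F x Y)
  smooth : ∀ Y p, FieldSmoothAt (fun x ↦ F x Y) p
  bracket : ∀ X Y p, mlieBracket 𝓘(ℝ, E) (fun x ↦ F x X) (fun x ↦ F x Y) p = - F p (br X Y)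

namespace KillingFrame

variable {g : Metric E M} {V : Type*} [NormedAddCommGroup V] [NormedSpace ℝ V]
  (K : KillingFrame g V)

/-- The orthogonal projection to the complement of the isotropy algebra at `x`. -/
def P (x : M) : V →L[ℝ] V := (K.θ x).comp (K.F x)

lemma P_apply (x : M) (X : V) : K.P x X = K.θ x (K.F x X) := rfl

lemma F_P (x : M) (X : V) : K.F x (K.P x X) = K.F x X := K.F_θ x _

lemma P_θ (x : M) (u : TangentSpace 𝓘(ℝ, E) x) : K.P x (K.θ x u) = K.θ x u := by
  rw [P_apply, F_θ]

lemma P_P (x : M) (X : V) : K.P x (K.P x X) = K.P x X := K.P_θ x _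

/-- Both sides equal `g (F X) (F Y)`, so `P` is an orthogonal projection. -/
lemma ip_P (x : M) (X Y : V) : K.ip (K.P x X) Y = K.ip X (K.P x Y) := by
  rw [P_apply, K.ip_θ, K.ip_symm X, P_apply, K.ip_θ, g.symm]

lemma inner_eq (x : M) (u v : TangentSpace 𝓘(ℝ, E) x) :
    g.inner x u v = K.ip (K.θ x u) (K.θ x v) := by
  rw [K.ip_θ, K.F_θ]

lemma ext_ip {X Y : V} (h : ∀ Z, K.ip X Z = K.ip Y Z) : X = Y := by
  rw [← sub_eq_zero]
  exact K.ip_nondeg _ fun Z ↦ by simp [h]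

/-- The expression of a vector field as a function with values in the Lie algebra. -/
def lift (U : (x : M) → TangentSpace 𝓘(ℝ, E) x) (x : M) : V := K.θ x (U x)

variable [FiniteDimensional ℝ V]

/-- Smoothness of `θ` is not part of the structure. It comes from this expansion with constant
vectors `c i`, whose coefficients involve only `g` and the smooth fields `F b_i`. -/
lemma exists_θ_eq_sum : ∃ (c : Fin (Module.finrank ℝ V) → V), ∀ x (u : TangentSpace 𝓘(ℝ, E) x),
    K.θ x u = ∑ i, g.inner x u (K.F x (Module.finBasis ℝ V i)) • c i := by
  set b := Module.finBasis ℝ V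
  let A : V →ₗ[ℝ] (Fin (Module.finrank ℝ V) → ℝ) :=
    LinearMap.pi fun i ↦ (K.ip.flip (b i)).toLinearMap
  have hA : LinearMap.ker A = ⊥ := by
    rw [LinearMap.ker_eq_bot']
    intro X hX
    refine K.ip_nondeg X fun Y ↦ ?_
    have h : (K.ip X).toLinearMap = 0 := b.ext fun i ↦ congrFun hX i
    exact congrArg (fun l : V →ₗ[ℝ] ℝ ↦ l Y) h
  -- The vectors `L e_i` form the basis dual to `b` for `ip`.
  obtain ⟨L, hL⟩ := A.exists_leftInverse_of_injective hA
  refine ⟨fun i ↦ L (Pi.single i 1), fun x u ↦ ?_⟩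
  have h1 : L (A (K.θ x u)) = K.θ x u := congrArg (fun l : V →ₗ[ℝ] V ↦ l (K.θ x u)) hL
  rw [← h1, ← (Pi.basisFun ℝ _).sum_repr (A (K.θ x u)), map_sum]
  refine Finset.sum_congr rfl fun i _ ↦ ?_
  rw [map_smul, Pi.basisFun_apply, Pi.basisFun_repr]
  congr 1
  exact K.ip_θ x u (b i)

lemma contMDiffAt_inner {U W : (x : M) → TangentSpace 𝓘(ℝ, E) x} {p : M} (hU : FieldSmoothAt U p)
    (hW : FieldSmoothAt W p) : ContMDiffAt 𝓘(ℝ, E) 𝓘(ℝ, ℝ) ∞ (fun x ↦ g.inner x (U x) (W x)) p := by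
  have h := ContMDiffAt.clm_bundle_apply₂ (F₁ := E) (F₂ := E) (F₃ := ℝ)
    (E₁ := fun x : M ↦ TangentSpace 𝓘(ℝ, E) x) (E₂ := fun x : M ↦ TangentSpace 𝓘(ℝ, E) x)
    (E₃ := Bundle.Trivial M ℝ) (IB := 𝓘(ℝ, E)) (IM := 𝓘(ℝ, E)) (b := id) (x := p)
    (g.contMDiff.contMDiffAt (x := p)) hU hW
  exact (contMDiffAt_totalSpace.1 h).2

lemma mdifferentiableAt_inner {U W : (x : M) → TangentSpace 𝓘(ℝ, E) x} {p : M}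
    (hU : FieldDiffAt U p) (hW : FieldDiffAt W p) :
    MDifferentiableAt 𝓘(ℝ, E) 𝓘(ℝ, ℝ) (fun x ↦ g.inner x (U x) (W x)) p := by
  have h := MDifferentiableAt.clm_bundle_apply₂ (F₁ := E) (F₂ := E) (F₃ := ℝ)
    (E₁ := fun x : M ↦ TangentSpace 𝓘(ℝ, E) x) (E₂ := fun x : M ↦ TangentSpace 𝓘(ℝ, E) x)
    (E₃ := Bundle.Trivial M ℝ) (IB := 𝓘(ℝ, E)) (IM := 𝓘(ℝ, E)) (b := id) (x := p)
    ((g.contMDiff.contMDiffAt (x := p)).mdifferentiableAt (by simp)) hU hW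
  exact ((mdifferentiableAt_totalSpace _ _).1 h).2

lemma contMDiffAt_lift {U : (x : M) → TangentSpace 𝓘(ℝ, E) x} {p : M} (hU : FieldSmoothAt U p) :
    ContMDiffAt 𝓘(ℝ, E) 𝓘(ℝ, V) ∞ (K.lift U) p := by
  obtain ⟨c, hc⟩ := K.exists_θ_eq_sum
  have : K.lift U = fun x ↦ ∑ i, g.inner x (U x) (K.F x (Module.finBasis ℝ V i)) • c i :=
    funext fun x ↦ hc x (U x)
  rw [this]
  exact contMDiffAt_finsetSum fun i _ ↦
    (contMDiffAt_inner hU (K.smooth _ p)).smul contMDiffAt_const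

lemma mdifferentiableAt_lift {U : (x : M) → TangentSpace 𝓘(ℝ, E) x} {p : M}
    (hU : FieldDiffAt U p) : MDifferentiableAt 𝓘(ℝ, E) 𝓘(ℝ, V) (K.lift U) p := by
  obtain ⟨c, hc⟩ := K.exists_θ_eq_sum
  have : K.lift U = fun x ↦ ∑ i, g.inner x (U x) (K.F x (Module.finBasis ℝ V i)) • c i :=
    funext fun x ↦ hc x (U x)
  rw [this, show (fun x ↦ ∑ i, g.inner x (U x) (K.F x (Module.finBasis ℝ V i)) • c i) =
    ∑ i, fun x ↦ g.inner x (U x) (K.F x (Module.finBasis ℝ V i)) • c i by ext x; simp]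
  exact MDifferentiableAt.sum fun i _ ↦ mdifferentiableAt_bilin (ContinuousLinearMap.lsmul ℝ ℝ)
    (mdifferentiableAt_inner hU (K.smooth _ p).fieldDiffAt) mdifferentiableAt_const

lemma fieldSmoothAt_F {s : M → V} {p : M} (hs : ContMDiffAt 𝓘(ℝ, E) 𝓘(ℝ, V) ∞ s p) :
    FieldSmoothAt (fun x ↦ K.F x (s x)) p := by
  set b := Module.finBasis ℝ V
  have : (fun x ↦ K.F x (s x)) = fun x ↦ ∑ i, b.repr (s x) i • K.F x (b i) := by
    funext x
    conv_lhs => rw [← b.sum_repr (s x)]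
    simp only [map_sum, map_smul]
  unfold FieldSmoothAt
  simp only [congrFun this]
  refine ContMDiffAt.sum_section fun i _ ↦ ContMDiffAt.smul_section ?_ (K.smooth _ p)
  exact ((b.coord i).toContinuousLinearMap.contDiff.contMDiff.contMDiffAt).comp p hs

lemma contMDiffAt_P (p : M) : ContMDiffAt 𝓘(ℝ, E) 𝓘(ℝ, V →L[ℝ] V) ∞ K.P p := by
  set b := Module.finBasis ℝ V
  have : K.P = fun x ↦ ∑ i, ContinuousLinearMap.smulRightL ℝ V V
      (b.coord i).toContinuousLinearMap (K.lift (fun x ↦ K.F x (b i)) x) := by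
    funext x
    ext X
    conv_lhs => rw [← b.sum_repr X]
    simp only [map_sum, map_smul, P_apply]
    simp [lift]
  rw [this]
  refine contMDiffAt_finsetSum fun i _ ↦ ?_
  exact ((ContinuousLinearMap.smulRightL ℝ V V
      (b.coord i).toContinuousLinearMap).contDiff.contMDiff.contMDiffAt).comp p
    (K.contMDiffAt_lift (K.smooth _ p))

/-- The exterior derivative of the one-form `θ`. -/
def dθ (p : M) (U W : (x : M) → TangentSpace 𝓘(ℝ, E) x) : V :=
  D (K.lift W) p (U p) - D (K.lift U) p (W p) - K.θ p (mlieBracket 𝓘(ℝ, E) U W p)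

lemma lift_smul (f : M → ℝ) (U : (x : M) → TangentSpace 𝓘(ℝ, E) x) :
    K.lift (f • U) = f • K.lift U := by
  ext x; simp [lift]

lemma lift_add (U W : (x : M) → TangentSpace 𝓘(ℝ, E) x) :
    K.lift (U + W) = K.lift U + K.lift W := by
  ext x; simp [lift]

variable [CompleteSpace E]

lemma dθ_swap (p : M) (U W : (x : M) → TangentSpace 𝓘(ℝ, E) x) :
    K.dθ p U W = - K.dθ p W U := by
  rw [dθ, dθ, mlieBracket_swap_apply]
  simp only [map_neg]
  abel

/-- The term `-(W f) θ U` from differentiating `θ (f U)` cancels against the one from `[f U, W] = f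
[U, W] - (W f) U`. -/
lemma tensorialAt_dθ_left (p : M) (W : (x : M) → TangentSpace 𝓘(ℝ, E) x) :
    TensorialAt 𝓘(ℝ, E) E (K.dθ p · W) p where
  smul {f U} hf hU := by
    have h1 := mvfderiv_smul hf (K.mdifferentiableAt_lift hU)
    simp only [dθ, lift_smul, D, h1, mlieBracket_smul_left hf hU]
    simp [lift]
    module
  add {U U'} hU hU' := by
    have h1 := mvfderiv_add (K.mdifferentiableAt_lift hU) (K.mdifferentiableAt_lift hU')
    simp only [dθ, lift_add, D, h1, mlieBracket_add_left hU hU']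
    simp
    abel

lemma tensorialAt_dθ_right (p : M) (U : (x : M) → TangentSpace 𝓘(ℝ, E) x) :
    TensorialAt 𝓘(ℝ, E) E (K.dθ p U ·) p where
  smul hf hU := by
    rw [dθ_swap, (K.tensorialAt_dθ_left p U).smul hf hU, dθ_swap]; simp
  add hU hU' := by
    rw [dθ_swap, (K.tensorialAt_dθ_left p U).add hU hU', neg_add,
      ← K.dθ_swap p U, ← K.dθ_swap p U]

variable [FiniteDimensional ℝ E]

/-- Allows `dθ` to be evaluated on any convenient extensions, in particular on Killing fields. -/
lemma dθ_congr {p : M} {U U' W W' : (x : M) → TangentSpace 𝓘(ℝ, E) x} (hU : FieldDiffAt U p)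
    (hU' : FieldDiffAt U' p) (hW : FieldDiffAt W p) (hW' : FieldDiffAt W' p) (h : U p = U' p)
    (h' : W p = W' p) : K.dθ p U W = K.dθ p U' W' :=
  TensorialAt.pointwise₂ (fun τ _ ↦ K.tensorialAt_dθ_left p τ) (fun σ _ ↦ K.tensorialAt_dθ_right p σ)
    hU hU' hW hW' h h'

lemma dθ_F (p : M) (X Y : V) : K.dθ p (fun x ↦ K.F x X) (fun x ↦ K.F x Y) =
    D (fun x ↦ K.P x Y) p (K.F p X) - D (fun x ↦ K.P x X) p (K.F p Y) + K.P p (K.br X Y) := by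
  rw [dθ, K.bracket, map_neg, sub_neg_eq_add]
  rfl

/-- The derivative of the projection in the direction of `u`. -/
def dP (p : M) (u : TangentSpace 𝓘(ℝ, E) p) : V →L[ℝ] V := D K.P p u

lemma mdifferentiableAt_P (p : M) : MDifferentiableAt 𝓘(ℝ, E) 𝓘(ℝ, V →L[ℝ] V) K.P p :=
  (K.contMDiffAt_P p).mdifferentiableAt (by simp)

lemma D_P_apply {s : M → V} {p : M} (hs : MDifferentiableAt 𝓘(ℝ, E) 𝓘(ℝ, V) s p)
    (u : TangentSpace 𝓘(ℝ, E) p) :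
    D (fun x ↦ K.P x (s x)) p u = K.dP p u (s p) + K.P p (D s p u) := by
  have := D_bilin (ContinuousLinearMap.id ℝ (V →L[ℝ] V)) (K.mdifferentiableAt_P p) hs u
  exact this

lemma D_P_const (p : M) (Y : V) (u : TangentSpace 𝓘(ℝ, E) p) :
    D (fun x ↦ K.P x Y) p u = K.dP p u Y := by
  have := K.D_P_apply (s := fun _ ↦ Y) mdifferentiableAt_const u (p := p)
  simpa [D, mvfderiv_const] using this

lemma mdifferentiableAt_P_apply {s : M → V} {p : M}
    (hs : MDifferentiableAt 𝓘(ℝ, E) 𝓘(ℝ, V) s p) :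
    MDifferentiableAt 𝓘(ℝ, E) 𝓘(ℝ, V) (fun x ↦ K.P x (s x)) p := by
  have := mdifferentiableAt_bilin (ContinuousLinearMap.id ℝ (V →L[ℝ] V))
    (K.mdifferentiableAt_P p) hs
  simpa using this

/-- Derivative of `P = P ∘ P`; it implies that `dP` maps the image of `P` into its kernel. -/
lemma dP_eq (p : M) (u : TangentSpace 𝓘(ℝ, E) p) (Y : V) :
    K.dP p u Y = K.dP p u (K.P p Y) + K.P p (K.dP p u Y) := by
  have h1 : (fun x ↦ K.P x Y) = fun x ↦ K.P x (K.P x Y) := by ext x; rw [P_P]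
  have h2 := K.D_P_apply (K.mdifferentiableAt_P_apply (s := fun _ ↦ Y) mdifferentiableAt_const) u
    (p := p)
  rw [← h1, D_P_const] at h2
  exact h2

/-- Derivative of the self-adjointness of `P`. -/
lemma ip_dP (p : M) (u : TangentSpace 𝓘(ℝ, E) p) (Y Z : V) :
    K.ip (K.dP p u Y) Z = K.ip Y (K.dP p u Z) := by
  have h (Y Z : V) : D (fun x ↦ K.ip Z (K.P x Y)) p u = K.ip Z (K.dP p u Y) := by
    rw [D_clm (K.ip Z) (K.mdifferentiableAt_P_apply (s := fun _ ↦ Y) mdifferentiableAt_const),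
      D_P_const]
  rw [K.ip_symm, ← h Y Z, ← h Z Y]
  congr 1
  ext x
  rw [K.ip_symm, K.ip_P]

/-- The Killing field of `Y` vanishes at `p`, so by tensoriality `dθ (F θu, F Y)` is zero there;
`dθ_F` turns this into the formula. -/
lemma dP_ker (p : M) (u : TangentSpace 𝓘(ℝ, E) p) {Y : V} (hY : K.F p Y = 0) :
    K.dP p u Y = - K.P p (K.br (K.θ p u) Y) := by
  have h1 := K.dθ_F p (K.θ p u) Y
  have h2 : K.dθ p (fun x ↦ K.F x (K.θ p u)) (fun x ↦ K.F x Y) =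
      K.dθ p (fun x ↦ K.F x (K.θ p u)) (fun x ↦ K.F x (0 : V)) :=
    K.dθ_congr (K.smooth _ p).fieldDiffAt (K.smooth _ p).fieldDiffAt
      (K.smooth _ p).fieldDiffAt (K.smooth _ p).fieldDiffAt rfl (by simp [hY])
  rw [h2, dθ_F, D_P_const, D_P_const, D_P_const, D_P_const, hY, F_θ] at h1
  have h3 (Z : V) : K.dP p 0 Z = 0 := by simp [dP, D]
  simp only [map_zero, h3, sub_zero, add_zero] at h1
  exact eq_neg_of_add_eq_zero_left h1.symm

/-- On the kernel of `P` this is `dP_ker`. On the image of `P`, `dP` takes values in the kernel, and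
these are found by pairing with the kernel and moving `dP` across by `ip_dP`. -/
lemma dP_apply (p : M) (u : TangentSpace 𝓘(ℝ, E) p) (Z : V) :
    K.dP p u Z = - K.P p (K.br (K.θ p u) (Z - K.P p Z)) +
      (K.br (K.θ p u) (K.P p Z) - K.P p (K.br (K.θ p u) (K.P p Z))) := by
  have hker (Z : V) : K.F p (Z - K.P p Z) = 0 := by rw [map_sub, F_P, sub_self]
  rw [← K.dP_ker p u (hker Z)]
  have key : K.dP p u (K.P p Z) =
      K.br (K.θ p u) (K.P p Z) - K.P p (K.br (K.θ p u) (K.P p Z)) := by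
    set Y := K.P p Z
    have hY : K.P p Y = Y := K.P_P p Z
    have h0 : K.P p (K.dP p u Y) = 0 := by
      have := K.dP_eq p u Y
      rw [hY] at this
      simpa using this
    refine K.ext_ip fun W ↦ ?_
    have h1 : K.ip (K.dP p u Y) W = K.ip (K.dP p u Y) (W - K.P p W) := by
      rw [map_sub, ← K.ip_P, h0]; simp
    rw [h1, ip_dP, dP_ker _ _ _ (hker W), map_neg, ← K.ip_P, hY, ← K.ip_br]
    simp only [map_sub, sub_apply]
    rw [K.ip_P]
  rw [← key, ← map_add, sub_add_cancel]

/-- Replace the fields by the Killing fields with the same values at `p`. Each of the two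
derivatives in `dθ_F` contributes the isotropy component of `[θU, θW]`, and the bracket of fields
contributes its `𝔪`-component. -/
lemma dθ_apply {p : M} {U W : (x : M) → TangentSpace 𝓘(ℝ, E) x} (hU : FieldDiffAt U p)
    (hW : FieldDiffAt W p) : K.dθ p U W =
      (2 : ℝ) • K.br (K.lift U p) (K.lift W p) - K.P p (K.br (K.lift U p) (K.lift W p)) := by
  have h2 : K.dθ p U W = K.dθ p (fun x ↦ K.F x (K.lift U p)) (fun x ↦ K.F x (K.lift W p)) :=
    K.dθ_congr hU (K.smooth _ p).fieldDiffAt hW (K.smooth _ p).fieldDiffAt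
      (K.F_θ _ _).symm (K.F_θ _ _).symm
  have hP (U : (x : M) → TangentSpace 𝓘(ℝ, E) x) : K.P p (K.lift U p) = K.lift U p := K.P_θ _ _
  have hθ (U : (x : M) → TangentSpace 𝓘(ℝ, E) x) : K.θ p (K.F p (K.lift U p)) = K.lift U p :=
    K.P_θ _ _
  rw [h2, dθ_F, D_P_const, D_P_const, dP_apply, dP_apply, hP, hP, hθ, hθ,
    K.br_skew (K.lift W p) (K.lift U p)]
  simp only [sub_self, map_zero, neg_zero, map_neg]
  module

end KillingFrame
end KillingFrame
end StdHom
end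

noncomputable section

namespace StdHom

/-! ### The one-parameter family of metric connections, and uniqueness for given torsion. -/

section Connection

set_option linter.unusedSectionVars false

open VectorField
open scoped Topology

variable {E : Type*} [NormedAddCommGroup E] [NormedSpace ℝ E] [CompleteSpace E]
  [FiniteDimensional ℝ E]
  {M : Type*} [TopologicalSpace M] [ChartedSpace E M] [IsManifold 𝓘(ℝ, E) ∞ M]
  {g : Metric E M} {V : Type*} [NormedAddCommGroup V] [NormedSpace ℝ V] [FiniteDimensional ℝ V]

namespace KillingFrame

variable (K : KillingFrame g V) (a : ℝ)

/-- The connection `∇_v W = F (d (θ W) v + a [θ v, θ W])`. -/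
def cov (W : (x : M) → TangentSpace 𝓘(ℝ, E) x) (x : M) :
    TangentSpace 𝓘(ℝ, E) x →L[ℝ] TangentSpace 𝓘(ℝ, E) x :=
  (K.F x).comp (mvfderiv 𝓘(ℝ, E) (K.lift W) x + a • (K.br.flip (K.lift W x)).comp (K.θ x))

lemma cov_apply (W : (x : M) → TangentSpace 𝓘(ℝ, E) x) (x : M) (v : TangentSpace 𝓘(ℝ, E) x) :
    K.cov a W x v = K.F x (D (K.lift W) x v + a • K.br (K.θ x v) (K.lift W x)) := rfl

lemma isCovariantDerivativeOn_cov :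
    IsCovariantDerivativeOn E (I := 𝓘(ℝ, E)) (V := (TangentSpace 𝓘(ℝ, E) : M → Type _))
      (K.cov a) Set.univ where
  add {σ σ' x} hσ hσ' _ := by
    have h1 := mvfderiv_add (K.mdifferentiableAt_lift hσ) (K.mdifferentiableAt_lift hσ')
    ext v
    simp only [cov_apply, lift_add, D, h1]
    simp [cov_apply, D]
    abel
  leibniz {σ f x} hσ hf _ := by
    have h1 := mvfderiv_smul hf (K.mdifferentiableAt_lift hσ)
    have h2 : K.F x (K.lift σ x) = σ x := K.F_θ _ _
    ext v
    simp only [cov_apply, lift_smul, D, h1]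
    simp [cov_apply, D, h2]
    module

/-- Product rule for `ip (θσ) (θτ)`. The projection hidden in `F` is invisible when paired with a
lift, and the two terms with `a` cancel because `ip` is `ad`-invariant. -/
lemma cov_metric (p : M) (v : TangentSpace 𝓘(ℝ, E) p) {σ τ : (x : M) → TangentSpace 𝓘(ℝ, E) x}
    (hσ : FieldDiffAt σ p) (hτ : FieldDiffAt τ p) :
    mvfderiv 𝓘(ℝ, E) (fun x ↦ g.inner x (σ x) (τ x)) p v =
      g.inner p (K.cov a σ p v) (τ p) + g.inner p (σ p) (K.cov a τ p v) := by
  have h1 : (fun x ↦ g.inner x (σ x) (τ x)) = fun x ↦ K.ip (K.lift σ x) (K.lift τ x) := by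
    ext x; exact K.inner_eq x _ _
  have h2 := D_bilin K.ip (K.mdifferentiableAt_lift hσ) (K.mdifferentiableAt_lift hτ) v
  rw [← h1] at h2
  have hP (U : (x : M) → TangentSpace 𝓘(ℝ, E) x) : K.P p (K.lift U p) = K.lift U p := K.P_θ _ _
  have h3 : ∀ X (U : (x : M) → TangentSpace 𝓘(ℝ, E) x),
      g.inner p (K.F p X) (U p) = K.ip X (K.lift U p) := by
    intro X U
    rw [K.inner_eq, ← P_apply, K.ip_P, P_θ]; rfl
  refine h2.trans ?_
  rw [g.symm p (σ p), cov_apply, cov_apply, h3, h3, K.ip_symm (D (K.lift τ) p v + _)]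
  simp only [map_add, map_smul, add_apply, smul_apply, smul_eq_mul, K.ip_br]
  ring

/-- Applying `F` to `dθ_apply` gives the summand `1`; the bracket term of the connection contributes
`a` twice, by skew-symmetry. -/
lemma cov_torsion (p : M) {U W : (x : M) → TangentSpace 𝓘(ℝ, E) x} (hU : FieldDiffAt U p)
    (hW : FieldDiffAt W p) :
    K.cov a W p (U p) - K.cov a U p (W p) - mlieBracket 𝓘(ℝ, E) U W p =
      (1 + 2 * a) • K.F p (K.br (K.lift U p) (K.lift W p)) := by
  have h1 := congrArg (K.F p) (K.dθ_apply hU hW)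
  rw [dθ, map_sub, map_sub, K.F_θ, map_sub, F_P, map_smul] at h1
  rw [cov_apply, cov_apply]
  have h2 : K.θ p (U p) = K.lift U p := rfl
  have h3 : K.θ p (W p) = K.lift W p := rfl
  rw [h2, h3, K.br_skew (K.lift W p) (K.lift U p)]
  simp only [map_add, map_smul, map_neg]
  rw [sub_sub, sub_eq_iff_eq_add] at h1
  rw [h1]
  module

/-- A metric connection with torsion `(1 + 2 a) [θ u, θ v]` is the connection `cov a`. -/
theorem eq_cov (nabla : AffineConnection E M) (hm : IsMetric g nabla)
    (ht : ∀ (p : M) (u v : TangentSpace 𝓘(ℝ, E) p),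
      nabla.torsion p u v = (1 + 2 * a) • K.F p (K.br (K.θ p u) (K.θ p v)))
    {p : M} {W : (x : M) → TangentSpace 𝓘(ℝ, E) x} (hW : FieldDiffAt W p) :
    nabla W p = K.cov a W p := by
  -- The difference of two connections is a tensor. Being metric makes `g (A u v) w` skew in `u, w`;
  -- equal torsions make it symmetric in `u, v`.
  set A := IsCovariantDerivativeOn.difference nabla.isCovariantDerivativeOn
    (K.isCovariantDerivativeOn_cov a) p
  have hA : ∀ {σ : (x : M) → TangentSpace 𝓘(ℝ, E) x}, FieldDiffAt σ p →
      A (σ p) = nabla σ p - K.cov a σ p := fun {σ} hσ ↦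
    IsCovariantDerivativeOn.difference_apply nabla.isCovariantDerivativeOn
      (K.isCovariantDerivativeOn_cov a) (by trivial) hσ
  have hext (v : TangentSpace 𝓘(ℝ, E) p) : FieldDiffAt (FiberBundle.extend E v) p :=
    FiberBundle.mdifferentiableAt_extend ..
  have hself (v : TangentSpace 𝓘(ℝ, E) p) : FiberBundle.extend E v p = v :=
    FiberBundle.extend_apply_self ..
  have skew : ∀ u v w : TangentSpace 𝓘(ℝ, E) p,
      g.inner p (A u v) w = - g.inner p (A w v) u := by
    intro u v w
    have h1 := hm p v _ _ (hext u) (hext w)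
    have h2 := K.cov_metric a p v (hext u) (hext w)
    have h3 := hA (hext u)
    have h4 := hA (hext w)
    simp only [hself] at h1 h2 h3 h4
    rw [h3, h4, g.symm p _ u]
    simp only [sub_apply, map_sub]
    linarith
  have symm : ∀ u v : TangentSpace 𝓘(ℝ, E) p, A u v = A v u := by
    intro u v
    have h1 := ht p v u
    have h2 := K.cov_torsion a p (hext v) (hext u)
    rw [CovariantDerivative.torsion_apply_eq_extend] at h1
    have h3 := hA (hext u)
    have h4 := hA (hext v)
    simp only [hself, lift] at h1 h2 h3 h4
    rw [h3, h4]
    simp only [sub_apply]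
    rw [← h2, sub_left_inj, sub_eq_sub_iff_add_eq_add] at h1
    rw [sub_eq_sub_iff_add_eq_add, h1, add_comm]
  have zero : ∀ u v : TangentSpace 𝓘(ℝ, E) p, A u v = 0 := by
    intro u v
    by_contra h
    have h1 : ∀ w, g.inner p (A u v) w = 0 := by
      intro w
      -- A trilinear form symmetric in one pair of slots and skew in another vanishes: three
      -- alternating swaps return the form with the opposite sign.
      have e1 := skew u v w
      have e2 := skew v w u
      have e3 := skew w u v
      rw [symm w v] at e1
      rw [symm u w] at e2
      rw [symm v u] at e3
      linarith
    exact (g.pos p _ h).ne' (h1 _)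
  have := hA hW
  rw [← sub_eq_zero, ← this]
  ext v
  exact zero _ _

end KillingFrame
end Connection
end StdHom
end

noncomputable section

namespace StdHom

/-! ### Curvature of the connections in terms of brackets. -/

section CurvatureFormula

set_option linter.unusedSectionVars false

open VectorField
open scoped Topology

variable {E : Type*} [NormedAddCommGroup E] [NormedSpace ℝ E] [CompleteSpace E]
  [FiniteDimensional ℝ E]
  {M : Type*} [TopologicalSpace M] [ChartedSpace E M] [IsManifold 𝓘(ℝ, E) ∞ M]
  {g : Metric E M} {V : Type*} [NormedAddCommGroup V] [NormedSpace ℝ V] [FiniteDimensional ℝ V]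

namespace KillingFrame

variable (K : KillingFrame g V) (a : ℝ)

/-- The connection `cov a` in the direction of a vector field `U`, as a function with values in
the Lie algebra, before projection. -/
def covLift (W U : (x : M) → TangentSpace 𝓘(ℝ, E) x) (x : M) : V :=
  D (K.lift W) x (U x) + a • K.br (K.lift U x) (K.lift W x)

lemma contMDiffAt_covLift {W U : (x : M) → TangentSpace 𝓘(ℝ, E) x} {p : M}
    (hW : FieldSmoothAt W p) (hU : FieldSmoothAt U p) :
    ContMDiffAt 𝓘(ℝ, E) 𝓘(ℝ, V) ∞ (K.covLift a W U) p :=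
  (contMDiffAt_D (K.contMDiffAt_lift hW) hU).add
    (contMDiffAt_bilin (a • K.br) (K.contMDiffAt_lift hU) (K.contMDiffAt_lift hW))

lemma D_covLift {W U : (x : M) → TangentSpace 𝓘(ℝ, E) x} {p : M}
    (hW : FieldSmoothAt W p) (hU : FieldSmoothAt U p) (v : TangentSpace 𝓘(ℝ, E) p) :
    D (K.covLift a W U) p v = D (fun x ↦ D (K.lift W) x (U x)) p v +
      a • (K.br (D (K.lift U) p v) (K.lift W p) + K.br (K.lift U p) (D (K.lift W) p v)) := by
  have h1 := (contMDiffAt_D (K.contMDiffAt_lift hW) hU).mdifferentiableAt (by simp)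
  have hU' := K.mdifferentiableAt_lift hU.fieldDiffAt
  have hW' := K.mdifferentiableAt_lift hW.fieldDiffAt
  have h2 := mvfderiv_add h1 (mdifferentiableAt_bilin (a • K.br) hU' hW')
  have h3 := D_bilin (a • K.br) hU' hW' v
  have h4 := congrArg (fun A : TangentSpace 𝓘(ℝ, E) p →L[ℝ] V ↦ A v) h2
  refine h4.trans ?_
  simp only [add_apply]
  refine congrArg₂ (· + ·) rfl (h3.trans ?_)
  simp [smul_add]

variable (nabla : AffineConnection E M)
    (hn : ∀ {p : M} {W : (x : M) → TangentSpace 𝓘(ℝ, E) x}, FieldDiffAt W p →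
      nabla W p = K.cov a W p)

include hn

lemma eventuallyEq_F_covLift {W : (x : M) → TangentSpace 𝓘(ℝ, E) x} {p : M}
    (hW : FieldSmoothAt W p) (U : (x : M) → TangentSpace 𝓘(ℝ, E) x) :
    ∀ᶠ x in 𝓝 p, nabla W x (U x) = K.F x (K.covLift a W U x) := by
  filter_upwards [(contMDiffAt_iff_contMDiffAt_nhds (by simp)).1 (hW.of_le (m := 1) (by simp))]
    with x hx
  rw [hn (hx.mdifferentiableAt (by simp)), cov_apply]
  rfl

lemma fieldSmoothAt_nabla {W U : (x : M) → TangentSpace 𝓘(ℝ, E) x} {p : M}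
    (hW : FieldSmoothAt W p) (hU : FieldSmoothAt U p) :
    FieldSmoothAt (fun x ↦ nabla W x (U x)) p := by
  refine (K.fieldSmoothAt_F (K.contMDiffAt_covLift a hW hU)).congr_of_eventuallyEq ?_
  filter_upwards [K.eventuallyEq_F_covLift a nabla hn hW U] with x hx
  rw [hx]

/-- The lift of `∇_U W` is `P s` with `s` the unprojected `covLift`, so a second derivative also
differentiates `P`. Of `dP s`, the part with values in the isotropy algebra is killed by the outer
projection, leaving `-[θv, s - P s]`. -/
lemma θ_nabla_nabla {W U : (x : M) → TangentSpace 𝓘(ℝ, E) x} {p : M}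
    (hW : FieldSmoothAt W p) (hU : FieldSmoothAt U p) (v : TangentSpace 𝓘(ℝ, E) p) :
    K.θ p (nabla (fun x ↦ nabla W x (U x)) p v) =
      K.P p (- K.br (K.θ p v) (K.covLift a W U p - K.P p (K.covLift a W U p)) +
        D (K.covLift a W U) p v + a • K.br (K.θ p v) (K.P p (K.covLift a W U p))) := by
  have hs := (K.contMDiffAt_covLift a hW hU).mdifferentiableAt (by simp)
  have he := K.eventuallyEq_F_covLift a nabla hn hW U
  have h1 : K.lift (fun x ↦ nabla W x (U x)) =ᶠ[𝓝 p] fun x ↦ K.P x (K.covLift a W U x) := by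
    filter_upwards [he] with x hx
    rw [lift, hx]; rfl
  rw [hn (K.fieldSmoothAt_nabla a nabla hn hW hU).fieldDiffAt, cov_apply, D_congr h1,
    h1.eq_of_nhds, K.D_P_apply hs, ← P_apply, dP_apply]
  simp only [map_add, map_neg, map_sub, P_P, sub_self, add_zero]

/-- The curvature of the connection `cov a`. -/
theorem θ_curvature (p : M) (u v w : TangentSpace 𝓘(ℝ, E) p) :
    K.θ p (curvature nabla p u v w) =
      K.P p (- (1 + a) ^ 2 • K.br (K.θ p u) (K.br (K.θ p v) (K.θ p w) -
          K.P p (K.br (K.θ p v) (K.θ p w))) +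
        (1 + a) ^ 2 • K.br (K.θ p v) (K.br (K.θ p u) (K.θ p w) -
          K.P p (K.br (K.θ p u) (K.θ p w))) +
        a • K.br ((2 : ℝ) • K.br (K.θ p u) (K.θ p v) - K.P p (K.br (K.θ p u) (K.θ p v))) (K.θ p w) +
        a ^ 2 • K.br (K.br (K.θ p u) (K.θ p v)) (K.θ p w)) := by
  obtain ⟨U, hU, hUp, hUe⟩ : ∃ U : (x : M) → TangentSpace 𝓘(ℝ, E) x,
      FieldSmoothAt U p ∧ U p = u ∧ U = FiberBundle.extend E u :=
    ⟨_, FiberBundle.contMDiffAt_extend .., FiberBundle.extend_apply_self .., rfl⟩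
  obtain ⟨U', hV, hVp, hVe⟩ : ∃ U : (x : M) → TangentSpace 𝓘(ℝ, E) x,
      FieldSmoothAt U p ∧ U p = v ∧ U = FiberBundle.extend E v :=
    ⟨_, FiberBundle.contMDiffAt_extend .., FiberBundle.extend_apply_self .., rfl⟩
  obtain ⟨W, hW, hWp, hWe⟩ : ∃ U : (x : M) → TangentSpace 𝓘(ℝ, E) x,
      FieldSmoothAt U p ∧ U p = w ∧ U = FiberBundle.extend E w :=
    ⟨_, FiberBundle.contMDiffAt_extend .., FiberBundle.extend_apply_self .., rfl⟩
  have hc : curvature nabla p u v w = nabla (fun x ↦ nabla W x (U' x)) p u -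
      nabla (fun x ↦ nabla W x (U x)) p v - nabla W p (mlieBracket 𝓘(ℝ, E) U U' p) := by
    rw [hUe, hVe, hWe]; rfl
  have lU : K.lift U p = K.θ p u := congrArg (K.θ p) hUp
  have lV : K.lift U' p = K.θ p v := congrArg (K.θ p) hVp
  have lW : K.lift W p = K.θ p w := congrArg (K.θ p) hWp
  have h1 := K.θ_nabla_nabla a nabla hn hW hV u
  have h2 := K.θ_nabla_nabla a nabla hn hW hU v
  rw [K.D_covLift a hW hV] at h1
  rw [K.D_covLift a hW hU] at h2
  have h3 : K.θ p (nabla W p (mlieBracket 𝓘(ℝ, E) U U' p)) = K.P p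
      (D (K.lift W) p (mlieBracket 𝓘(ℝ, E) U U' p) +
        a • K.br (K.θ p (mlieBracket 𝓘(ℝ, E) U U' p)) (K.lift W p)) := by
    rw [hn hW.fieldDiffAt]; rfl
  rw [D_mlieBracket (K.contMDiffAt_lift hW) hU.fieldDiffAt hV.fieldDiffAt, hUp, hVp] at h3
  have h4 := K.dθ_apply hU.fieldDiffAt hV.fieldDiffAt
  rw [dθ, hUp, hVp] at h4
  -- Differentiating `θW = P (θW)` shows that the isotropy component of the derivative of `θW` is
  -- algebraic. This removes the first derivatives of `θW` left after `D_mlieBracket` has cancelled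
  -- the second ones; the derivatives of `θU` and `θV` combine to `dθ`.
  have h5 : ∀ z : TangentSpace 𝓘(ℝ, E) p, D (K.lift W) p z - K.P p (D (K.lift W) p z) =
      K.br (K.θ p z) (K.θ p w) - K.P p (K.br (K.θ p z) (K.θ p w)) := by
    intro z
    have e1 : K.lift W = fun x ↦ K.P x (K.lift W x) := by
      ext x; exact (K.P_θ _ _).symm
    have e2 := K.D_P_apply (K.mdifferentiableAt_lift hW.fieldDiffAt) z
    rw [← e1, dP_apply, lW, P_θ] at e2
    simp only [sub_self, map_zero, neg_zero, zero_add] at e2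
    conv_lhs => rw [e2]
    simp only [map_add, map_sub, P_P]
    abel
  have cV : K.covLift a W U' p = D (K.lift W) p v + a • K.br (K.θ p v) (K.θ p w) := by
    simp only [covLift, lV, lW, hVp]
  have cU : K.covLift a W U p = D (K.lift W) p u + a • K.br (K.θ p u) (K.θ p w) := by
    simp only [covLift, lU, lW, hUp]
  rw [hc, map_sub, map_sub, h1, h2, h3, ← map_sub, ← map_sub, cV, cU]
  rw [lU, lV] at h4
  rw [sub_eq_iff_eq_add, sub_eq_iff_eq_add] at h4
  have h5u := h5 u
  have h5v := h5 v
  rw [sub_eq_iff_eq_add] at h5u h5v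
  rw [lU, lV, lW, h4]
  congr 1
  set X := K.θ p u
  set Y := K.θ p v
  set Z := K.θ p w
  -- The terms `[Y, [X,Z] - P[X,Z]]` carry `1 + 2a` and the terms `[Y, P[X,Z]]` carry `-a²`.
  -- Completing the first coefficient to `(1 + a)²` leaves `-a² [Y, [X,Z]]`, which with its
  -- counterpart is `a² [[X,Y], Z]` by Jacobi.
  have hj := K.jacobi X Y Z
  rw [h5u, h5v, hj]
  simp only [map_add, map_sub, map_smul, P_P, add_apply, sub_apply, smul_apply, smul_add,
    smul_sub, neg_sub]
  rw [hj]
  module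

end KillingFrame
end CurvatureFormula
end StdHom
end

noncomputable section

namespace StdHom

/-! ### Ricci tensor and the algebraic criterion for the Einstein equation. -/

section Einstein

set_option linter.unusedSectionVars false

open VectorField
open scoped Topology

variable {E : Type*} [NormedAddCommGroup E] [NormedSpace ℝ E] [CompleteSpace E]
  [FiniteDimensional ℝ E]
  {M : Type*} [TopologicalSpace M] [ChartedSpace E M] [IsManifold 𝓘(ℝ, E) ∞ M]
  {g : Metric E M} {V : Type*} [NormedAddCommGroup V] [NormedSpace ℝ V] [FiniteDimensional ℝ V]

lemma ricci_eq_trace (nabla : AffineConnection E M) (p : M) (v w : TangentSpace 𝓘(ℝ, E) p)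
    (R : TangentSpace 𝓘(ℝ, E) p →ₗ[ℝ] TangentSpace 𝓘(ℝ, E) p)
    (hR : ∀ u, curvature nabla p u v w = R u) : ricci nabla p v w = LinearMap.trace ℝ _ R := by
  rw [LinearMap.trace_eq_matrix_trace ℝ (Module.finBasis ℝ (TangentSpace 𝓘(ℝ, E) p)), ricci]
  simp only [Matrix.trace, Matrix.diag, LinearMap.toMatrix_apply, hR]

/-- The inverse Gram matrix is symmetric, so its contraction with `Ric` sees only `Ric_S`, and `tr
(G⁻¹ G)` is the dimension. -/
lemma scalarCurvature_of_ricciSymm (nabla : AffineConnection E M) (p : M) (c : ℝ)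
    (h : ∀ u v : TangentSpace 𝓘(ℝ, E) p, ricciSymm nabla p u v = c * g.inner p u v) :
    scalarCurvature g nabla p = c * Module.finrank ℝ E := by
  set b := Module.finBasis ℝ (TangentSpace 𝓘(ℝ, E) p) with hb
  set G : Matrix _ _ ℝ := Matrix.of fun k l ↦ g.inner p (b k) (b l) with hG
  have hGs : G.transpose = G := by
    ext i j
    exact g.symm p _ _
  have hdet : IsUnit G.det := by
    rw [isUnit_iff_ne_zero]
    intro h0
    obtain ⟨v, hv, hv0⟩ := Matrix.exists_mulVec_eq_zero_iff.2 h0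
    have h1 : g.inner p (∑ i, v i • b i) (∑ i, v i • b i) = v ⬝ᵥ G.mulVec v := by
      simp only [map_sum, map_smul, sum_apply, smul_apply, smul_eq_mul, dotProduct, Matrix.mulVec,
        hG, Matrix.of_apply, Finset.mul_sum]
      rw [Finset.sum_comm]
      exact Finset.sum_congr rfl fun i _ ↦ Finset.sum_congr rfl fun j _ ↦ by ring
    rw [hv0, dotProduct_zero] at h1
    have h2 : ∑ i, v i • b i ≠ 0 := by
      intro h3
      exact hv (funext (Fintype.linearIndependent_iff.1 b.linearIndependent v h3))
    exact (g.pos p _ h2).ne' h1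
  have hGi : (G⁻¹).transpose = G⁻¹ := by rw [Matrix.transpose_nonsing_inv, hGs]
  have e1 : scalarCurvature g nabla p = ∑ i, ∑ j, G⁻¹ i j * ricci nabla p (b i) (b j) := rfl
  have e2 : scalarCurvature g nabla p = ∑ i, ∑ j, G⁻¹ i j * ricci nabla p (b j) (b i) := by
    rw [e1, Finset.sum_comm]
    refine Finset.sum_congr rfl fun i _ ↦ Finset.sum_congr rfl fun j _ ↦ ?_
    rw [← hGi, Matrix.transpose_apply, hGi]
  have e3 : scalarCurvature g nabla p = ∑ i, ∑ j, G⁻¹ i j * ricciSymm nabla p (b i) (b j) := by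
    have : ∑ i, ∑ j, G⁻¹ i j * ricciSymm nabla p (b i) (b j) =
        (∑ i, ∑ j, G⁻¹ i j * ricci nabla p (b i) (b j) +
          ∑ i, ∑ j, G⁻¹ i j * ricci nabla p (b j) (b i)) / 2 := by
      simp only [← Finset.sum_add_distrib, Finset.sum_div, ricciSymm]
      exact Finset.sum_congr rfl fun i _ ↦ Finset.sum_congr rfl fun j _ ↦ by ring
    rw [this, ← e1, ← e2]; ring
  have e4 : ∑ i, ∑ j, G⁻¹ i j * ricciSymm nabla p (b i) (b j) = c * (G⁻¹ * G).trace := by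
    simp only [Matrix.trace, Matrix.diag, Matrix.mul_apply, Finset.mul_sum, h]
    refine Finset.sum_congr rfl fun i _ ↦ Finset.sum_congr rfl fun j _ ↦ ?_
    have : G j i = g.inner p (b i) (b j) := g.symm p _ _
    rw [this]; ring
  rw [e3, e4, Matrix.nonsing_inv_mul _ hdet, Matrix.trace_one, Fintype.card_fin]
  rfl

lemma einstein_of_ricciSymm (nabla : AffineConnection E M) (p : M) (c : ℝ)
    (h : ∀ u v : TangentSpace 𝓘(ℝ, E) p, ricciSymm nabla p u v = c * g.inner p u v)
    (u v : TangentSpace 𝓘(ℝ, E) p) : ricciSymm nabla p u v =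
      scalarCurvature g nabla p / (Module.finrank ℝ E : ℝ) * g.inner p u v := by
  rw [h u v, scalarCurvature_of_ricciSymm nabla p c h]
  -- In dimension zero the quotient by the dimension is a division by zero, but then `u = 0` and
  -- both sides vanish.
  by_cases hn : Module.finrank ℝ E = 0
  · have : Subsingleton E := Module.finrank_zero_iff.1 hn
    have hu : u = 0 := Subsingleton.elim (α := E) _ _
    simp [hu]
  · have : (Module.finrank ℝ E : ℝ) ≠ 0 := by exact_mod_cast hn
    field_simp

namespace KillingFrame

variable (K : KillingFrame g V) (a : ℝ)

/-- The adjoint action. -/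
def adj (X : V) : Module.End ℝ V := (K.br X).toLinearMap

/-- The projection `P`, as an endomorphism. -/
def proj (x : M) : Module.End ℝ V := (K.P x).toLinearMap

lemma proj_mul_proj (x : M) : K.proj x * K.proj x = K.proj x := by
  ext X; exact K.P_P x X

/-- Two vector fields which vanish at a point have a bracket vanishing there, so the isotropy
algebra is a subalgebra. -/
lemma F_br_eq_zero (x : M) {X Y : V} (hX : K.F x X = 0) (hY : K.F x Y = 0) :
    K.F x (K.br X Y) = 0 := by
  have h := K.bracket X Y x
  have h0 : mlieBracketWithin 𝓘(ℝ, E) (fun x ↦ K.F x X) (fun x ↦ K.F x Y) Set.univ x = 0 :=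
    mlieBracketWithin_eq_zero_of_eq_zero (V := fun x ↦ K.F x X) (W := fun x ↦ K.F x Y) hX hY
  rw [← mlieBracketWithin_univ, h0] at h
  exact neg_eq_zero.1 h.symm

/-- This is reductivity, `[𝔪, 𝔨] ⊆ 𝔪`: by invariance of `ip` it is dual to `[𝔨, 𝔨] ⊆ 𝔨`. -/
lemma compl_mul_adj_mul_compl (x : M) {Y : V} (hY : K.P x Y = Y) :
    (1 - K.proj x) * K.adj Y * (1 - K.proj x) = 0 := by
  ext X
  refine K.ext_ip fun Z ↦ ?_
  have hker (Z : V) : K.F x (Z - K.P x Z) = 0 := by rw [map_sub, F_P, sub_self]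
  have hP (W Z : V) : K.ip (W - K.P x W) Z = K.ip W (Z - K.P x Z) := by
    rw [map_sub, map_sub, sub_apply, K.ip_P]
  change K.ip (K.br Y (X - K.P x X) - K.P x (K.br Y (X - K.P x X))) Z = K.ip 0 Z
  rw [hP, K.br_skew, map_neg, neg_apply, K.ip_br, neg_neg, ← hY, K.ip_P, P_apply,
    K.F_br_eq_zero x (hker X) (hker Z)]
  simp

variable (nabla : AffineConnection E M)
    (hn : ∀ {p : M} {W : (x : M) → TangentSpace 𝓘(ℝ, E) x}, FieldDiffAt W p →
      nabla W p = K.cov a W p)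

include hn

/-- By `θ_curvature`, `u ↦ R(u, v) w` has the form `F ∘ Ψ ∘ θ`; cyclicity turns its trace on the
tangent space into the trace of `Ψ P` on the Lie algebra. -/
lemma ricci_eq (p : M) (v w : TangentSpace 𝓘(ℝ, E) p) :
    ricci nabla p v w =
      (1 + a) ^ 2 * LinearMap.trace ℝ V (K.proj p * K.adj (K.br (K.θ p v) (K.θ p w) -
          K.P p (K.br (K.θ p v) (K.θ p w)))) -
      (1 + a) ^ 2 * LinearMap.trace ℝ V (K.proj p * K.adj (K.θ p v) * K.adj (K.θ p w)) +
      (2 * a + a ^ 2) * LinearMap.trace ℝ V (K.proj p * K.adj (K.θ p w) * K.adj (K.θ p v)) +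
      ((1 + a) ^ 2 - a) *
        LinearMap.trace ℝ V (K.proj p * K.adj (K.θ p v) * K.proj p * K.adj (K.θ p w)) := by
  set Y := K.θ p v
  set Z := K.θ p w
  set q := K.proj p with hq
  set A := K.adj Y
  set B := K.adj Z
  set C := K.adj (K.br Y Z - K.P p (K.br Y Z))
  -- The curvature formula with `θ u` brought to the last slot of each bracket, so that it reads as
  -- an endomorphism applied to `θ u`.
  let Ψ : Module.End ℝ V := q * ((1 + a) ^ 2 • C - (1 + a) ^ 2 • (A * (1 - q) * B) +
    (2 * a + a ^ 2) • (B * A) - a • (B * q * A))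
  have hR : ∀ u, curvature nabla p u v w =
      ((K.F p).toLinearMap ∘ₗ Ψ ∘ₗ (K.θ p).toLinearMap) u := by
    intro u
    rw [← K.F_θ p (curvature nabla p u v w), K.θ_curvature a nabla hn]
    change K.F p _ = K.F p (K.P p _)
    congr 2
    simp only [LinearMap.sub_apply, LinearMap.add_apply, LinearMap.smul_apply]
    change _ = (1 + a) ^ 2 • K.br (K.br Y Z - K.P p (K.br Y Z)) (K.θ p u) -
      (1 + a) ^ 2 • K.br Y (K.br Z (K.θ p u) - K.P p (K.br Z (K.θ p u))) +
      (2 * a + a ^ 2) • K.br Z (K.br Y (K.θ p u)) - a • K.br Z (K.P p (K.br Y (K.θ p u)))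
    rw [K.br_skew (K.br Y Z - _) (K.θ p u), K.br_skew Z (K.br Y _), K.br_skew Z (K.P p _),
      K.br_skew Y (K.θ p u), K.br_skew Z (K.θ p u)]
    simp only [map_sub, map_neg, map_smul, sub_apply, neg_apply, smul_apply]
    module
  rw [ricci_eq_trace nabla p v w _ hR, LinearMap.trace_comp_comm']
  have hΨ : (Ψ ∘ₗ (K.θ p).toLinearMap) ∘ₗ (K.F p).toLinearMap = Ψ * q := rfl
  rw [hΨ]
  have hp : ∀ X : Module.End ℝ V, LinearMap.trace ℝ V (q * X * q) = LinearMap.trace ℝ V (q * X) := by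
    intro X
    rw [LinearMap.trace_mul_comm, ← mul_assoc, hq, proj_mul_proj]
  have hs : LinearMap.trace ℝ V (q * (B * q * A)) = LinearMap.trace ℝ V (q * A * q * B) := by
    rw [show q * (B * q * A) = (q * B) * (q * A) by noncomm_ring, LinearMap.trace_mul_comm]
    congr 1
  have h1 : LinearMap.trace ℝ V (q * (A * (1 - q) * B)) =
      LinearMap.trace ℝ V (q * A * B) - LinearMap.trace ℝ V (q * A * q * B) := by
    rw [← map_sub]; congr 1; noncomm_ring
  simp only [Ψ, hp]
  simp only [mul_sub, mul_add, mul_smul_comm, map_sub, map_add, map_smul, smul_eq_mul, hs] at h1 ⊢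
  simp only [mul_assoc] at h1 ⊢
  linear_combination (-(1 + a) ^ 2) * h1

/-- The symmetric part of the Ricci tensor of the connection `cov a`. -/
theorem ricciSymm_eq (p : M) (v w : TangentSpace 𝓘(ℝ, E) p) :
    ricciSymm nabla p v w =
      (1 / 2 + a + a ^ 2) *
        LinearMap.trace ℝ V (K.proj p * K.adj (K.θ p v) * K.proj p * K.adj (K.θ p w)) -
      1 / 2 * LinearMap.trace ℝ V (K.adj (K.θ p v) * K.adj (K.θ p w)) := by
  rw [ricciSymm, K.ricci_eq a nabla hn p v w, K.ricci_eq a nabla hn p w v]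
  -- The trace with `ad` of the isotropy part of `[θv, θw]` is skew in `v, w` and drops out of the
  -- symmetric part.
  have hA := K.compl_mul_adj_mul_compl p (K.P_θ p v)
  have hskew : K.adj (K.br (K.θ p w) (K.θ p v) - K.P p (K.br (K.θ p w) (K.θ p v))) =
      - K.adj (K.br (K.θ p v) (K.θ p w) - K.P p (K.br (K.θ p v) (K.θ p w))) := by
    rw [K.br_skew (K.θ p w)]
    ext X
    simp [adj]
    abel
  rw [hskew]
  set q := K.proj p with hq
  set A := K.adj (K.θ p v)
  set B := K.adj (K.θ p w)
  have h1 : LinearMap.trace ℝ V (q * B * q * A) = LinearMap.trace ℝ V (q * A * q * B) := by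
    rw [mul_assoc, LinearMap.trace_mul_comm, ← mul_assoc]
  have h2 : LinearMap.trace ℝ V (A * q * B) = LinearMap.trace ℝ V (q * B * A) := by
    rw [mul_assoc, LinearMap.trace_mul_comm]
  -- Expansion of `(1 - q) A (1 - q) B = 0`. It replaces the remaining traces with a single `q`,
  -- whose symmetrized coefficient is `-1/2` for every `a`, by the uncompressed trace form.
  have h3 : LinearMap.trace ℝ V (A * B) = LinearMap.trace ℝ V (q * A * B) +
      LinearMap.trace ℝ V (A * q * B) - LinearMap.trace ℝ V (q * A * q * B) := by
    rw [← map_add, ← map_sub]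
    congr 1
    have h4 : A * B - (q * A * B + A * q * B - q * A * q * B) = (1 - q) * A * (1 - q) * B := by
      noncomm_ring
    rw [hA, zero_mul] at h4
    exact sub_eq_zero.1 h4
  rw [h3, h2, h1, mul_neg, map_neg]
  ring

omit hn in
/-- If the trace form of the compressed adjoint action is a multiple of the trace form of the
adjoint action, which induces the metric, then the metric connection with torsion a multiple of the
canonical torsion is Einstein with skew torsion. -/
theorem isNablaEinstein (hm : IsMetric g nabla)
    (ht : ∀ (p : M) (u v : TangentSpace 𝓘(ℝ, E) p),
      nabla.torsion p u v = (1 + 2 * a) • K.F p (K.br (K.θ p u) (K.θ p v)))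
    (hip : ∀ X Y, LinearMap.trace ℝ V (K.adj X * K.adj Y) = - K.ip X Y)
    (hc : ∀ p, ∃ c : ℝ, ∀ X Y, K.P p X = X → K.P p Y = Y →
      LinearMap.trace ℝ V (K.proj p * K.adj X * K.proj p * K.adj Y) =
        c * LinearMap.trace ℝ V (K.adj X * K.adj Y)) :
    IsNablaEinstein g nabla where
  metric := hm
  skew p u v w := by
    have h (X Y Z : V) : K.ip (K.br X Y) Z = - K.ip (K.br X Z) Y := by
      rw [K.ip_br, K.ip_symm]
    rw [ht, ht, map_smul, map_smul, smul_apply, smul_apply, g.symm p _ w, g.symm p _ v,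
      ← K.ip_θ, ← K.ip_θ, K.ip_symm, h, K.ip_symm (K.θ p v), smul_neg]
  einstein p u v := by
    obtain ⟨c, hc⟩ := hc p
    -- `ricciSymm_eq` with both trace forms expressed by `ip`, where `tr (ad X ad Y) = -ip X Y`.
    refine einstein_of_ricciSymm nabla p (1 / 2 - (1 / 2 + a + a ^ 2) * c) (fun u v ↦ ?_) u v
    rw [K.ricciSymm_eq a nabla (fun hW ↦ K.eq_cov a nabla hm ht hW),
      hc _ _ (K.P_θ p u) (K.P_θ p v), hip, K.inner_eq]
    ring

end KillingFrame
end Einstein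
end StdHom
end

noncomputable section

namespace StdHom

/-! ### Derivatives depending on parameters, and exchange of partial derivatives. -/

section Parameters

set_option linter.unusedSectionVars false

open VectorField
open scoped Topology

variable {E : Type*} [NormedAddCommGroup E] [NormedSpace ℝ E]
  {M : Type*} [TopologicalSpace M] [ChartedSpace E M] [IsManifold 𝓘(ℝ, E) ∞ M]
  {E' : Type*} [NormedAddCommGroup E'] [NormedSpace ℝ E']
  {M' : Type*} [TopologicalSpace M'] [ChartedSpace E' M'] [IsManifold 𝓘(ℝ, E') ∞ M']
  {E'' : Type*} [NormedAddCommGroup E''] [NormedSpace ℝ E'']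
  {M'' : Type*} [TopologicalSpace M''] [ChartedSpace E'' M''] [IsManifold 𝓘(ℝ, E'') ∞ M'']
  {V : Type*} [NormedAddCommGroup V] [NormedSpace ℝ V]

/-- Partial derivatives depend smoothly on the parameter. -/
lemma contMDiffAt_mfderiv_param {Φ : M → M' → M''} {x : M} {y : M'}
    (hΦ : ContMDiffAt (𝓘(ℝ, E).prod 𝓘(ℝ, E')) 𝓘(ℝ, E'') ∞ (fun z : M × M' ↦ Φ z.1 z.2) (x, y))
    (w : TangentSpace 𝓘(ℝ, E') y) :
    ContMDiffAt 𝓘(ℝ, E) 𝓘(ℝ, E'').tangent ∞ (fun x ↦ (⟨Φ x y,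
      mfderiv 𝓘(ℝ, E') 𝓘(ℝ, E'') (Φ x) y w⟩ : TangentBundle 𝓘(ℝ, E'') M'')) x := by
  have h1 := ContMDiffAt.mfderiv (m := ∞) Φ (fun _ ↦ y) hΦ contMDiffAt_const (by simp)
  have h3 : ContMDiffAt 𝓘(ℝ, E) 𝓘(ℝ, E'') ∞ (fun x ↦ Φ x y) x :=
    hΦ.comp x (f := fun x ↦ (x, y)) (contMDiffAt_id.prodMk contMDiffAt_const)
  exact ContMDiffAt.clm_apply_of_inCoordinates h1
    (contMDiffAt_const (I' := 𝓘(ℝ, E').tangent) (c := (⟨y, w⟩ : TangentBundle 𝓘(ℝ, E') M'))) h3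

lemma contMDiffAt_D_param {Φ : M → M' → V} {x : M} {y : M'}
    (hΦ : ContMDiffAt (𝓘(ℝ, E).prod 𝓘(ℝ, E')) 𝓘(ℝ, V) ∞ (fun z : M × M' ↦ Φ z.1 z.2) (x, y))
    (w : TangentSpace 𝓘(ℝ, E') y) :
    ContMDiffAt 𝓘(ℝ, E) 𝓘(ℝ, V) ∞ (fun x ↦ D (Φ x) y w) x :=
  (contMDiff_snd_tangentBundle_modelSpace V 𝓘(ℝ, V)).contMDiffAt.comp x
    (contMDiffAt_mfderiv_param hΦ w)

lemma D_eq_fderiv {f : M → V} {p : M} (hf : MDifferentiableAt 𝓘(ℝ, E) 𝓘(ℝ, V) f p)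
    (v : TangentSpace 𝓘(ℝ, E) p) :
    D f p v = fderiv ℝ (f ∘ (extChartAt 𝓘(ℝ, E) p).symm) (extChartAt 𝓘(ℝ, E) p p) v := by
  have := hf.mfderiv
  rw [ModelWithCorners.range_eq_univ, fderivWithin_univ] at this
  exact congrArg (fun A : E →L[ℝ] V ↦ A v) this

/-- Partial derivatives commute. -/
lemma D_D_comm {Φ : M → M' → V} {p : M} {p' : M'}
    (hΦ : ContMDiffAt (𝓘(ℝ, E).prod 𝓘(ℝ, E')) 𝓘(ℝ, V) ∞ (fun z : M × M' ↦ Φ z.1 z.2) (p, p'))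
    (v : TangentSpace 𝓘(ℝ, E) p) (w : TangentSpace 𝓘(ℝ, E') p') :
    D (fun x ↦ D (Φ x) p' w) p v = D (fun y ↦ D (fun x ↦ Φ x y) p v) p' w := by
  set φ := extChartAt 𝓘(ℝ, E) p
  set φ' := extChartAt 𝓘(ℝ, E') p'
  have hp : p ∈ φ.source := mem_extChartAt_source p
  have hp' : p' ∈ φ'.source := mem_extChartAt_source p'
  let Ψ : E × E' → V := fun z ↦ Φ (φ.symm z.1) (φ'.symm z.2)
  have hΨ : ContDiffAt ℝ ∞ Ψ (φ p, φ' p') := by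
    have h1 : ContMDiffAt 𝓘(ℝ, E) 𝓘(ℝ, E) ∞ φ.symm (φ p) :=
      (contMDiffOn_extChartAt_symm (I := 𝓘(ℝ, E)) p).contMDiffAt (extChartAt_target_mem_nhds p)
    have h2 : ContMDiffAt 𝓘(ℝ, E') 𝓘(ℝ, E') ∞ φ'.symm (φ' p') :=
      (contMDiffOn_extChartAt_symm (I := 𝓘(ℝ, E')) p').contMDiffAt (extChartAt_target_mem_nhds p')
    have h3 := h1.prodMap h2
    have h4 : ContMDiffAt (𝓘(ℝ, E).prod 𝓘(ℝ, E')) 𝓘(ℝ, V) ∞ Ψ (φ p, φ' p') := by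
      refine ContMDiffAt.comp (φ p, φ' p') (g := fun z : M × M' ↦ Φ z.1 z.2) ?_ h3
      simp only [Prod.map_apply, φ.left_inv hp, φ'.left_inv hp']
      exact hΦ
    rw [← modelWithCornersSelf_prod, chartedSpaceSelf_prod] at h4
    exact h4.contDiffAt
  have hsymm := hΨ.isSymmSndFDerivAt
    (by rw [minSmoothness_of_isRCLikeNormedField]; exact ENat.LEInfty.out)
  have hΨ1 : ContDiffAt ℝ 1 (fderiv ℝ Ψ) (φ p, φ' p') :=
    hΨ.fderiv_right (m := 1) (by rw [one_add_one_eq_two]; exact ENat.LEInfty.out)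
  have hev : ∀ᶠ z in 𝓝 (φ p, φ' p'), DifferentiableAt ℝ Ψ z := by
    have : ∀ᶠ z in 𝓝 (φ p, φ' p'), ContDiffAt ℝ 1 Ψ z :=
      (hΨ.of_le (m := 1) (by simp)).eventually (by simp)
    exact this.mono fun z hz ↦ hz.differentiableAt (by simp)
  have hevΦ : ∀ᶠ z in 𝓝 (p, p'), MDifferentiableAt (𝓘(ℝ, E).prod 𝓘(ℝ, E')) 𝓘(ℝ, V)
      (fun z : M × M' ↦ Φ z.1 z.2) z :=
    ((contMDiffAt_iff_contMDiffAt_nhds (by simp)).1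
      (hΦ.of_le (m := 1) (by simp))).mono fun x hx ↦ hx.mdifferentiableAt (by simp)
  have hd := hΨ1.differentiableAt (by simp)
  have hc : ContinuousAt φ p := continuousAt_extChartAt p
  have hc' : ContinuousAt φ' p' := continuousAt_extChartAt p'
  have e1 : (fun x ↦ D (Φ x) p' w) =ᶠ[𝓝 p] fun x ↦
      (fun z ↦ fderiv ℝ Ψ (z, φ' p') ((0 : E), w)) (φ x) := by
    have t1 : Filter.Tendsto (fun x ↦ (x, p')) (𝓝 p) (𝓝 (p, p')) :=
      (continuous_id.prodMk continuous_const).tendsto p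
    have t2 : Filter.Tendsto (fun x ↦ (φ x, φ' p')) (𝓝 p) (𝓝 (φ p, φ' p')) :=
      hc.prodMk_nhds tendsto_const_nhds
    filter_upwards [t1.eventually hevΦ, t2.eventually hev, extChartAt_source_mem_nhds (I := 𝓘(ℝ, E)) p]
      with x h1 h2 h3
    have h4 : MDifferentiableAt 𝓘(ℝ, E') 𝓘(ℝ, V) (Φ x) p' :=
      h1.comp p' (f := fun y ↦ (x, y)) (mdifferentiableAt_const.prodMk mdifferentiableAt_id)
    rw [D_eq_fderiv h4]
    have h5 : (Φ x ∘ φ'.symm) = fun y ↦ Ψ (φ x, y) := by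
      ext y; simp only [Function.comp_apply, Ψ, φ.left_inv h3]
    have h6 := (h2.hasFDerivAt.comp (φ' p') (hasFDerivAt_prodMk_right (φ x) (φ' p'))).fderiv
    rw [h5]
    exact congrArg (fun A : E' →L[ℝ] V ↦ A w) h6
  have e2 : (fun y ↦ D (fun x ↦ Φ x y) p v) =ᶠ[𝓝 p'] fun y ↦
      (fun z ↦ fderiv ℝ Ψ (φ p, z) (v, (0 : E'))) (φ' y) := by
    have t1 : Filter.Tendsto (fun y ↦ (p, y)) (𝓝 p') (𝓝 (p, p')) :=
      (continuous_const.prodMk continuous_id).tendsto p'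
    have t2 : Filter.Tendsto (fun y ↦ (φ p, φ' y)) (𝓝 p') (𝓝 (φ p, φ' p')) :=
      tendsto_const_nhds.prodMk_nhds hc'
    filter_upwards [t1.eventually hevΦ, t2.eventually hev, extChartAt_source_mem_nhds (I := 𝓘(ℝ, E')) p']
      with y h1 h2 h3
    have h4 : MDifferentiableAt 𝓘(ℝ, E) 𝓘(ℝ, V) (fun x ↦ Φ x y) p :=
      h1.comp p (f := fun x ↦ (x, y)) (mdifferentiableAt_id.prodMk mdifferentiableAt_const)
    rw [D_eq_fderiv h4]
    have h5 : ((fun x ↦ Φ x y) ∘ φ.symm) = fun x ↦ Ψ (x, φ' y) := by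
      ext x; simp only [Function.comp_apply, Ψ, φ'.left_inv h3]
    have h6 := (h2.hasFDerivAt.comp (φ p) (hasFDerivAt_prodMk_left (𝕜 := ℝ) (φ p) (φ' y))).fderiv
    rw [h5]
    exact congrArg (fun A : E →L[ℝ] V ↦ A v) h6
  have d1 := (hd.hasFDerivAt.comp (φ p)
    (hasFDerivAt_prodMk_left (𝕜 := ℝ) (φ p) (φ' p'))).clm_apply
    (hasFDerivAt_const (𝕜 := ℝ) (((0 : E), (w : E')) : E × E') (φ p))
  have d2 := (hd.hasFDerivAt.comp (φ' p')
    (hasFDerivAt_prodMk_right (𝕜 := ℝ) (φ p) (φ' p'))).clm_apply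
    (hasFDerivAt_const (𝕜 := ℝ) (((v : E), (0 : E')) : E × E') (φ' p'))
  have c1 := D_comp_chart hp d1.differentiableAt v
  have c2 := D_comp_chart hp' d2.differentiableAt w
  rw [mfderiv_extChartAt_self] at c1 c2
  have r1 := congrArg (fun A : E →L[ℝ] V ↦ A v) d1.fderiv
  have r2 := congrArg (fun A : E' →L[ℝ] V ↦ A w) d2.fderiv
  refine ((D_congr e1 v).trans c1).trans (Eq.trans (r1.trans ?_) (r2.symm.trans (c2.symm.trans (D_congr e2 w).symm)))
  have r3 := hsymm.eq ((v : E), (0 : E')) ((0 : E), (w : E'))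
  simp only [ContinuousLinearMap.comp_zero, zero_add]
  exact r3

end Parameters

end StdHom
end

noncomputable section

namespace StdHom

/-! ### Invariant vector fields on a Lie group and fundamental fields of an action. -/

section LieGroups

set_option linter.unusedSectionVars false

open VectorField
open scoped Topology

variable {EG : Type*} [NormedAddCommGroup EG] [NormedSpace ℝ EG] [CompleteSpace EG]
  {G : Type*} [TopologicalSpace G] [ChartedSpace EG G] [Group G] [LieGroup 𝓘(ℝ, EG) ∞ G]
  {E : Type*} [NormedAddCommGroup E] [NormedSpace ℝ E] [CompleteSpace E]
  {M : Type*} [TopologicalSpace M] [ChartedSpace E M] [IsManifold 𝓘(ℝ, E) ∞ M]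
  {V : Type*} [NormedAddCommGroup V] [NormedSpace ℝ V]

/-- All tangent spaces are definitionally the model space. This and the next two lemmas move a
vector between propositionally equal base points, such as `1 • p` and `p`. -/
lemma tangentBundle_mk_eq {x y : M} (h : x = y) (v : E) :
    (⟨x, v⟩ : TangentBundle 𝓘(ℝ, E) M) = ⟨y, v⟩ := by
  subst h; rfl

lemma D_base {x y : M} (h : x = y) (f : M → V) (v : E) :
    D f x (v : TangentSpace 𝓘(ℝ, E) x) = D f y (v : TangentSpace 𝓘(ℝ, E) y) := by
  subst h; rfl

lemma mfderiv_base {E' : Type*} [NormedAddCommGroup E'] [NormedSpace ℝ E'] {M' : Type*}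
    [TopologicalSpace M'] [ChartedSpace E' M'] {x y : M} (h : x = y) (f : M → M') (v : E) :
    (mfderiv 𝓘(ℝ, E) 𝓘(ℝ, E') f x (v : TangentSpace 𝓘(ℝ, E) x) : E') =
      mfderiv 𝓘(ℝ, E) 𝓘(ℝ, E') f y (v : TangentSpace 𝓘(ℝ, E) y) := by
  subst h; rfl

lemma contMDiff_mul' : ContMDiff (𝓘(ℝ, EG).prod 𝓘(ℝ, EG)) 𝓘(ℝ, EG) ∞
    (fun z : G × G ↦ z.1 * z.2) := contMDiff_mul 𝓘(ℝ, EG) ∞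

/-- The differential at `1` of the orbit map `g ↦ g • x`. -/
def orbitDeriv [MulAction G M] (x : M) : EG →L[ℝ] TangentSpace 𝓘(ℝ, E) x :=
  (mfderiv 𝓘(ℝ, EG) 𝓘(ℝ, E) (fun g : G ↦ g • x) (1 : G))

/-- The right invariant vector field. -/
def rightField (X : EG) (a : G) : TangentSpace 𝓘(ℝ, EG) a :=
  (mfderiv 𝓘(ℝ, EG) 𝓘(ℝ, EG) (fun g : G ↦ g * a) (1 : G)) X

/-- The left invariant vector field. -/
def leftField (X : EG) (a : G) : TangentSpace 𝓘(ℝ, EG) a :=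
  (mfderiv 𝓘(ℝ, EG) 𝓘(ℝ, EG) (fun g : G ↦ a * g) (1 : G)) X

lemma fieldSmoothAt_orbitDeriv [MulAction G M]
    (h : ContMDiffSMul 𝓘(ℝ, EG) 𝓘(ℝ, E) ∞ G M) (X : EG) (p : M) :
    FieldSmoothAt (E := E) (fun x : M ↦ orbitDeriv (G := G) x X) p := by
  have h0 : ContMDiffAt (𝓘(ℝ, E).prod 𝓘(ℝ, EG)) 𝓘(ℝ, E) ∞ (fun z : M × G ↦ z.2 • z.1) (p, 1) :=
    (h.contMDiff_smul.comp (contMDiff_snd.prodMk contMDiff_fst)).contMDiffAt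
  have h1 := contMDiffAt_mfderiv_param (Φ := fun (x : M) (g : G) ↦ g • x) h0 X
  refine h1.congr_of_eventuallyEq (Filter.Eventually.of_forall fun x ↦ ?_)
  exact tangentBundle_mk_eq (one_smul G x).symm _

lemma fieldSmoothAt_rightField (X : EG) (a : G) : FieldSmoothAt (rightField (G := G) X) a := by
  have h0 : ContMDiffAt (𝓘(ℝ, EG).prod 𝓘(ℝ, EG)) 𝓘(ℝ, EG) ∞ (fun z : G × G ↦ z.2 * z.1) (a, 1) :=
    (contMDiff_mul'.comp (contMDiff_snd.prodMk contMDiff_fst)).contMDiffAt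
  have h1 := contMDiffAt_mfderiv_param (Φ := fun (x : G) (g : G) ↦ g * x) h0 X
  refine h1.congr_of_eventuallyEq (Filter.Eventually.of_forall fun x ↦ ?_)
  exact tangentBundle_mk_eq (one_mul x).symm _

lemma fieldSmoothAt_leftField (X : EG) (a : G) : FieldSmoothAt (leftField (G := G) X) a := by
  have h0 : ContMDiffAt (𝓘(ℝ, EG).prod 𝓘(ℝ, EG)) 𝓘(ℝ, EG) ∞ (fun z : G × G ↦ z.1 * z.2) (a, 1) :=
    contMDiff_mul'.contMDiffAt
  have h1 := contMDiffAt_mfderiv_param (Φ := fun (x : G) (g : G) ↦ x * g) h0 X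
  refine h1.congr_of_eventuallyEq (Filter.Eventually.of_forall fun x ↦ ?_)
  exact tangentBundle_mk_eq (mul_one x).symm _

lemma mdifferentiableAt_mul_left (a b : G) :
    MDifferentiableAt 𝓘(ℝ, EG) 𝓘(ℝ, EG) (fun g : G ↦ a * g) b :=
  (contMDiff_mul_left (I := 𝓘(ℝ, EG)) (n := ∞)).mdifferentiable (by simp) b

lemma mdifferentiableAt_mul_right (a b : G) :
    MDifferentiableAt 𝓘(ℝ, EG) 𝓘(ℝ, EG) (fun g : G ↦ g * a) b :=
  (contMDiff_mul_right (I := 𝓘(ℝ, EG)) (n := ∞)).mdifferentiable (by simp) b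

lemma D_rightField {f : G → V} {a : G} (hf : MDifferentiableAt 𝓘(ℝ, EG) 𝓘(ℝ, V) f a) (X : EG) :
    D f a (rightField X a) = D (fun g ↦ f (g * a)) (1 : G) X := by
  have := D_comp (f := fun g : G ↦ g * a) (p := 1) (h := f) (by rwa [one_mul])
    (mdifferentiableAt_mul_right a 1) X
  rw [this]
  exact D_base (one_mul a).symm f _

lemma D_leftField {f : G → V} {a : G} (hf : MDifferentiableAt 𝓘(ℝ, EG) 𝓘(ℝ, V) f a) (X : EG) :
    D f a (leftField X a) = D (fun g ↦ f (a * g)) (1 : G) X := by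
  have := D_comp (f := fun g : G ↦ a * g) (p := 1) (h := f) (by rwa [mul_one])
    (mdifferentiableAt_mul_left a 1) X
  rw [this]
  exact D_base (mul_one a).symm f _

lemma rightField_one (X : EG) : rightField (G := G) X 1 = X := by
  have : (fun g : G ↦ g * 1) = id := by ext; simp
  rw [rightField, this, mfderiv_id]
  rfl

lemma leftField_one (X : EG) : leftField (G := G) X 1 = X := by
  have : (fun g : G ↦ 1 * g) = id := by ext; simp
  rw [leftField, this, mfderiv_id]
  rfl

lemma mdifferentiableAt_nhds {f : M → V} {p : M} (hf : ContMDiffAt 𝓘(ℝ, E) 𝓘(ℝ, V) ∞ f p) :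
    ∀ᶠ x in 𝓝 p, MDifferentiableAt 𝓘(ℝ, E) 𝓘(ℝ, V) f x :=
  ((contMDiffAt_iff_contMDiffAt_nhds (by simp)).1
      (hf.of_le (m := 1) (by simp))).mono fun _ hx ↦ hx.mdifferentiableAt (by simp)

/-- Both sides are mixed partial derivatives at `(1, 1)` of `(a, g) ↦ f (g * a)`, taken in opposite
orders. -/
lemma D_D_rightField {f : G → V} (hf : ContMDiffAt 𝓘(ℝ, EG) 𝓘(ℝ, V) ∞ f 1) (X Y : EG) :
    D (fun a ↦ D f a (rightField Y a)) (1 : G) X = D (fun a ↦ D f a (leftField X a)) (1 : G) Y := by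
  have h1 : (fun a ↦ D f a (rightField Y a)) =ᶠ[𝓝 1] fun a ↦ D (fun g ↦ f (g * a)) (1 : G) Y :=
    (mdifferentiableAt_nhds hf).mono fun a ha ↦ D_rightField ha Y
  have h2 : (fun a ↦ D f a (leftField X a)) =ᶠ[𝓝 1] fun a ↦ D (fun g ↦ f (a * g)) (1 : G) X :=
    (mdifferentiableAt_nhds hf).mono fun a ha ↦ D_leftField ha X
  refine (D_congr h1 X).trans (Eq.trans ?_ (D_congr h2 Y).symm)
  have h3 : ContMDiffAt (𝓘(ℝ, EG).prod 𝓘(ℝ, EG)) 𝓘(ℝ, V) ∞ (fun z : G × G ↦ f (z.2 * z.1))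
      (1, 1) := by
    refine ContMDiffAt.comp (1, 1) (g := f) (by simpa using hf) ?_
    exact (contMDiff_mul'.comp (contMDiff_snd.prodMk contMDiff_fst)).contMDiffAt
  exact D_D_comm (Φ := fun a g : G ↦ f (g * a)) h3 X Y

lemma D_extChartAt (p : M) (v : TangentSpace 𝓘(ℝ, E) p) :
    D (fun x ↦ (extChartAt 𝓘(ℝ, E) p x : E)) p v = v :=
  congrArg (fun A : E →L[ℝ] E ↦ A v) (mfderiv_extChartAt_self (I := 𝓘(ℝ, E)) (x := p))

variable (G) in
/-- The Lie bracket of the Lie algebra of `G`, on the model space. -/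
def brk (X Y : EG) : EG :=
  Bracket.bracket (L := GroupLieAlgebra 𝓘(ℝ, EG) G) (M := GroupLieAlgebra 𝓘(ℝ, EG) G) X Y

lemma brk_eq_D (X Y : EG) : brk G X Y =
    D (fun a ↦ D (fun x ↦ (extChartAt 𝓘(ℝ, EG) (1 : G) x : EG)) a (leftField Y a)) (1 : G) X -
    D (fun a ↦ D (fun x ↦ (extChartAt 𝓘(ℝ, EG) (1 : G) x : EG)) a (leftField X a)) (1 : G) Y := by
  have h := D_mlieBracket (f := fun x ↦ (extChartAt 𝓘(ℝ, EG) (1 : G) x : EG))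
    contMDiffAt_extChartAt (fieldSmoothAt_leftField X (1 : G)).fieldDiffAt
    (fieldSmoothAt_leftField Y (1 : G)).fieldDiffAt
  rw [D_extChartAt, leftField_one, leftField_one] at h
  exact h

/-- Exchanging the order of differentiation by `D_D_rightField` replaces right by left invariant
fields and interchanges `X` and `Y`; hence the sign. -/
lemma mlieBracket_rightField (X Y : EG) :
    mlieBracket 𝓘(ℝ, EG) (rightField (G := G) X) (rightField Y) 1 = - brk G X Y := by
  have h := D_mlieBracket (f := fun x ↦ (extChartAt 𝓘(ℝ, EG) (1 : G) x : EG))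
    contMDiffAt_extChartAt (fieldSmoothAt_rightField X (1 : G)).fieldDiffAt
    (fieldSmoothAt_rightField Y (1 : G)).fieldDiffAt
  rw [D_extChartAt, rightField_one, rightField_one, D_D_rightField contMDiffAt_extChartAt,
    D_D_rightField contMDiffAt_extChartAt] at h
  rw [brk_eq_D, neg_sub]
  exact h

/-- The fundamental vector fields of a left action: `[X*, Y*] = - [X, Y]*`. -/
theorem mlieBracket_orbitDeriv [MulAction G M]
    (h : ContMDiffSMul 𝓘(ℝ, EG) 𝓘(ℝ, E) ∞ G M) (X Y : EG) (p : M) :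
    mlieBracket 𝓘(ℝ, E) (fun x : M ↦ orbitDeriv (G := G) x X)
      (fun x ↦ orbitDeriv (G := G) x Y) p = - orbitDeriv (G := G) p (brk G X Y) := by
  have hsm (x : M) : ContMDiff 𝓘(ℝ, EG) 𝓘(ℝ, E) ∞ (fun g : G ↦ g • x) :=
    h.contMDiff_smul.comp (contMDiff_id.prodMk contMDiff_const)
  -- The orbit map `g ↦ g • p` relates right invariant fields to fundamental fields, so the sign of
  -- `mlieBracket_rightField` carries over.
  have hrel (X : EG) (a : G) : mfderiv 𝓘(ℝ, EG) 𝓘(ℝ, E) (fun g : G ↦ g • p) a (rightField X a) =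
      orbitDeriv (G := G) (a • p) X := by
    have h1 := mfderiv_comp (I := 𝓘(ℝ, EG)) (I' := 𝓘(ℝ, EG)) (I'' := 𝓘(ℝ, E)) (1 : G)
      (g := fun g : G ↦ g • p) (f := fun g : G ↦ g * a)
      ((hsm p).mdifferentiable (by simp) _) (mdifferentiableAt_mul_right a 1)
    have h2 : (fun g : G ↦ g • p) ∘ (fun g : G ↦ g * a) = fun g ↦ g • (a • p) := by
      ext g; exact mul_smul g a p
    rw [h2] at h1
    have h3 := congrArg (fun A : EG →L[ℝ] E ↦ A X) h1
    exact (mfderiv_base (one_mul a).symm (fun g : G ↦ g • p) _).trans h3.symm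
  have key := mfderiv_mlieBracket_of_related (p := (1 : G)) (f := fun g : G ↦ g • p)
    (hsm p).contMDiffAt (fieldSmoothAt_rightField X (1 : G)).fieldDiffAt
    (fieldSmoothAt_rightField Y (1 : G)).fieldDiffAt
    (fieldSmoothAt_orbitDeriv h X _) (fieldSmoothAt_orbitDeriv h Y _)
    (Filter.Eventually.of_forall (hrel X)) (Filter.Eventually.of_forall (hrel Y))
  rw [mlieBracket_rightField] at key
  have e : ∀ x, x = p → (mlieBracket 𝓘(ℝ, E) (fun x : M ↦ orbitDeriv (G := G) x X)
      (fun x ↦ orbitDeriv (G := G) x Y) x : E) = mlieBracket 𝓘(ℝ, E)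
      (fun x : M ↦ orbitDeriv (G := G) x X) (fun x ↦ orbitDeriv (G := G) x Y) p := by
    rintro x rfl; rfl
  refine (e _ (one_smul G p)).symm.trans (key.symm.trans ?_)
  exact map_neg (orbitDeriv (EG := EG) (G := G) p) (brk G X Y)

end LieGroups

end StdHom
end

noncomputable section

namespace StdHom

/-! ### Differentials of homomorphisms and the adjoint representation. -/

section Adjoint

set_option linter.unusedSectionVars false

open VectorField
open scoped Topology

variable {EG : Type*} [NormedAddCommGroup EG] [NormedSpace ℝ EG] [CompleteSpace EG]
  {G : Type*} [TopologicalSpace G] [ChartedSpace EG G] [Group G] [LieGroup 𝓘(ℝ, EG) ∞ G]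
  {EH : Type*} [NormedAddCommGroup EH] [NormedSpace ℝ EH] [CompleteSpace EH]
  {H : Type*} [TopologicalSpace H] [ChartedSpace EH H] [Group H] [LieGroup 𝓘(ℝ, EH) ∞ H]
  {EL : Type*} [NormedAddCommGroup EL] [NormedSpace ℝ EL] [CompleteSpace EL]
  {L : Type*} [TopologicalSpace L] [ChartedSpace EL L] [Group L] [LieGroup 𝓘(ℝ, EL) ∞ L]
  {E : Type*} [NormedAddCommGroup E] [NormedSpace ℝ E] [CompleteSpace E]
  {M : Type*} [TopologicalSpace M] [ChartedSpace E M] [IsManifold 𝓘(ℝ, E) ∞ M]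

/-- The differential at `1` of a homomorphism of Lie groups. -/
def dHom (f : G →* H) : EG →L[ℝ] EH := mfderiv 𝓘(ℝ, EG) 𝓘(ℝ, EH) f 1

lemma dHom_id : dHom (MonoidHom.id G) = ContinuousLinearMap.id ℝ EG := by
  have := mfderiv_id (I := 𝓘(ℝ, EG)) (x := (1 : G))
  exact this

lemma dHom_comp {f : H →* L} {f' : G →* H} (hf : ContMDiff 𝓘(ℝ, EH) 𝓘(ℝ, EL) ∞ f)
    (hf' : ContMDiff 𝓘(ℝ, EG) 𝓘(ℝ, EH) ∞ f') (X : EG) :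
    (dHom (f.comp f') X : EL) = dHom f (dHom f' X : EH) := by
  have h1 := mfderiv_comp (I := 𝓘(ℝ, EG)) (I' := 𝓘(ℝ, EH)) (I'' := 𝓘(ℝ, EL)) (1 : G)
    (hf.mdifferentiable (by simp) (f' 1)) (hf'.mdifferentiable (by simp) 1)
  have h2 := congrArg (fun A : EG →L[ℝ] EL ↦ A X) h1
  exact h2.trans (mfderiv_base f'.map_one f _)

lemma mfderiv_leftField {f : G →* H} (hf : ContMDiff 𝓘(ℝ, EG) 𝓘(ℝ, EH) ∞ f) (X : EG) (a : G) :
    mfderiv 𝓘(ℝ, EG) 𝓘(ℝ, EH) f a (leftField X a) = leftField (dHom f X) (f a) := by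
  have h1 := mfderiv_comp (I := 𝓘(ℝ, EG)) (I' := 𝓘(ℝ, EG)) (I'' := 𝓘(ℝ, EH)) (1 : G)
    (hf.mdifferentiable (by simp) (a * 1)) (mdifferentiableAt_mul_left a 1)
  have h2 := mfderiv_comp (I := 𝓘(ℝ, EG)) (I' := 𝓘(ℝ, EH)) (I'' := 𝓘(ℝ, EH)) (1 : G)
    (mdifferentiableAt_mul_left (f a) (f 1)) (hf.mdifferentiable (by simp) 1)
  have h3 : f ∘ (fun g ↦ a * g) = (fun g ↦ f a * g) ∘ f := by ext g; simp
  rw [h3, h2] at h1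
  have h4 := congrArg (fun A : EG →L[ℝ] EH ↦ A X) h1
  refine (mfderiv_base (mul_one a).symm f _).trans (h4.symm.trans ?_)
  exact mfderiv_base f.map_one (fun g ↦ f a * g) _

/-- The differential of a homomorphism of Lie groups is a homomorphism of Lie algebras. -/
theorem dHom_brk {f : G →* H} (hf : ContMDiff 𝓘(ℝ, EG) 𝓘(ℝ, EH) ∞ f) (X Y : EG) :
    dHom (EH := EH) f (brk G X Y) = brk H (dHom f X) (dHom f Y) := by
  have key := mfderiv_mlieBracket_of_related (p := (1 : G)) (f := f)
    hf.contMDiffAt (fieldSmoothAt_leftField X (1 : G)).fieldDiffAt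
    (fieldSmoothAt_leftField Y (1 : G)).fieldDiffAt
    (fieldSmoothAt_leftField (dHom f X) (f 1)) (fieldSmoothAt_leftField (dHom f Y) (f 1))
    (Filter.Eventually.of_forall (mfderiv_leftField hf X))
    (Filter.Eventually.of_forall (mfderiv_leftField hf Y))
  refine Eq.trans key ?_
  have e : ∀ x, x = 1 → (mlieBracket 𝓘(ℝ, EH) (leftField (G := H) (dHom f X))
      (leftField (dHom f Y)) x : EH) =
      mlieBracket 𝓘(ℝ, EH) (leftField (G := H) (dHom f X)) (leftField (dHom f Y)) 1 := by
    rintro x rfl; rfl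
  exact e _ f.map_one

lemma contMDiff_conj' : ContMDiff (𝓘(ℝ, EG).prod 𝓘(ℝ, EG)) 𝓘(ℝ, EG) ∞
    (fun z : G × G ↦ z.1 * z.2 * z.1⁻¹) :=
  contMDiff_mul'.mul (contMDiff_inv 𝓘(ℝ, EG) ∞ |>.comp contMDiff_fst)

lemma contMDiff_conj (a : G) : ContMDiff 𝓘(ℝ, EG) 𝓘(ℝ, EG) ∞ (MulAut.conj a).toMonoidHom :=
  contMDiff_conj'.comp (contMDiff_const.prodMk contMDiff_id)

/-- The adjoint representation. -/
def Ad (a : G) : EG →L[ℝ] EG := dHom (MulAut.conj a).toMonoidHom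

lemma Ad_one : Ad (1 : G) = ContinuousLinearMap.id ℝ EG := by
  rw [Ad, ← dHom_id (G := G)]
  congr 1
  ext g
  simp

lemma Ad_mul (a b : G) (X : EG) : Ad (a * b) X = Ad a (Ad b X) := by
  rw [Ad, Ad, Ad, ← dHom_comp (contMDiff_conj a) (contMDiff_conj b)]
  congr 2
  ext g
  simp

lemma Ad_inv_Ad (a : G) (X : EG) : Ad a⁻¹ (Ad a X) = X := by
  rw [← Ad_mul, inv_mul_cancel, Ad_one]; rfl

lemma Ad_Ad_inv (a : G) (X : EG) : Ad a (Ad a⁻¹ X) = X := by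
  rw [← Ad_mul, mul_inv_cancel, Ad_one]; rfl

lemma Ad_brk (a : G) (X Y : EG) : Ad a (brk G X Y) = brk G (Ad a X) (Ad a Y) :=
  dHom_brk (contMDiff_conj a) X Y

/-- Expresses `Ad a X` as a derivative with values in a fixed vector space, so that smoothness in
`a` follows from `contMDiffAt_D_param`. -/
lemma Ad_eq_D (a : G) (X : EG) : Ad a X =
    D (fun t ↦ (extChartAt 𝓘(ℝ, EG) (1 : G) (a * t * a⁻¹) : EG)) (1 : G) X := by
  have h1 : MDifferentiableAt 𝓘(ℝ, EG) 𝓘(ℝ, EG)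
      (fun x ↦ (extChartAt 𝓘(ℝ, EG) (1 : G) x : EG)) ((MulAut.conj a).toMonoidHom 1) := by
    rw [map_one]
    exact contMDiffAt_extChartAt.mdifferentiableAt (n := ∞) (by simp)
  have h2 := D_comp h1 ((contMDiff_conj a).mdifferentiable (by simp) 1) X
  refine Eq.trans ?_ h2.symm
  refine ((D_base (map_one (MulAut.conj a).toMonoidHom) _ _).trans ?_).symm
  exact D_extChartAt _ _

lemma contMDiff_Ad (X : EG) : ContMDiff 𝓘(ℝ, EG) 𝓘(ℝ, EG) ∞ (fun a : G ↦ Ad a X) := by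
  intro a
  simp only [Ad_eq_D]
  refine contMDiffAt_D_param
    (Φ := fun a t : G ↦ (extChartAt 𝓘(ℝ, EG) (1 : G) (a * t * a⁻¹) : EG)) ?_ X
  refine ContMDiffAt.comp (a, 1) (g := fun x ↦ (extChartAt 𝓘(ℝ, EG) (1 : G) x : EG)) ?_
    contMDiff_conj'.contMDiffAt
  simp only [mul_one, mul_inv_cancel]
  exact contMDiffAt_extChartAt

lemma leftField_eq_rightField_Ad (X : EG) (a : G) : leftField X a = rightField (Ad a X) a := by
  have h1 := mfderiv_comp (I := 𝓘(ℝ, EG)) (I' := 𝓘(ℝ, EG)) (I'' := 𝓘(ℝ, EG)) (1 : G)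
    (mdifferentiableAt_mul_right a ((MulAut.conj a).toMonoidHom 1))
    ((contMDiff_conj a).mdifferentiable (by simp) 1)
  have h2 : (fun g ↦ g * a) ∘ (MulAut.conj a).toMonoidHom = fun g ↦ a * g := by ext g; simp
  rw [h2] at h1
  have h3 := congrArg (fun A : EG →L[ℝ] EG ↦ A X) h1
  refine h3.trans ?_
  exact mfderiv_base (map_one (MulAut.conj a).toMonoidHom) (fun g ↦ g * a) _

/-- The differential of the adjoint representation of the group is that of the Lie algebra. -/
theorem D_Ad [FiniteDimensional ℝ EG] (X Z : EG) :
    D (fun a : G ↦ Ad a X) 1 Z = brk G Z X := by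
  set b := Module.finBasis ℝ EG
  set φ : G → EG := fun x ↦ (extChartAt 𝓘(ℝ, EG) (1 : G) x : EG)
  have hφ : ContMDiffAt 𝓘(ℝ, EG) 𝓘(ℝ, EG) ∞ φ 1 := contMDiffAt_extChartAt
  -- `L a` reads right invariant fields in the chart at `1`, with `L 1` the identity. The left field
  -- of `X` is then `L a (Ad a X)`; the product rule gives its derivative as that of `Ad a X` plus a
  -- term which `D_D_rightField` identifies with the second half of the bracket.
  let L (a : G) : EG →L[ℝ] EG := (mvfderiv 𝓘(ℝ, EG) φ a : EG →L[ℝ] EG).comp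
    (mfderiv 𝓘(ℝ, EG) 𝓘(ℝ, EG) (fun g : G ↦ g * a) (1 : G) : EG →L[ℝ] EG)
  have hL (Y : EG) : MDifferentiableAt 𝓘(ℝ, EG) 𝓘(ℝ, EG) (fun a ↦ L a Y) 1 :=
    (contMDiffAt_D hφ (fieldSmoothAt_rightField Y 1)).mdifferentiableAt (by simp)
  have hL' : MDifferentiableAt 𝓘(ℝ, EG) 𝓘(ℝ, EG →L[ℝ] EG) L 1 := by
    have : L = ∑ i, fun a ↦ ContinuousLinearMap.smulRightL ℝ EG EG
        (b.coord i).toContinuousLinearMap (L a (b i)) := by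
      funext a
      ext Y
      conv_lhs => rw [← b.sum_repr Y]
      simp only [map_sum, map_smul, Finset.sum_apply, sum_apply]
      simp
    rw [this]
    refine MDifferentiableAt.sum fun i _ ↦ ?_
    exact ((ContinuousLinearMap.smulRightL ℝ EG EG
      (b.coord i).toContinuousLinearMap).differentiableAt.mdifferentiableAt).comp _ (hL (b i))
  have hA : MDifferentiableAt 𝓘(ℝ, EG) 𝓘(ℝ, EG) (fun a : G ↦ Ad a X) 1 :=
    (contMDiff_Ad X).mdifferentiable (by simp) 1
  have e1 : (fun a ↦ D φ a (leftField X a)) = fun a ↦ L a (Ad a X) := by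
    funext a
    rw [leftField_eq_rightField_Ad]
    rfl
  have e2 := D_bilin (ContinuousLinearMap.id ℝ (EG →L[ℝ] EG)) hL' hA Z
  have e3 : D (fun a ↦ L a X) 1 Z = D L 1 Z X :=
    D_clm (ContinuousLinearMap.apply ℝ EG X) hL' Z
  have e4 : D (fun a ↦ L a X) 1 Z = D (fun a ↦ D φ a (leftField Z a)) 1 X :=
    D_D_rightField hφ Z X
  have e5 : L 1 (D (fun a : G ↦ Ad a X) 1 Z) = D (fun a : G ↦ Ad a X) 1 Z := by
    change D φ 1 (rightField _ 1) = _
    rw [rightField_one]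
    exact D_extChartAt _ _
  have e6 : (Ad (1 : G) X : EG) = X := by rw [Ad_one]; rfl
  rw [brk_eq_D]
  change _ = D (fun a ↦ D φ a (leftField X a)) 1 Z - D (fun a ↦ D φ a (leftField Z a)) 1 X
  rw [← e4, e3, e1]
  simp only [ContinuousLinearMap.id_apply, e5, e6] at e2
  rw [e2]
  abel

/-- Equivariance of the fundamental vector fields. -/
lemma orbitDeriv_Ad [MulAction G M] (h : ContMDiffSMul 𝓘(ℝ, EG) 𝓘(ℝ, E) ∞ G M) (a : G) (p : M)
    (X : EG) : orbitDeriv (G := G) (a • p) (Ad a X) =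
      mfderiv 𝓘(ℝ, E) 𝓘(ℝ, E) (fun x : M ↦ a • x) p (orbitDeriv (G := G) p X) := by
  have hsm (x : M) : ContMDiff 𝓘(ℝ, EG) 𝓘(ℝ, E) ∞ (fun g : G ↦ g • x) :=
    h.contMDiff_smul.comp (contMDiff_id.prodMk contMDiff_const)
  have hsm' : ContMDiff 𝓘(ℝ, E) 𝓘(ℝ, E) ∞ (fun x : M ↦ a • x) :=
    h.contMDiff_smul.comp (contMDiff_const.prodMk contMDiff_id)
  have h1 := mfderiv_comp (I := 𝓘(ℝ, EG)) (I' := 𝓘(ℝ, EG)) (I'' := 𝓘(ℝ, E)) (1 : G)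
    ((hsm (a • p)).mdifferentiable (by simp) ((MulAut.conj a).toMonoidHom 1))
    ((contMDiff_conj a).mdifferentiable (by simp) 1)
  have h2 := mfderiv_comp (I := 𝓘(ℝ, EG)) (I' := 𝓘(ℝ, E)) (I'' := 𝓘(ℝ, E)) (1 : G)
    (hsm'.mdifferentiable (by simp) ((1 : G) • p)) ((hsm p).mdifferentiable (by simp) 1)
  have h3 : (fun g : G ↦ g • a • p) ∘ (MulAut.conj a).toMonoidHom =
      (fun x : M ↦ a • x) ∘ fun g : G ↦ g • p := by
    ext g; simp [mul_smul]
  rw [h3, h2] at h1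
  have h4 := congrArg (fun A : EG →L[ℝ] E ↦ A X) h1
  refine Eq.trans (Eq.trans ?_ h4.symm) ?_
  · exact (mfderiv_base (map_one (MulAut.conj a).toMonoidHom) (fun g : G ↦ g • a • p) _).symm
  · exact mfderiv_base (one_smul G p) (fun x : M ↦ a • x) _

end Adjoint

end StdHom
end

noncomputable section

namespace StdHom

/-! ### Skew and self-adjoint operators for a scalar product. -/

section LinearAlgebra

variable {V : Type*} [AddCommGroup V] [Module ℝ V] [FiniteDimensional ℝ V]

/-- In a `Q`-orthogonal basis the diagonal entries of `A²` are `-Q(A b_i, A b_i) / Q(b_i, b_i)`, and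
one of them is nonzero if `A` is. -/
lemma trace_mul_self_of_skew (Q : V →ₗ[ℝ] V →ₗ[ℝ] ℝ) (hs : ∀ x y, Q x y = Q y x)
    (hp : ∀ x, x ≠ 0 → 0 < Q x x) (A : Module.End ℝ V) (hA : ∀ x y, Q (A x) y = - Q x (A y))
    (hA0 : A ≠ 0) : LinearMap.trace ℝ V (A * A) < 0 := by
  obtain ⟨b, hb⟩ := LinearMap.BilinForm.exists_orthogonal_basis (B := Q) ⟨fun x y ↦ hs x y⟩
  have hc (i) : 0 < Q (b i) (b i) := hp _ (b.ne_zero i)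
  have hr (x : V) (i) : Q x (b i) = b.repr x i * Q (b i) (b i) := by
    conv_lhs => rw [← b.sum_repr x]
    simp only [map_sum, map_smul, LinearMap.sum_apply, LinearMap.smul_apply, smul_eq_mul]
    refine Finset.sum_eq_single i (fun j _ hj ↦ ?_) (by simp)
    rw [show Q (b j) (b i) = 0 from hb hj, mul_zero]
  have hn (x : V) : 0 ≤ Q x x := by
    by_cases hx : x = 0
    · simp [hx]
    · exact (hp x hx).le
  have ht (i) : b.repr ((A * A) (b i)) i = - (Q (A (b i)) (A (b i)) / Q (b i) (b i)) := by
    have h1 := hr ((A * A) (b i)) i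
    rw [Module.End.mul_apply, hA] at h1
    rw [← neg_div, h1, mul_div_assoc, div_self (hc i).ne', mul_one]
    rfl
  rw [LinearMap.trace_eq_matrix_trace ℝ b]
  simp only [Matrix.trace, Matrix.diag, LinearMap.toMatrix_apply, ht, Finset.sum_neg_distrib]
  obtain ⟨i, hi⟩ : ∃ i, A (b i) ≠ 0 := by
    by_contra! h
    exact hA0 (b.ext fun i ↦ by simpa using h i)
  exact neg_neg_of_pos (Finset.sum_pos' (fun j _ ↦ div_nonneg (hn _) (hc j).le)
    ⟨i, Finset.mem_univ i, div_pos (hp _ hi) (hc i)⟩)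

/-- The operator which represents `S` with respect to `Q` is self-adjoint, so the spectral theorem
gives a real eigenvector. -/
lemma exists_eigenvector [Nontrivial V] (Q S : V →ₗ[ℝ] V →ₗ[ℝ] ℝ) (hs : ∀ x y, Q x y = Q y x)
    (hp : ∀ x, x ≠ 0 → 0 < Q x x) (hS : ∀ x y, S x y = S y x) :
    ∃ c : ℝ, ∃ w : V, w ≠ 0 ∧ ∀ v, S w v = c * Q w v := by
  have hnd : LinearMap.BilinForm.Nondegenerate Q := by
    refine ⟨fun x hx ↦ ?_, fun x hx ↦ ?_⟩ <;>
    · by_contra h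
      exact (hp x h).ne' (hx x)
  let T : V →ₗ[ℝ] V := (LinearMap.BilinForm.toDual Q hnd).symm.toLinearMap ∘ₗ S
  have hT (x y : V) : Q (T x) y = S x y :=
    LinearMap.BilinForm.apply_toDual_symm_apply (hB := hnd) (S x) y
  let core : InnerProductSpace.Core ℝ V :=
    { inner := fun x y ↦ Q x y
      conj_inner_symm := fun x y ↦ hs y x
      re_inner_nonneg := fun x ↦ by
        by_cases hx : x = 0
        · simp [hx]
        · exact (hp x hx).le
      add_left := fun x y z ↦ by simp
      smul_left := fun x y r ↦ by simp
      definite := fun x hx ↦ by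
        by_contra h
        exact (hp x h).ne' hx }
  let : NormedAddCommGroup V := core.toNormedAddCommGroup
  let : InnerProductSpace ℝ V := InnerProductSpace.ofCore core.toCore
  have hsym : T.IsSymmetric := by
    intro x y
    change Q (T x) y = Q x (T y)
    rw [hT, hs, hT, hS]
  obtain ⟨c, w, hw⟩ : ∃ c, ∃ w, Module.End.HasEigenvector T c w :=
    ⟨_, hsym.hasEigenvalue_iSup_of_finiteDimensional.exists_hasEigenvector⟩
  refine ⟨c, w, hw.2, fun v ↦ ?_⟩
  rw [← hT, hw.apply_eq_smul, map_smul]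
  rfl

end LinearAlgebra

end StdHom
end

noncomputable section

namespace StdHom

/-! ### Definiteness and invariance of the Killing form. -/

section KillingForm

set_option linter.unusedSectionVars false

open MeasureTheory

variable {EG : Type*} [NormedAddCommGroup EG] [NormedSpace ℝ EG] [FiniteDimensional ℝ EG]
  [CompleteSpace EG]
  {G : Type*} [TopologicalSpace G] [ChartedSpace EG G] [Group G] [LieGroup 𝓘(ℝ, EG) ∞ G]

/-- A compact Lie group has an invariant scalar product on its Lie algebra. -/
lemma exists_invariant_form [T2Space G] [CompactSpace G] : ∃ Q : EG →ₗ[ℝ] EG →ₗ[ℝ] ℝ,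
    (∀ X Y, Q X Y = Q Y X) ∧ (∀ X, X ≠ 0 → 0 < Q X X) ∧
    ∀ (a : G) X Y, Q (Ad a X) (Ad a Y) = Q X Y := by
  have : IsTopologicalGroup G := topologicalGroup_of_lieGroup 𝓘(ℝ, EG) ∞
  let : MeasurableSpace G := borel G
  have : BorelSpace G := ⟨rfl⟩
  let μ : Measure G := Measure.haar
  set b := Module.finBasis ℝ EG
  let q : EG →ₗ[ℝ] EG →ₗ[ℝ] ℝ := ∑ i, (b.coord i).smulRight (b.coord i)
  have hq (X Y : EG) : q X Y = ∑ i, b.repr X i * b.repr Y i := by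
    simp [q, LinearMap.sum_apply]
  have hc (X Y : EG) : Continuous fun a : G ↦ q (Ad a⁻¹ X) (Ad a⁻¹ Y) := by
    have h1 (X : EG) : Continuous fun a : G ↦ Ad a⁻¹ X :=
      (contMDiff_Ad X).continuous.comp continuous_inv
    exact (q.toContinuousBilinearMap.continuous.comp (h1 X)).clm_apply (h1 Y)
  have hi (X Y : EG) : Integrable (fun a : G ↦ q (Ad a⁻¹ X) (Ad a⁻¹ Y)) μ :=
    (hc X Y).integrable_of_hasCompactSupport (HasCompactSupport.of_compactSpace _)
  have hq0 (X : EG) : 0 ≤ q X X := by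
    rw [hq]; exact Finset.sum_nonneg fun i _ ↦ mul_self_nonneg _
  -- Weyl's averaging of an arbitrary scalar product over Haar measure. With `a⁻¹` in the integrand,
  -- replacing `X, Y` by `Ad c X, Ad c Y` amounts to a left translation of the variable.
  let Q : EG →ₗ[ℝ] EG →ₗ[ℝ] ℝ := LinearMap.mk₂ ℝ
    (fun X Y ↦ ∫ a : G, q (Ad a⁻¹ X) (Ad a⁻¹ Y) ∂μ)
    (fun X X' Y ↦ by
      simp only [map_add, LinearMap.add_apply]; exact integral_add (hi X Y) (hi X' Y))
    (fun c X Y ↦ by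
      simp only [map_smul, LinearMap.smul_apply, smul_eq_mul]; exact integral_const_mul c _)
    (fun X Y Y' ↦ by
      simp only [map_add]; exact integral_add (hi X Y) (hi X Y'))
    (fun c X Y ↦ by
      simp only [map_smul, smul_eq_mul]; exact integral_const_mul c _)
  refine ⟨Q, fun X Y ↦ ?_, fun X hX ↦ ?_, fun c X Y ↦ ?_⟩
  · change ∫ a : G, _ ∂μ = ∫ a : G, _ ∂μ
    refine integral_congr_ae (Filter.Eventually.of_forall fun a ↦ ?_)
    simp only [hq]
    exact Finset.sum_congr rfl fun i _ ↦ mul_comm _ _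
  · refine (hc X X).integral_pos_of_hasCompactSupport_nonneg_nonzero
      (HasCompactSupport.of_compactSpace _) (fun a ↦ hq0 _) (x := 1) ?_
    intro h
    have h1 : (Ad (1 : G)⁻¹ X : EG) = X := by rw [inv_one, Ad_one]; rfl
    rw [h1, hq, Finset.sum_eq_zero_iff_of_nonneg fun i _ ↦ mul_self_nonneg _] at h
    apply hX
    apply b.ext_elem
    intro i
    simpa using h i (Finset.mem_univ i)
  · change ∫ a : G, q (Ad a⁻¹ (Ad c X)) (Ad a⁻¹ (Ad c Y)) ∂μ = ∫ a : G, q (Ad a⁻¹ X) (Ad a⁻¹ Y) ∂μ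
    rw [← integral_mul_left_eq_self (fun a : G ↦ q (Ad a⁻¹ X) (Ad a⁻¹ Y)) c⁻¹]
    refine integral_congr_ae (Filter.Eventually.of_forall fun a ↦ ?_)
    simp only [mul_inv_rev, inv_inv, Ad_mul]

/-- Derivative at `a = 1` of the constant function `a ↦ Q (Ad a X) (Ad a Y)`. -/
lemma invariant_form_brk {Q : EG →ₗ[ℝ] EG →ₗ[ℝ] ℝ}
    (hQ : ∀ (a : G) X Y, Q (Ad a X) (Ad a Y) = Q X Y) (Z X Y : EG) :
    Q (brk G Z X) Y = - Q X (brk G Z Y) := by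
  have hA (X : EG) : MDifferentiableAt 𝓘(ℝ, EG) 𝓘(ℝ, EG) (fun a : G ↦ Ad a X) 1 :=
    (contMDiff_Ad X).mdifferentiable (by simp) 1
  have h1 := D_bilin Q.toContinuousBilinearMap (hA X) (hA Y) Z
  have h2 : (fun a : G ↦ Q.toContinuousBilinearMap (Ad a X) (Ad a Y)) = fun _ ↦ Q X Y := by
    funext a; exact hQ a X Y
  have e6 (X : EG) : (Ad (1 : G) X : EG) = X := by rw [Ad_one]; rfl
  have h3 : D (fun _ : G ↦ Q X Y) 1 (Z : EG) = 0 := by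
    simp only [D, mvfderiv_const]; rfl
  rw [h2, D_Ad, D_Ad, e6, e6] at h1
  have h4 := h3.symm.trans h1
  exact eq_neg_of_add_eq_zero_left h4.symm

variable (G) in
/-- The adjoint representation of the Lie algebra. -/
def adG (X : EG) : Module.End ℝ EG :=
  LieAlgebra.ad ℝ (GroupLieAlgebra 𝓘(ℝ, EG) G) X

variable (G) in
/-- The negative of the Killing form. -/
def negKilling : EG →L[ℝ] EG →L[ℝ] ℝ :=
  LinearMap.toContinuousBilinearMap (-(killingForm ℝ (GroupLieAlgebra 𝓘(ℝ, EG) G)) :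
    GroupLieAlgebra 𝓘(ℝ, EG) G →ₗ[ℝ] GroupLieAlgebra 𝓘(ℝ, EG) G →ₗ[ℝ] ℝ)

variable (G) in
/-- The Lie bracket as a continuous bilinear map. -/
def brkL : EG →L[ℝ] EG →L[ℝ] EG :=
  LinearMap.toContinuousBilinearMap (LinearMap.mk₂ ℝ (brk G)
    (fun X X' Y ↦ add_lie (L := GroupLieAlgebra 𝓘(ℝ, EG) G) (M := GroupLieAlgebra 𝓘(ℝ, EG) G) X X' Y)
    (fun c X Y ↦ smul_lie (L := GroupLieAlgebra 𝓘(ℝ, EG) G) (M := GroupLieAlgebra 𝓘(ℝ, EG) G) c X Y)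
    (fun X Y Y' ↦ lie_add (L := GroupLieAlgebra 𝓘(ℝ, EG) G) (M := GroupLieAlgebra 𝓘(ℝ, EG) G) X Y Y')
    (fun c X Y ↦ lie_smul (L := GroupLieAlgebra 𝓘(ℝ, EG) G) (M := GroupLieAlgebra 𝓘(ℝ, EG) G) c X Y))

lemma brkL_apply (X Y : EG) : brkL G X Y = brk G X Y := rfl

lemma negKilling_apply (X Y : EG) :
    negKilling G X Y = - killingForm ℝ (GroupLieAlgebra 𝓘(ℝ, EG) G) X Y := rfl

lemma negKilling_eq (X Y : EG) :
    negKilling G X Y = - LinearMap.trace ℝ EG (adG G X * adG G Y) := by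
  rw [negKilling_apply]
  exact congrArg Neg.neg (killingForm_apply_apply ℝ (GroupLieAlgebra 𝓘(ℝ, EG) G) X Y)

lemma negKilling_symm (X Y : EG) : negKilling G X Y = negKilling G Y X := by
  rw [negKilling_eq, negKilling_eq, LinearMap.trace_mul_comm]

lemma brk_skew (X Y : EG) : brk G X Y = - brk G Y X :=
  (lie_skew (L := GroupLieAlgebra 𝓘(ℝ, EG) G) X Y).symm

lemma brk_jacobi (X Y Z : EG) :
    brk G (brk G X Y) Z = brk G X (brk G Y Z) - brk G Y (brk G X Z) :=
  lie_lie (L := GroupLieAlgebra 𝓘(ℝ, EG) G) (M := GroupLieAlgebra 𝓘(ℝ, EG) G) X Y Z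

lemma adG_brk (X Y : EG) : adG G (brk G X Y) = adG G X * adG G Y - adG G Y * adG G X := by
  ext Z; exact brk_jacobi X Y Z

lemma negKilling_brk (X Y Z : EG) :
    negKilling G (brk G X Y) Z = - negKilling G Y (brk G X Z) := by
  rw [negKilling_eq, negKilling_eq, adG_brk, adG_brk, neg_neg, sub_mul, mul_sub, map_sub, map_sub,
    mul_assoc, mul_assoc, LinearMap.trace_mul_comm ℝ (adG G X), mul_assoc, neg_sub]

lemma adG_conj (a : G) (X : EG) : adG G (Ad a X) =
    (Ad a).toLinearMap * adG G X * (Ad a⁻¹).toLinearMap := by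
  ext Y
  change brk G (Ad a X) Y = Ad a (brk G X (Ad a⁻¹ Y))
  rw [Ad_brk, Ad_Ad_inv]

lemma Ad_inv_mul_Ad (a : G) :
    (Ad a⁻¹).toLinearMap * (Ad a).toLinearMap = (1 : Module.End ℝ EG) := by
  ext Y; exact Ad_inv_Ad a Y

/-- `Ad a` is a Lie algebra automorphism for every `a`, so the invariance holds on all of `G` and
not only on its identity component. -/
lemma negKilling_Ad (a : G) (X Y : EG) : negKilling G (Ad a X) (Ad a Y) = negKilling G X Y := by
  rw [negKilling_eq, negKilling_eq, adG_conj, adG_conj]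
  rw [show (Ad a).toLinearMap * adG G X * (Ad a⁻¹).toLinearMap *
      ((Ad a).toLinearMap * adG G Y * (Ad a⁻¹).toLinearMap) =
      (Ad a).toLinearMap * (adG G X * ((Ad a⁻¹).toLinearMap * (Ad a).toLinearMap) * adG G Y *
      (Ad a⁻¹).toLinearMap) by simp only [mul_assoc],
    LinearMap.trace_mul_comm, mul_assoc _ (Ad a⁻¹).toLinearMap, Ad_inv_mul_Ad, mul_one, mul_one]

/-- The Killing form of a compact Lie group with trivial centre of the Lie algebra is negative
definite. -/
theorem negKilling_pos [T2Space G] [CompactSpace G]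
    (hz : ∀ X : EG, (∀ Y, brk G X Y = 0) → X = 0) {X : EG} (hX : X ≠ 0) :
    0 < negKilling G X X := by
  obtain ⟨Q, hs, hp, hQ⟩ := exists_invariant_form (EG := EG) (G := G)
  rw [negKilling_eq]
  -- `ad X` is skew for the averaged scalar product, and nonzero because the centre is trivial.
  refine neg_pos.2 (trace_mul_self_of_skew Q hs hp (adG G X) (fun Y Z ↦ ?_) fun h ↦ hX (hz X ?_))
  · exact invariant_form_brk hQ X Y Z
  · exact fun Y ↦ congrArg (fun A : Module.End ℝ EG ↦ A Y) h

/-- The Lie algebra of a simple Lie algebra has trivial centre. -/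
lemma center_trivial_of_isSimple (h : LieAlgebra.IsSimple ℝ (GroupLieAlgebra 𝓘(ℝ, EG) G)) (X : EG)
    (hX : ∀ Y, brk G X Y = 0) : X = 0 := by
  have hc : LieAlgebra.center ℝ (GroupLieAlgebra 𝓘(ℝ, EG) G) = ⊥ := by
    rcases h.eq_bot_or_eq_top (LieAlgebra.center ℝ (GroupLieAlgebra 𝓘(ℝ, EG) G)) with h1 | h1
    · exact h1
    · exact absurd ((LieAlgebra.isLieAbelian_iff_center_eq_top ℝ _).2 h1) h.non_abelian
  have hm (X : GroupLieAlgebra 𝓘(ℝ, EG) G) (hX : ∀ Y : GroupLieAlgebra 𝓘(ℝ, EG) G, ⁅X, Y⁆ = 0) :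
        X = 0 := by
    have : X ∈ LieAlgebra.center ℝ (GroupLieAlgebra 𝓘(ℝ, EG) G) :=
      (LieModule.mem_maxTrivSubmodule _ _ _ X).2 fun Y ↦ by rw [← lie_skew, hX, neg_zero]
    rwa [hc, LieSubmodule.mem_bot] at this
  exact hm X hX

end KillingForm

end StdHom
end

noncomputable section

namespace StdHom

/-! ### The Killing frame of a homogeneous space with its standard metric. -/

section StandardFrame

set_option linter.unusedSectionVars false

variable {EG : Type*} [NormedAddCommGroup EG] [NormedSpace ℝ EG] [FiniteDimensional ℝ EG]
  [CompleteSpace EG]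
  {G : Type*} [TopologicalSpace G] [ChartedSpace EG G] [Group G] [LieGroup 𝓘(ℝ, EG) ∞ G]
  [T2Space G] [CompactSpace G]
  {E : Type*} [NormedAddCommGroup E] [NormedSpace ℝ E] [FiniteDimensional ℝ E] [CompleteSpace E]
  {M : Type*} [TopologicalSpace M] [ChartedSpace E M] [IsManifold 𝓘(ℝ, E) ∞ M] [MulAction G M]
  {g : Metric E M}

lemma orbitDeriv_eq_fundamental (p : M) (X : EG) :
    orbitDeriv (G := G) (E := E) p X = fundamental EG G E p X := rfl

lemma mem_reductiveComplement (p : M) (X : GroupLieAlgebra 𝓘(ℝ, EG) G) :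
    X ∈ reductiveComplement EG G E p ↔
      ∀ Y : EG, orbitDeriv (G := G) (E := E) p Y = 0 → negKilling G Y X = 0 := by
  refine ⟨fun h Y hY ↦ ?_, fun h Y hY ↦ ?_⟩
  · exact neg_eq_zero.2 (h Y hY)
  · exact neg_eq_zero.1 (h Y hY)

/-- Since the Killing form is definite, `𝔨` and its orthogonal space are complementary. The
differential of the orbit map is onto with kernel `𝔨`, so it restricts to an isomorphism on the
complement, and `θ` is the inverse. -/
lemma exists_lift (hz : ∀ X : EG, (∀ Y, brk G X Y = 0) → X = 0) (p : M)
    (hs : Function.Surjective (orbitDeriv (EG := EG) (G := G) (E := E) p)) :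
    ∃ θ : TangentSpace 𝓘(ℝ, E) p →L[ℝ] EG, ∀ u, orbitDeriv (G := G) p (θ u) = u ∧
      ∀ Y, orbitDeriv (G := G) (E := E) p Y = 0 → negKilling G Y (θ u) = 0 := by
  let B : LinearMap.BilinForm ℝ EG :=
    (ContinuousLinearMap.coeLM ℝ).comp (negKilling G).toLinearMap
  have hB (X Y : EG) : B X Y = negKilling G X Y := rfl
  let F : EG →ₗ[ℝ] E := (orbitDeriv (EG := EG) (G := G) (E := E) p).toLinearMap
  let k : Submodule ℝ EG := LinearMap.ker F
  have hrefl : B.IsRefl := fun X Y h ↦ by rwa [hB, negKilling_symm]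
  have hdis : Disjoint k (B.orthogonal k) := by
    rw [Submodule.disjoint_def]
    intro X hX hX'
    by_contra h0
    exact (negKilling_pos hz h0).ne' (hX' X hX)
  have hcompl := (LinearMap.BilinForm.isCompl_orthogonal_iff_disjoint (W := k) hrefl).2 hdis
  let f : B.orthogonal k →ₗ[ℝ] E := F ∘ₗ (B.orthogonal k).subtype
  have hf : Function.Bijective f := by
    refine ⟨(injective_iff_map_eq_zero f).2 fun X hX ↦ ?_, fun u ↦ ?_⟩
    · exact Subtype.ext ((Submodule.disjoint_def.1 hdis) X hX X.2)
    · obtain ⟨X, hX⟩ := hs u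
      obtain ⟨Y, hY, Z, hZ, hYZ⟩ :=
        Submodule.mem_sup.1 (hcompl.sup_eq_top ▸ Submodule.mem_top : X ∈ k ⊔ B.orthogonal k)
      refine ⟨⟨Z, hZ⟩, ?_⟩
      have h1 : F X = F Y + F Z := by rw [← map_add, hYZ]
      rw [show F Y = 0 from hY, zero_add] at h1
      exact h1.symm.trans hX
  let e := LinearEquiv.ofBijective f hf
  let θ : E →L[ℝ] EG := LinearMap.toContinuousLinearMap
    ((B.orthogonal k).subtype ∘ₗ e.symm.toLinearMap)
  refine ⟨θ, fun u ↦ ⟨e.apply_symm_apply u, fun Y hY ↦ (e.symm u).2 Y hY⟩⟩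

namespace KillingFrame

variable (K : KillingFrame g EG)

lemma P_eq_self_iff (p : M) (X : EG) :
    K.P p X = X ↔ ∀ Y, K.F p Y = 0 → K.ip Y X = 0 := by
  refine ⟨fun h Y hY ↦ ?_, fun h ↦ ?_⟩
  · rw [← h, ← K.ip_P, P_apply, hY, map_zero, map_zero]; rfl
  · refine K.ext_ip fun Z ↦ ?_
    have h1 := h (Z - K.P p Z) (by rw [map_sub, F_P, sub_self])
    rw [K.ip_symm, map_sub, sub_eq_zero] at h1
    rw [K.ip_P, h1]

/-- The frame of the fundamental vector fields of the action of `G`. -/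
structure IsStandard (G : Type*) [TopologicalSpace G] [ChartedSpace EG G] [Group G]
    [LieGroup 𝓘(ℝ, EG) ∞ G] [MulAction G M] : Prop where
  smooth_action : ContMDiffSMul 𝓘(ℝ, EG) 𝓘(ℝ, E) ∞ G M
  br_eq : K.br = brkL G
  ip_eq : K.ip = negKilling G
  F_eq : ∀ p X, K.F p X = orbitDeriv (G := G) p X

lemma exists_isStandard (hM : IsHomogeneousSpace EG G E M) (hg : IsStandardMetric EG G E M g)
    (hz : ∀ X : EG, (∀ Y, brk G X Y = 0) → X = 0) : ∃ K : KillingFrame g EG, K.IsStandard G := by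
  have hs (p : M) : Function.Surjective (orbitDeriv (EG := EG) (G := G) (E := E) p) :=
    hM.submersion p
  choose θ hθ using fun p : M ↦ exists_lift hz p (hs p)
  refine ⟨{ br := brkL G
            ip := negKilling G
            F := orbitDeriv (G := G)
            θ := θ
            br_skew := brk_skew
            jacobi := brk_jacobi
            ip_symm := negKilling_symm
            ip_br := negKilling_brk
            ip_nondeg := fun X hX ↦ by
              by_contra h
              exact (negKilling_pos hz h).ne' (hX X)
            F_θ := fun x u ↦ (hθ x u).1
            ip_θ := fun x u Y ↦ ?_
            smooth := fieldSmoothAt_orbitDeriv hM.smooth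
            bracket := mlieBracket_orbitDeriv hM.smooth }, hM.smooth, rfl, rfl, fun _ _ ↦ rfl⟩
  -- `Y` and the lift of its value at `x` differ by an isotropy element, which is orthogonal to `θ
  -- u`; so `Y` may be taken in `𝔪`, where the metric is `-B`.
  have h1 : orbitDeriv (G := G) (E := E) x (Y - θ x (orbitDeriv (G := G) x Y)) = 0 := by
    rw [map_sub, (hθ x _).1, sub_self]
  have h2 := (hθ x u).2 _ h1
  rw [negKilling_symm, map_sub, sub_eq_zero] at h2
  rw [h2, negKilling_apply]
  refine Eq.trans (hg x _ ((mem_reductiveComplement x _).2 (hθ x u).2) _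
    ((mem_reductiveComplement x _).2 (hθ x (orbitDeriv (G := G) x Y)).2)).symm ?_
  rw [← orbitDeriv_eq_fundamental, ← orbitDeriv_eq_fundamental, (hθ x _).1, (hθ x _).1]

variable {K} (hK : K.IsStandard G)
include hK

/-- The chosen lift lies in `𝔪`, hence is fixed by `P = θ ∘ F`, which determines it. -/
lemma IsStandard.horizontalLift_eq (p : M) (u : TangentSpace 𝓘(ℝ, E) p) :
    horizontalLift EG G E p u = K.θ p u := by
  have hex : ∃ X ∈ reductiveComplement EG G E p, fundamental EG G E p X = u := by
    refine ⟨K.θ p u, (mem_reductiveComplement p _).2 fun Y hY ↦ ?_, ?_⟩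
    · rw [← hK.ip_eq]
      exact (K.P_eq_self_iff p _).1 (K.P_θ p u) Y ((hK.F_eq p Y).trans hY)
    · exact (hK.F_eq p _).symm.trans (K.F_θ p u)
  rw [horizontalLift, dif_pos hex]
  obtain ⟨h1, h2⟩ := hex.choose_spec
  have h3 : K.P p hex.choose = hex.choose := by
    refine (K.P_eq_self_iff p _).2 fun Y hY ↦ ?_
    rw [hK.ip_eq]
    exact (mem_reductiveComplement p _).1 h1 Y ((hK.F_eq p Y).symm.trans hY)
  have h4 : K.F p hex.choose = u := (hK.F_eq p _).trans h2
  exact h3.symm.trans (congrArg (K.θ p) h4)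

lemma IsStandard.canonicalTorsion_eq (p : M) (u v : TangentSpace 𝓘(ℝ, E) p) :
    canonicalTorsion EG G E p u v = - K.F p (K.br (K.θ p u) (K.θ p v)) := by
  rw [canonicalTorsion, hK.horizontalLift_eq, hK.horizontalLift_eq, hK.F_eq, hK.br_eq]
  rfl

lemma IsStandard.adj_eq (X : EG) : K.adj X = adG G X := by
  rw [adj, hK.br_eq]; rfl

theorem IsStandard.isNablaEinstein {α : ℝ} {nabla : AffineConnection E M}
    (hn : IsNablaAlpha EG G E M g α nabla)
    (hc : ∀ p, ∃ c : ℝ, ∀ X Y, K.P p X = X → K.P p Y = Y →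
      LinearMap.trace ℝ EG (K.proj p * K.adj X * K.proj p * K.adj Y) = c * K.ip X Y) :
    IsNablaEinstein g nabla := by
  have hip (X Y : EG) : LinearMap.trace ℝ EG (K.adj X * K.adj Y) = - K.ip X Y := by
    rw [hK.ip_eq, hK.adj_eq, hK.adj_eq, negKilling_eq, neg_neg]
  -- The torsion `α T^c = -α F [θu, θv]` requires `1 + 2a = -α`.
  refine K.isNablaEinstein (-(1 + α) / 2) nabla hn.metric (fun p u v ↦ ?_) hip fun p ↦ ?_
  · rw [hn.torsion_eq, hK.canonicalTorsion_eq, smul_neg, ← neg_smul]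
    congr 1
    ring
  · obtain ⟨c, hc⟩ := hc p
    refine ⟨-c, fun X Y hX hY ↦ ?_⟩
    rw [hc X Y hX hY, hip]
    ring

lemma IsStandard.F_Ad {a : G} {p q : M} (h : a • p = q) (X : EG) :
    (K.F q (Ad a X) : E) = mfderiv 𝓘(ℝ, E) 𝓘(ℝ, E) (fun x : M ↦ a • x) p (K.F p X) := by
  subst h
  rw [hK.F_eq, hK.F_eq]
  exact orbitDeriv_Ad hK.smooth_action a p X

/-- `Ad a` carries the isotropy algebra at `p` to that at `q` and preserves the Killing form, hence
also carries one complement to the other. -/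
lemma IsStandard.P_Ad {a : G} {p q : M} (h : a • p = q) (X : EG) :
    K.P q (Ad a X) = Ad a (K.P p X) := by
  have h1 : K.P q (Ad a (K.P p X)) = Ad a (K.P p X) := by
    refine (K.P_eq_self_iff q _).2 fun Y hY ↦ ?_
    rw [hK.ip_eq, ← Ad_Ad_inv a Y, negKilling_Ad, ← hK.ip_eq]
    refine (K.P_eq_self_iff p _).1 (K.P_P p X) _ ?_
    have h2 := hK.F_Ad (a := a⁻¹) (p := q) (q := p) (by rw [← h, inv_smul_smul]) Y
    rw [hY] at h2
    exact h2.trans (map_zero _)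
  rw [← h1, P_apply, P_apply]
  congr 1
  have h2 := hK.F_Ad h X
  have h3 := hK.F_Ad h (K.P p X)
  rw [F_P] at h3
  exact h2.trans h3.symm

lemma IsStandard.proj_Ad {a : G} {p q : M} (h : a • p = q) :
    K.proj q = (Ad a).toLinearMap * K.proj p * (Ad a⁻¹).toLinearMap := by
  ext X
  change K.P q X = Ad a (K.P p (Ad a⁻¹ X))
  rw [← hK.P_Ad h, Ad_Ad_inv]

/-- Used in two ways: with `q = p` it is the isotropy invariance needed for Schur's lemma, and with
transitivity it reduces the diagonal case to one point. -/
lemma IsStandard.trace_Ad {a : G} {p q : M} (h : a • p = q) (X Y : EG) :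
    LinearMap.trace ℝ EG (K.proj q * K.adj (Ad a X) * K.proj q * K.adj (Ad a Y)) =
      LinearMap.trace ℝ EG (K.proj p * K.adj X * K.proj p * K.adj Y) := by
  simp only [hK.adj_eq, adG_conj, hK.proj_Ad h]
  have hA := Ad_inv_mul_Ad (EG := EG) a
  set A := (Ad (EG := EG) a).toLinearMap
  set A' := (Ad (EG := EG) a⁻¹).toLinearMap
  have hA' (B : Module.End ℝ EG) : A' * (A * B) = B := by rw [← mul_assoc, hA, one_mul]
  simp only [mul_assoc, hA']
  rw [LinearMap.trace_mul_comm]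
  simp only [mul_assoc, hA, mul_one]

end KillingFrame

end StandardFrame

end StdHom
end

noncomputable section

namespace StdHom

/-! ### Schur's lemma for irreducible isotropy. -/

section Irreducible

set_option linter.unusedSectionVars false

variable {EG : Type*} [NormedAddCommGroup EG] [NormedSpace ℝ EG] [FiniteDimensional ℝ EG]
  [CompleteSpace EG]
  {G : Type*} [TopologicalSpace G] [ChartedSpace EG G] [Group G] [LieGroup 𝓘(ℝ, EG) ∞ G]
  [T2Space G] [CompactSpace G]
  {E : Type*} [NormedAddCommGroup E] [NormedSpace ℝ E] [FiniteDimensional ℝ E] [CompleteSpace E]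
  {M : Type*} [TopologicalSpace M] [ChartedSpace E M] [IsManifold 𝓘(ℝ, E) ∞ M] [MulAction G M]
  {g : Metric E M}

namespace KillingFrame

variable {K : KillingFrame g EG}

variable (K) in
/-- The trace form of the compressed adjoint action, on the tangent space. -/
def traceForm (p : M) :
    TangentSpace 𝓘(ℝ, E) p →ₗ[ℝ] TangentSpace 𝓘(ℝ, E) p →ₗ[ℝ] ℝ :=
  LinearMap.mk₂ ℝ (fun u v ↦ LinearMap.trace ℝ EG
      (K.proj p * K.adj (K.θ p u) * K.proj p * K.adj (K.θ p v)))
    (fun u u' v ↦ by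
      rw [← map_add]; congr 1; ext X; simp [adj, proj])
    (fun c u v ↦ by
      rw [← map_smul]; congr 1; ext X; simp [adj, proj])
    (fun u v v' ↦ by
      rw [← map_add]; congr 1; ext X; simp [adj, proj])
    (fun c u v ↦ by
      rw [← map_smul]; congr 1; ext X; simp [adj, proj])

lemma traceForm_symm (p : M) (u v : TangentSpace 𝓘(ℝ, E) p) :
    K.traceForm p u v = K.traceForm p v u := by
  change LinearMap.trace ℝ EG _ = LinearMap.trace ℝ EG _
  rw [mul_assoc, LinearMap.trace_mul_comm, ← mul_assoc]

/-- Schur's lemma for the trace form on an irreducible isotropy representation. -/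
theorem IsStandard.exists_trace_eq_of_irreducible (hK : K.IsStandard G)
    (hirr : IsIsotropyIrreducible G E M) (p : M) : ∃ c : ℝ, ∀ X Y, K.P p X = X → K.P p Y = Y →
      LinearMap.trace ℝ EG (K.proj p * K.adj X * K.proj p * K.adj Y) = c * K.ip X Y := by
  obtain ⟨hnt, hirr⟩ := hirr p
  let Q : TangentSpace 𝓘(ℝ, E) p →ₗ[ℝ] TangentSpace 𝓘(ℝ, E) p →ₗ[ℝ] ℝ :=
    (ContinuousLinearMap.coeLM ℝ).comp (g.inner p).toLinearMap
  obtain ⟨c, w, hw0, hw⟩ := exists_eigenvector Q (K.traceForm p) (g.symm p) (g.pos p)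
    (K.traceForm_symm p)
  -- The eigenspace for `c` of the trace form relative to the metric. It is nonzero, as it contains
  -- `w`, and isotropy invariant, so it is everything.
  let W : Submodule ℝ (TangentSpace 𝓘(ℝ, E) p) := LinearMap.ker (K.traceForm p - c • Q)
  have hW (w) : w ∈ W ↔ ∀ v, K.traceForm p w v = c * g.inner p w v := by
    rw [LinearMap.mem_ker, LinearMap.ext_iff]
    refine forall_congr' fun v ↦ ?_
    rw [LinearMap.sub_apply, LinearMap.sub_apply, LinearMap.zero_apply, sub_eq_zero]
    rfl
  have hWt : W = ⊤ := by
    refine (hirr W fun a w hw w' hww' ↦ ?_).resolve_left fun h ↦ hw0 ?_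
    · have h1 : a • p = p := congrArg TotalSpace.proj hww'
      let s : TangentBundle 𝓘(ℝ, E) M → E := fun z ↦ z.2
      have h2 : (mfderiv 𝓘(ℝ, E) 𝓘(ℝ, E) (fun x : M ↦ a • x) p w : E) = w' := congrArg s hww'
      have h1' : a⁻¹ • p = p := by rw [inv_smul_eq_iff, h1]
      have h3 : K.F p (Ad a (K.θ p w)) = w' := by
        refine (hK.F_Ad h1 (K.θ p w)).trans ?_
        rw [K.F_θ]
        exact h2
      -- Under `θ` the isotropy action of `a` becomes `Ad a`; the invariance of both forms then
      -- moves `Ad a` to the other argument as `Ad a⁻¹`.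
      have h4 : K.θ p w' = Ad a (K.θ p w) := by
        rw [← h3]
        exact (hK.P_Ad h1 _).trans (by rw [K.P_θ])
      rw [hW] at hw ⊢
      intro v
      have h5 : K.θ p (K.F p (Ad a⁻¹ (K.θ p v))) = Ad a⁻¹ (K.θ p v) :=
        (hK.P_Ad h1' _).trans (by rw [K.P_θ])
      have h6 := hw (K.F p (Ad a⁻¹ (K.θ p v)))
      have h7 := hK.trace_Ad h1 (K.θ p w) (Ad a⁻¹ (K.θ p v))
      rw [K.inner_eq, h5, hK.ip_eq, ← negKilling_Ad a, Ad_Ad_inv, ← h4, ← hK.ip_eq,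
        ← K.inner_eq] at h6
      rw [← h6]
      change LinearMap.trace ℝ EG (K.proj p * K.adj (K.θ p w') * K.proj p * K.adj (K.θ p v)) =
        LinearMap.trace ℝ EG (K.proj p * K.adj (K.θ p w) * K.proj p * K.adj (K.θ p _))
      rw [h5, ← h7, Ad_Ad_inv, h4]
    · have : w ∈ W := (hW w).2 hw
      rwa [h, Submodule.mem_bot] at this
  refine ⟨c, fun X Y hX hY ↦ ?_⟩
  have h1 := (hW (K.F p X)).1 (hWt ▸ Submodule.mem_top) (K.F p Y)
  rw [K.inner_eq] at h1
  change LinearMap.trace ℝ EG (K.proj p * K.adj (K.P p X) * K.proj p * K.adj (K.P p Y)) =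
    c * K.ip (K.P p X) (K.P p Y) at h1
  rwa [hX, hY] at h1

end KillingFrame

end Irreducible

end StdHom
end

noncomputable section

namespace StdHom

/-! ### From the stabilizer to the isotropy algebra. -/

section Isotropy

set_option linter.unusedSectionVars false

open scoped Topology

variable {EG : Type*} [NormedAddCommGroup EG] [NormedSpace ℝ EG] [CompleteSpace EG]
  {G : Type*} [TopologicalSpace G] [ChartedSpace EG G] [Group G] [LieGroup 𝓘(ℝ, EG) ∞ G]
  {EH : Type*} [NormedAddCommGroup EH] [NormedSpace ℝ EH] [CompleteSpace EH]
  {H : Type*} [TopologicalSpace H] [ChartedSpace EH H] [Group H] [LieGroup 𝓘(ℝ, EH) ∞ H]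
  {E : Type*} [NormedAddCommGroup E] [NormedSpace ℝ E] [CompleteSpace E]
  {M : Type*} [TopologicalSpace M] [ChartedSpace E M] [IsManifold 𝓘(ℝ, E) ∞ M]

/-- The derivative in strict form, as the implicit function theorem requires. -/
lemma hasStrictFDerivAt_chart {f : G → M} {a : G} {z : M} (hz : f a = z)
    (hf : ContMDiffAt 𝓘(ℝ, EG) 𝓘(ℝ, E) ∞ f a) :
    HasStrictFDerivAt (fun y ↦ extChartAt 𝓘(ℝ, E) z (f ((extChartAt 𝓘(ℝ, EG) a).symm y)))
      (mfderiv 𝓘(ℝ, EG) 𝓘(ℝ, E) f a : EG →L[ℝ] E) (extChartAt 𝓘(ℝ, EG) a a) := by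
  subst hz
  have h1 := (contMDiffAt_iff.1 hf).2
  have h2 := (hf.mdifferentiableAt (by simp)).mfderiv
  rw [ModelWithCorners.range_eq_univ, fderivWithin_univ] at h2
  rw [ModelWithCorners.range_eq_univ, contDiffWithinAt_univ] at h1
  have h3 := h1.hasStrictFDerivAt (by simp)
  rw [h2]
  exact h3

/-- Homomorphisms which agree on the stabilizer of a point have differentials which agree on the
isotropy algebra. -/
lemma dHom_eq_of_orbitDeriv_eq_zero [FiniteDimensional ℝ E] [MulAction G M]
    (h : ContMDiffSMul 𝓘(ℝ, EG) 𝓘(ℝ, E) ∞ G M) (o : M)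
    (hs : Function.Surjective (orbitDeriv (EG := EG) (G := G) (E := E) o)) {f f' : G →* H}
    (hf : ContMDiff 𝓘(ℝ, EG) 𝓘(ℝ, EH) ∞ f) (hf' : ContMDiff 𝓘(ℝ, EG) 𝓘(ℝ, EH) ∞ f')
    (hff' : ∀ a : G, a • o = o → f a = f' a) {X : EG}
    (hX : orbitDeriv (G := G) (E := E) o X = 0) : (dHom f X : EH) = dHom f' X := by
  have hsm : ContMDiff 𝓘(ℝ, EG) 𝓘(ℝ, E) ∞ (fun g : G ↦ g • o) :=
    h.contMDiff_smul.comp (contMDiff_id.prodMk contMDiff_const)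
  set φ := extChartAt 𝓘(ℝ, EG) (1 : G)
  set ψ := extChartAt 𝓘(ℝ, E) o
  set χ := extChartAt 𝓘(ℝ, EH) (1 : H)
  let F' : EG →L[ℝ] E := orbitDeriv (EG := EG) (G := G) (E := E) o
  have hF : HasStrictFDerivAt (fun y ↦ ψ (φ.symm y • o)) F' (φ 1) :=
    hasStrictFDerivAt_chart (f := fun g : G ↦ g • o) (one_smul G o) (hsm.contMDiffAt (x := 1))
  have hF0 : ψ (φ.symm (φ 1) • o) = ψ o := by
    rw [φ.left_inv (mem_extChartAt_source (I := 𝓘(ℝ, EG)) (1 : G)), one_smul]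
  have hk (f : G →* H) (hf : ContMDiff 𝓘(ℝ, EG) 𝓘(ℝ, EH) ∞ f) :
      HasStrictFDerivAt (fun y ↦ χ (f (φ.symm y))) (dHom f : EG →L[ℝ] EH) (φ 1) :=
    hasStrictFDerivAt_chart f.map_one (hf.contMDiffAt (x := 1))
  have hr : F'.range = ⊤ := LinearMap.range_eq_top.2 hs
  -- A parametrization of the stabilizer near `1` in a chart, by the implicit function theorem; its
  -- derivative at `0` is the inclusion of the isotropy algebra. Both homomorphisms agree along `γ`,
  -- so their differentials agree on that kernel.
  set γ := hF.implicitFunction _ F' hr (ψ (φ.symm (φ 1) • o)) with hγdef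
  have hγ : HasStrictFDerivAt γ F'.ker.subtypeL 0 := hF.to_implicitFunction hr
  have hγ0 : γ 0 = φ 1 := hF.implicitFunction_apply_image hr
  have hγc : Filter.Tendsto γ (𝓝 0) (𝓝 (φ 1)) := hγ0 ▸ hγ.continuousAt
  have hev1 : ∀ᶠ z in 𝓝 (0 : F'.ker), ψ (φ.symm (γ z) • o) = ψ o := by
    have t : Filter.Tendsto (fun z : F'.ker ↦ (ψ (φ.symm (φ 1) • o), z)) (𝓝 0)
        (𝓝 (ψ (φ.symm (φ 1) • o), 0)) := tendsto_const_nhds.prodMk_nhds Filter.tendsto_id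
    filter_upwards [t.eventually (hF.map_implicitFunction_eq hr)] with z hz
    exact hz.trans hF0
  -- The chart `ψ` is injective only on its source, so `γ` must be kept where the orbit stays inside
  -- it.
  have hev2 : ∀ᶠ z in 𝓝 (0 : F'.ker), φ.symm (γ z) • o ∈ ψ.source := by
    have c : ContinuousAt (fun y ↦ φ.symm y • o) (φ 1) :=
      (hsm.continuous.continuousAt).comp (continuousAt_extChartAt_symm (I := 𝓘(ℝ, EG)) (1 : G))
    refine (c.tendsto.comp hγc).eventually ?_
    rw [φ.left_inv (mem_extChartAt_source (I := 𝓘(ℝ, EG)) (1 : G)), one_smul]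
    exact extChartAt_source_mem_nhds (I := 𝓘(ℝ, E)) o
  have hev : (fun z ↦ χ (f (φ.symm (γ z)))) =ᶠ[𝓝 0] fun z ↦ χ (f' (φ.symm (γ z))) := by
    filter_upwards [hev1, hev2] with z h1 h2
    rw [hff' _ (ψ.injOn h2 (mem_extChartAt_source (I := 𝓘(ℝ, E)) o) h1)]
  have d1 := ((hγ0 ▸ hk f hf : HasStrictFDerivAt _ _ (γ 0)).comp 0 hγ).hasFDerivAt
  have d2 := ((hγ0 ▸ hk f' hf' : HasStrictFDerivAt _ _ (γ 0)).comp 0 hγ).hasFDerivAt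
  have d3 := d1.unique (d2.congr_of_eventuallyEq hev)
  exact congrArg (fun A : F'.ker →L[ℝ] EH ↦ A ⟨X, hX⟩) d3

end Isotropy

/-! ### Differential calculus on a power of a Lie group. -/

section Power

set_option linter.unusedSectionVars false

variable {EG : Type*} [NormedAddCommGroup EG] [NormedSpace ℝ EG] [CompleteSpace EG]
  {G : Type*} [TopologicalSpace G] [ChartedSpace EG G] [Group G] [LieGroup 𝓘(ℝ, EG) ∞ G]
  {EH : Type*} [NormedAddCommGroup EH] [NormedSpace ℝ EH] [CompleteSpace EH]
  {H : Type*} [TopologicalSpace H] [ChartedSpace EH H] [Group H] [LieGroup 𝓘(ℝ, EH) ∞ H]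
  {EN : Type*} [NormedAddCommGroup EN] [NormedSpace ℝ EN]
  {N : Type*} [TopologicalSpace N] [ChartedSpace EN N]
  {q : ℕ} {e : G ≃* (Fin q → H)}

lemma mfderiv_mul_apply_eq_zero {f f' : N → G} {x : N} {v : TangentSpace 𝓘(ℝ, EN) x}
    (hf : MDifferentiableAt 𝓘(ℝ, EN) 𝓘(ℝ, EG) f x)
    (hf' : MDifferentiableAt 𝓘(ℝ, EN) 𝓘(ℝ, EG) f' x) (h : mfderiv 𝓘(ℝ, EN) 𝓘(ℝ, EG) f x v = 0)
    (h' : mfderiv 𝓘(ℝ, EN) 𝓘(ℝ, EG) f' x v = 0) :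
    mfderiv 𝓘(ℝ, EN) 𝓘(ℝ, EG) (fun x ↦ f x * f' x) x v = 0 := by
  have h1 := mfderiv_comp (I := 𝓘(ℝ, EN)) (I' := 𝓘(ℝ, EG).prod 𝓘(ℝ, EG)) (I'' := 𝓘(ℝ, EG)) x
    (g := fun z : G × G ↦ z.1 * z.2) (f := fun x ↦ (f x, f' x))
    (contMDiff_mul'.mdifferentiable (by simp) _) (hf.prodMk hf')
  rw [mfderiv_prodMk hf hf'] at h1
  have h2 := congrArg (fun A : EN →L[ℝ] EG ↦ A v) h1
  refine h2.trans ?_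
  have h3 : ((mfderiv 𝓘(ℝ, EN) 𝓘(ℝ, EG) f x).prod (mfderiv 𝓘(ℝ, EN) 𝓘(ℝ, EG) f' x)) v = 0 :=
    Prod.ext h h'
  exact (congrArg (mfderiv (𝓘(ℝ, EG).prod 𝓘(ℝ, EG)) 𝓘(ℝ, EG) (fun z : G × G ↦ z.1 * z.2)
    (f x, f' x)) h3).trans (map_zero _)

namespace IsLieGroupPower

variable (he : IsLieGroupPower EG EH e)
include he

/-- Only the projections and the inclusions of single factors are known to be smooth. A map into `G`
with components `u i` is the product of the maps `u i` put into single factors, so its smoothness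
and the vanishing of its derivative follow one factor at a time. -/
lemma contMDiff_and_mfderiv {u : Fin q → N → H}
    (hu : ∀ i, ContMDiff 𝓘(ℝ, EN) 𝓘(ℝ, EH) ∞ (u i)) :
    ContMDiff 𝓘(ℝ, EN) 𝓘(ℝ, EG) ∞ (fun n ↦ e.symm fun i ↦ u i n) ∧
    ∀ (x : N) (v : TangentSpace 𝓘(ℝ, EN) x), (∀ i, mfderiv 𝓘(ℝ, EN) 𝓘(ℝ, EH) (u i) x v = 0) →
      mfderiv 𝓘(ℝ, EN) 𝓘(ℝ, EG) (fun n ↦ e.symm fun i ↦ u i n) x v = 0 := by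
  -- Induction on the number `k` of nontrivial components; the others are set to `1`.
  suffices h : ∀ k ≤ q,
      ContMDiff 𝓘(ℝ, EN) 𝓘(ℝ, EG) ∞ (fun n ↦ e.symm fun i ↦ if i.val < k then u i n else 1) ∧
      ∀ (x : N) (v : TangentSpace 𝓘(ℝ, EN) x), (∀ i, mfderiv 𝓘(ℝ, EN) 𝓘(ℝ, EH) (u i) x v = 0) →
        mfderiv 𝓘(ℝ, EN) 𝓘(ℝ, EG)
          (fun n ↦ e.symm fun i ↦ if i.val < k then u i n else 1) x v = 0 by
    have hq : (fun n ↦ e.symm fun i : Fin q ↦ if i.val < q then u i n else 1) =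
        fun n ↦ e.symm fun i ↦ u i n := by simp
    rw [← hq]
    exact h q le_rfl
  intro k
  induction k with
  | zero =>
    intro _
    have h0 : (fun n ↦ e.symm fun i : Fin q ↦ if i.val < 0 then u i n else 1) =
        fun _ ↦ e.symm 1 := by
      simp only [not_lt_zero, if_false]; rfl
    rw [h0]
    refine ⟨contMDiff_const, fun x v _ ↦ ?_⟩
    rw [mfderiv_const]
    rfl
  | succ k ih =>
    intro hk
    obtain ⟨h1, h2⟩ := ih (by omega)
    let j : Fin q := ⟨k, hk⟩
    have hstep : (fun n ↦ e.symm fun i : Fin q ↦ if i.val < k + 1 then u i n else 1) =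
        fun n ↦ (e.symm fun i ↦ if i.val < k then u i n else 1) *
          e.symm (Pi.mulSingle j (u j n)) := by
      funext n
      rw [← map_mul]
      congr 1
      funext i
      rw [Pi.mul_apply]
      by_cases hi : i = j
      · subst hi; simp [j]
      · have hik : i.val ≠ k := fun h ↦ hi (Fin.ext h)
        rw [Pi.mulSingle_eq_of_ne hi, mul_one]
        simp only [show i.val < k + 1 ↔ i.val < k by omega]
    have h3 : ContMDiff 𝓘(ℝ, EN) 𝓘(ℝ, EG) ∞ fun n ↦ e.symm (Pi.mulSingle j (u j n)) :=
      (he.smooth_incl j).comp (hu j)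
    rw [hstep]
    refine ⟨h1.mul h3, fun x v hv ↦ mfderiv_mul_apply_eq_zero (h1.mdifferentiable (by simp) x)
      (h3.mdifferentiable (by simp) x) (h2 x v hv) ?_⟩
    have h4 := mfderiv_comp (I := 𝓘(ℝ, EN)) (I' := 𝓘(ℝ, EH)) (I'' := 𝓘(ℝ, EG)) x
      (g := fun h : H ↦ e.symm (Pi.mulSingle j h)) (f := u j)
      ((he.smooth_incl j).mdifferentiable (by simp) _) ((hu j).mdifferentiable (by simp) x)
    have h5 := congrArg (fun A : EN →L[ℝ] EG ↦ A v) h4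
    refine h5.trans ?_
    exact (congrArg (mfderiv 𝓘(ℝ, EH) 𝓘(ℝ, EG) (fun h : H ↦ e.symm (Pi.mulSingle j h)) (u j x))
      (hv j)).trans (map_zero _)

end IsLieGroupPower

/-- The projections of a power of a Lie group. -/
def powProj (e : G ≃* (Fin q → H)) (i : Fin q) : G →* H := (Pi.evalMonoidHom _ i).comp e.toMonoidHom

/-- The inclusions of the factors of a power of a Lie group. -/
def powIncl (e : G ≃* (Fin q → H)) (i : Fin q) : H →* G :=
  e.symm.toMonoidHom.comp (MonoidHom.mulSingle (fun _ : Fin q ↦ H) i)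

/-- The diagonal of a power of a Lie group. -/
def powDiag (e : G ≃* (Fin q → H)) : H →* G :=
  e.symm.toMonoidHom.comp (Pi.constMonoidHom (Fin q) H)

namespace IsLieGroupPower

variable (he : IsLieGroupPower EG EH e)
include he

lemma contMDiff_powProj (i : Fin q) : ContMDiff 𝓘(ℝ, EG) 𝓘(ℝ, EH) ∞ (powProj e i) :=
  he.smooth_proj i

lemma contMDiff_powIncl (i : Fin q) : ContMDiff 𝓘(ℝ, EH) 𝓘(ℝ, EG) ∞ (powIncl e i) :=
  he.smooth_incl i

lemma contMDiff_powDiag : ContMDiff 𝓘(ℝ, EH) 𝓘(ℝ, EG) ∞ (powDiag e) :=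
  (he.contMDiff_and_mfderiv (u := fun _ h ↦ h) fun _ ↦ contMDiff_id).1

/-- The identity of `G`, written through its components, has zero derivative along a vector killed
by the differentials of all projections. -/
lemma ext_dHom {X Y : EG} (h : ∀ i, (dHom (powProj e i) X : EH) = dHom (powProj e i) Y) :
    X = Y := by
  rw [← sub_eq_zero]
  have h1 := (he.contMDiff_and_mfderiv (u := fun i g ↦ e g i) he.smooth_proj).2 1 (X - Y : EG)
    fun i ↦ ?_
  · have h2 : (fun g ↦ e.symm fun i ↦ e g i) = id := by ext g; simp
    rw [h2, mfderiv_id] at h1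
    exact h1
  · have h3 : (dHom (EH := EH) (powProj e i) (X - Y) : EH) = 0 := by
      rw [map_sub, h i, sub_self]
    exact h3

lemma dHom_powProj_powIncl_same (i : Fin q) (x : EH) :
    (dHom (powProj e i) (dHom (powIncl e i) x : EG) : EH) = x := by
  rw [← dHom_comp (he.contMDiff_powProj i) (he.contMDiff_powIncl i)]
  have : (powProj e i).comp (powIncl e i) = MonoidHom.id H := by
    ext h; simp [powProj, powIncl]
  rw [this, dHom_id]
  rfl

lemma dHom_powProj_powIncl_ne {i j : Fin q} (hij : i ≠ j) (x : EH) :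
    (dHom (powProj e i) (dHom (powIncl e j) x : EG) : EH) = 0 := by
  rw [← dHom_comp (he.contMDiff_powProj i) (he.contMDiff_powIncl j)]
  have : ((powProj e i).comp (powIncl e j) : H → H) = fun _ ↦ 1 := by
    ext h; simp [powProj, powIncl, hij]
  rw [dHom, this, mfderiv_const]
  rfl

lemma dHom_powProj_powDiag (i : Fin q) (x : EH) :
    (dHom (powProj e i) (dHom (powDiag e) x : EG) : EH) = x := by
  rw [← dHom_comp (he.contMDiff_powProj i) he.contMDiff_powDiag]
  have : (powProj e i).comp (powDiag e) = MonoidHom.id H := by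
    ext h; simp [powProj, powDiag]
  rw [this, dHom_id]
  rfl

end IsLieGroupPower

end Power

end StdHom
end

noncomputable section

namespace StdHom

/-! ### Traces of block diagonal endomorphisms compressed by an average. -/

section BlockTrace

set_option linter.unusedSectionVars false

variable {V U : Type*} [AddCommGroup V] [Module ℝ V] [FiniteDimensional ℝ V]
  [AddCommGroup U] [Module ℝ U] [FiniteDimensional ℝ U] {ι : Type*} [Fintype ι]

/-- The block diagonal endomorphism. -/
def blockDiag (pr : ι → V →ₗ[ℝ] U) (ic : ι → U →ₗ[ℝ] V) (A : ι → Module.End ℝ U) :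
    Module.End ℝ V := ∑ i, ic i ∘ₗ A i ∘ₗ pr i

/-- The average over the blocks. -/
def blockAverage (pr : ι → V →ₗ[ℝ] U) (ic : ι → U →ₗ[ℝ] V) : Module.End ℝ V :=
  (Fintype.card ι : ℝ)⁻¹ • ((∑ i, ic i) ∘ₗ ∑ i, pr i)

variable {pr : ι → V →ₗ[ℝ] U} {ic : ι → U →ₗ[ℝ] V} (h1 : ∀ i x, pr i (ic i x) = x)
  (h0 : ∀ i j, i ≠ j → ∀ x, pr i (ic j x) = 0)
include h1

lemma trace_blockDiag (A : ι → Module.End ℝ U) :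
    LinearMap.trace ℝ V (blockDiag pr ic A) = ∑ i, LinearMap.trace ℝ U (A i) := by
  rw [blockDiag, map_sum]
  refine Finset.sum_congr rfl fun i _ ↦ ?_
  rw [LinearMap.trace_comp_comm', LinearMap.comp_assoc]
  congr 1
  ext x
  simp [h1]

include h0

lemma pr_blockDiag (A : ι → Module.End ℝ U) (j : ι) (X : V) :
    pr j (blockDiag pr ic A X) = A j (pr j X) := by
  rw [blockDiag, LinearMap.sum_apply, map_sum, Finset.sum_eq_single j]
  · exact h1 j _
  · exact fun i _ hi ↦ h0 j i hi.symm _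
  · simp

lemma blockDiag_mul (A B : ι → Module.End ℝ U) :
    blockDiag pr ic A * blockDiag pr ic B = blockDiag pr ic fun i ↦ A i * B i := by
  ext X
  conv_lhs => rw [Module.End.mul_apply, blockDiag]
  simp only [LinearMap.sum_apply, LinearMap.comp_apply, pr_blockDiag h1 h0]
  simp [blockDiag]

/-- The off-diagonal compositions `pr i ∘ ic j` vanish, so the double sum reduces to its diagonal.
-/
lemma sum_pr_blockDiag_sum_ic (A : ι → Module.End ℝ U) :
    (∑ i, pr i) ∘ₗ blockDiag pr ic A ∘ₗ (∑ i, ic i) = ∑ i, A i := by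
  ext x
  simp only [LinearMap.comp_apply, LinearMap.sum_apply, pr_blockDiag h1 h0, map_sum]
  rw [Finset.sum_comm]
  refine Finset.sum_congr rfl fun i _ ↦ ?_
  rw [Finset.sum_eq_single i]
  · rw [h1]
  · intro j _ hj
    rw [h0 i j hj.symm, map_zero]
  · simp

lemma trace_blockAverage_mul (A : ι → Module.End ℝ U) :
    LinearMap.trace ℝ V (blockAverage pr ic * blockDiag pr ic A) =
      (Fintype.card ι : ℝ)⁻¹ * ∑ i, LinearMap.trace ℝ U (A i) := by
  have h : blockAverage pr ic * blockDiag pr ic A =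
      (Fintype.card ι : ℝ)⁻¹ • ((∑ i, ic i) ∘ₗ ((∑ i, pr i) ∘ₗ blockDiag pr ic A)) := by
    rw [blockAverage, smul_mul_assoc]; rfl
  rw [h, map_smul, LinearMap.trace_comp_comm', LinearMap.comp_assoc,
    sum_pr_blockDiag_sum_ic h1 h0, map_sum, smul_eq_mul]

lemma blockAverage_mul_mul (A : ι → Module.End ℝ U) (hA : ∑ i, A i = 0) :
    blockAverage pr ic * blockDiag pr ic A * blockAverage pr ic = 0 := by
  have h : blockAverage pr ic * blockDiag pr ic A * blockAverage pr ic =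
      ((Fintype.card ι : ℝ)⁻¹ * (Fintype.card ι : ℝ)⁻¹) •
        ((∑ i, ic i) ∘ₗ ((∑ i, pr i) ∘ₗ blockDiag pr ic A ∘ₗ (∑ i, ic i)) ∘ₗ (∑ i, pr i)) := by
    rw [blockAverage, smul_mul_assoc, smul_mul_assoc, mul_smul_comm, smul_smul]; rfl
  rw [h, sum_pr_blockDiag_sum_ic h1 h0, hA]
  simp

/-- Let `J` be the average and `a, b` the two block diagonal maps. In the expansion of `(1 - J) a (1
- J) b` the term with `J a J` vanishes because the blocks of `a` sum to zero, and each of the terms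
with one `J` has trace `tr(a b)` divided by the number of blocks. -/
theorem trace_compress_blockDiag (A B : ι → Module.End ℝ U) (hA : ∑ i, A i = 0) :
    LinearMap.trace ℝ V ((1 - blockAverage pr ic) * blockDiag pr ic A *
      (1 - blockAverage pr ic) * blockDiag pr ic B) =
    (1 - 2 * (Fintype.card ι : ℝ)⁻¹) *
      LinearMap.trace ℝ V (blockDiag pr ic A * blockDiag pr ic B) := by
  have hJ := blockAverage_mul_mul h1 h0 A hA
  have t1 := trace_blockAverage_mul h1 h0 fun i ↦ A i * B i
  have t2 := trace_blockAverage_mul h1 h0 fun i ↦ B i * A i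
  have t3 := trace_blockDiag h1 fun i ↦ A i * B i
  rw [← blockDiag_mul h1 h0] at t1 t2 t3
  set J := blockAverage pr ic
  set a := blockDiag pr ic A
  set b := blockDiag pr ic B
  have e : (1 - J) * a * (1 - J) * b = a * b - J * (a * b) - a * (J * b) + J * a * J * b := by
    noncomm_ring
  rw [e, hJ, zero_mul, add_zero, map_sub, map_sub, t1, LinearMap.trace_mul_comm ℝ a (J * b), mul_assoc J,
    t2, t3]
  simp only [LinearMap.trace_mul_comm ℝ (B _)]
  ring

end BlockTrace

/-! ### The diagonal subgroup of `H × ⋯ × H`. -/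

section Diagonal

set_option linter.unusedSectionVars false

variable {EG : Type*} [NormedAddCommGroup EG] [NormedSpace ℝ EG] [FiniteDimensional ℝ EG]
  [CompleteSpace EG]
  {G : Type*} [TopologicalSpace G] [ChartedSpace EG G] [Group G] [LieGroup 𝓘(ℝ, EG) ∞ G]
  [T2Space G] [CompactSpace G]
  {E : Type*} [NormedAddCommGroup E] [NormedSpace ℝ E] [FiniteDimensional ℝ E] [CompleteSpace E]
  {M : Type*} [TopologicalSpace M] [ChartedSpace E M] [IsManifold 𝓘(ℝ, E) ∞ M] [MulAction G M]
  {g : Metric E M}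
  {EH : Type*} [NormedAddCommGroup EH] [NormedSpace ℝ EH] [FiniteDimensional ℝ EH]
  [CompleteSpace EH]
  {H : Type*} [TopologicalSpace H] [ChartedSpace EH H] [Group H] [LieGroup 𝓘(ℝ, EH) ∞ H]
  {q : ℕ} {e : G ≃* (Fin q → H)}

/-- The differentials of the projections. -/
def dProj (EG EH : Type*) [NormedAddCommGroup EG] [NormedSpace ℝ EG] [NormedAddCommGroup EH]
    [NormedSpace ℝ EH] {G : Type*} [TopologicalSpace G] [ChartedSpace EG G] [Group G]
    {H : Type*} [TopologicalSpace H] [ChartedSpace EH H] [Group H] [CompleteSpace EG]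
    [CompleteSpace EH] [LieGroup 𝓘(ℝ, EG) ∞ G] [LieGroup 𝓘(ℝ, EH) ∞ H]
    (e : G ≃* (Fin q → H)) (i : Fin q) : EG →ₗ[ℝ] EH := (dHom (powProj e i)).toLinearMap

/-- The differentials of the inclusions of the factors. -/
def dIncl (EG EH : Type*) [NormedAddCommGroup EG] [NormedSpace ℝ EG] [NormedAddCommGroup EH]
    [NormedSpace ℝ EH] {G : Type*} [TopologicalSpace G] [ChartedSpace EG G] [Group G]
    {H : Type*} [TopologicalSpace H] [ChartedSpace EH H] [Group H] [CompleteSpace EG]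
    [CompleteSpace EH] [LieGroup 𝓘(ℝ, EG) ∞ G] [LieGroup 𝓘(ℝ, EH) ∞ H]
    (e : G ≃* (Fin q → H)) (i : Fin q) : EH →ₗ[ℝ] EG := (dHom (powIncl e i)).toLinearMap

namespace IsLieGroupPower

variable (he : IsLieGroupPower EG EH e)
include he

lemma dProj_dIncl_same (i : Fin q) (x : EH) : dProj EG EH e i (dIncl EG EH e i x) = x :=
  he.dHom_powProj_powIncl_same i x

lemma dProj_dIncl_ne (i j : Fin q) (h : i ≠ j) (x : EH) :
    dProj EG EH e i (dIncl EG EH e j x) = 0 :=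
  he.dHom_powProj_powIncl_ne h x

omit he in
lemma sum_adG_eq_zero {X : EG} (hX : ∑ i, dProj EG EH e i X = 0) :
    ∑ i, adG H (dProj EG EH e i X) = 0 := by
  ext y
  have : brk H (∑ i, dProj EG EH e i X) y = 0 := by
    rw [hX]
    exact zero_lie (L := GroupLieAlgebra 𝓘(ℝ, EH) H) (M := GroupLieAlgebra 𝓘(ℝ, EH) H) y
  rw [← brkL_apply, map_sum, sum_apply] at this
  rw [LinearMap.sum_apply]
  exact this

lemma adG_eq_blockDiag (X : EG) : adG G X =
    blockDiag (dProj EG EH e) (dIncl EG EH e) fun i ↦ adG H (dProj EG EH e i X) := by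
  ext Y
  refine he.ext_dHom fun i ↦ ?_
  have := pr_blockDiag (pr := dProj EG EH e) (ic := dIncl EG EH e)
    he.dProj_dIncl_same he.dProj_dIncl_ne
    (fun i ↦ adG H (dProj EG EH e i X)) i Y
  exact (dHom_brk (he.contMDiff_powProj i) X Y).trans this.symm

lemma center_trivial (hz : ∀ x : EH, (∀ y, brk H x y = 0) → x = 0) (X : EG)
    (hX : ∀ Y, brk G X Y = 0) : X = 0 := by
  refine he.ext_dHom fun i ↦ ?_
  rw [map_zero]
  refine hz _ fun y ↦ ?_
  have h1 := dHom_brk (he.contMDiff_powProj i) X (dHom (powIncl e i) y : EG)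
  rw [hX, map_zero, he.dHom_powProj_powIncl_same] at h1
  exact h1.symm

variable {K : KillingFrame g EG} (hK : K.IsStandard G)
  (o : M) (ho : ∀ a : G, a • o = o ↔ ∃ h : H, e a = fun _ ↦ h)
include hK ho

/-- The orbit map is constant on the diagonal, so the diagonal of the Lie algebra lies in the
isotropy algebra. The converse inclusion is `dProj_eq_of_F_eq_zero`. -/
lemma F_powDiag (x : EH) : K.F o (dHom (powDiag e) x) = 0 := by
  have hsm : ContMDiff 𝓘(ℝ, EG) 𝓘(ℝ, E) ∞ (fun g : G ↦ g • o) :=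
    hK.smooth_action.contMDiff_smul.comp (contMDiff_id.prodMk contMDiff_const)
  rw [hK.F_eq]
  have h1 := mfderiv_comp (I := 𝓘(ℝ, EH)) (I' := 𝓘(ℝ, EG)) (I'' := 𝓘(ℝ, E)) (1 : H)
    (hsm.mdifferentiable (by simp) (powDiag e 1)) (he.contMDiff_powDiag.mdifferentiable (by simp) 1)
  have h2 : (fun g : G ↦ g • o) ∘ powDiag e = fun _ ↦ o := by
    funext h
    exact (ho _).2 ⟨h, by ext i; simp [powDiag]⟩
  rw [h2, mfderiv_const] at h1
  have h3 := congrArg (fun A : EH →L[ℝ] E ↦ A x) h1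
  exact (mfderiv_base (map_one (powDiag e)) (fun g : G ↦ g • o) _).symm.trans h3.symm

/-- On the stabilizer any two projections agree, hence so do their differentials on the isotropy
algebra. -/
lemma dProj_eq_of_F_eq_zero {X : EG} (hX : K.F o X = 0) (i j : Fin q) :
    dProj EG EH e i X = dProj EG EH e j X := by
  refine dHom_eq_of_orbitDeriv_eq_zero hK.smooth_action o (fun u ↦ ⟨K.θ o u, ?_⟩)
    (he.contMDiff_powProj i) (he.contMDiff_powProj j) (fun a ha ↦ ?_) ((hK.F_eq o X).symm.trans hX)
  · rw [← hK.F_eq, K.F_θ]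
  · obtain ⟨h, hh⟩ := (ho a).1 ha
    change e a i = e a j
    rw [hh]

/-- The average `J X` is diagonal, hence isotropic. The components of `X - J X` sum to zero, which
makes it orthogonal to the diagonal for the Killing form, itself the sum of the Killing forms of the
factors. -/
lemma proj_eq (hq : q ≠ 0) :
    K.proj o = 1 - blockAverage (dProj EG EH e) (dIncl EG EH e) := by
  have p1 := he.dProj_dIncl_same
  have p0 := he.dProj_dIncl_ne
  have hq' : (q : ℝ) ≠ 0 := by exact_mod_cast hq
  ext X
  set J := blockAverage (dProj EG EH e) (dIncl EG EH e) with hJ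
  let z : EH := (q : ℝ)⁻¹ • ∑ i, dProj EG EH e i X
  have hJX (i : Fin q) : dProj EG EH e i (J X) = z := by
    rw [hJ, blockAverage, Fintype.card_fin, LinearMap.smul_apply, map_smul]
    congr 1
    rw [LinearMap.comp_apply, LinearMap.sum_apply, LinearMap.sum_apply, map_sum,
      Finset.sum_eq_single i]
    · exact p1 i _
    · exact fun j _ hj ↦ p0 i j hj.symm _
    · simp
  have hJz : J X = (dHom (powDiag e) z : EG) := by
    refine he.ext_dHom fun i ↦ ?_
    rw [he.dHom_powProj_powDiag]
    exact hJX i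
  have hFJ : K.F o (J X) = 0 := by rw [hJz]; exact he.F_powDiag hK o ho z
  have h1 : K.P o (X - J X) = X - J X := by
    refine (K.P_eq_self_iff o _).2 fun Y hY ↦ ?_
    have hc : ∀ i, dProj EG EH e i Y = dProj EG EH e ⟨0, Nat.pos_of_ne_zero hq⟩ Y :=
      fun i ↦ he.dProj_eq_of_F_eq_zero hK o ho hY i _
    have hs : ∑ i, dProj EG EH e i (X - J X) = 0 := by
      simp only [map_sub, hJX, Finset.sum_sub_distrib, Finset.sum_const, Finset.card_univ,
        Fintype.card_fin, z]
      rw [← Nat.cast_smul_eq_nsmul ℝ, smul_smul, mul_inv_cancel₀ hq', one_smul, sub_self]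
    have hlin := sum_adG_eq_zero hs
    rw [hK.ip_eq, negKilling_eq, he.adG_eq_blockDiag, he.adG_eq_blockDiag, blockDiag_mul p1 p0,
      trace_blockDiag p1]
    simp only [hc]
    rw [← map_sum, ← Finset.mul_sum, hlin, mul_zero, map_zero, neg_zero]
  change K.P o X = X - J X
  have h2 : K.P o (X - J X) = K.P o X := by
    rw [K.P_apply, map_sub, hFJ, sub_zero]; rfl
  rw [← h2, h1]

/-- The trace form for the diagonal subgroup of a power of a Lie group. -/
theorem trace_eq (hq : q ≠ 0) {X Y : EG} (hX : K.P o X = X) :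
    LinearMap.trace ℝ EG (K.proj o * K.adj X * K.proj o * K.adj Y) =
      -(1 - 2 * (q : ℝ)⁻¹) * K.ip X Y := by
  have p1 := he.dProj_dIncl_same
  have p0 := he.dProj_dIncl_ne
  have hq' : (q : ℝ) ≠ 0 := by exact_mod_cast hq
  -- `P X = X` means that the average of `X` is zero; any one component of `J X` shows it.
  have hs : ∑ i, dProj EG EH e i X = 0 := by
    have h1 : K.proj o X = X := hX
    rw [he.proj_eq hK o ho hq, LinearMap.sub_apply, Module.End.one_apply, sub_eq_self] at h1
    have h2 := congrArg (dProj EG EH e ⟨0, Nat.pos_of_ne_zero hq⟩) h1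
    rw [blockAverage, Fintype.card_fin, LinearMap.smul_apply, map_smul, map_zero,
      smul_eq_zero_iff_right (inv_ne_zero hq'), LinearMap.comp_apply, LinearMap.sum_apply,
      LinearMap.sum_apply, map_sum, Finset.sum_eq_single ⟨0, Nat.pos_of_ne_zero hq⟩] at h2
    · exact (p1 _ _).symm.trans h2
    · exact fun j _ hj ↦ p0 _ j hj.symm _
    · simp
  have := trace_compress_blockDiag p1 p0 (fun i ↦ adG H (dProj EG EH e i X))
    (fun i ↦ adG H (dProj EG EH e i Y)) (sum_adG_eq_zero hs)
  rw [Fintype.card_fin] at this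
  rw [hK.ip_eq, negKilling_eq, hK.adj_eq, hK.adj_eq, he.proj_eq hK o ho hq, he.adG_eq_blockDiag X,
    he.adG_eq_blockDiag Y]
  refine Eq.trans this ?_
  ring

end IsLieGroupPower

end Diagonal

end StdHom
end

/-! ### The two cases of the theorem. -/

theorem mainTheorem2
    {EG : Type*} [NormedAddCommGroup EG] [NormedSpace ℝ EG] [FiniteDimensional ℝ EG]
    [CompleteSpace EG]
    {G : Type*} [TopologicalSpace G] [ChartedSpace EG G] [Group G]
    [LieGroup 𝓘(ℝ, EG) ∞ G] [T2Space G] [CompactSpace G]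
    {E : Type*} [NormedAddCommGroup E] [NormedSpace ℝ E] [FiniteDimensional ℝ E]
    [CompleteSpace E]
    {M : Type*} [TopologicalSpace M] [ChartedSpace E M]
    [IsManifold 𝓘(ℝ, E) ∞ M] [T2Space M] [CompactSpace M]
    [MulAction G M] (g : StdHom.Metric E M)
    (hM : StdHom.IsHomogeneousSpace EG G E M) (hg : StdHom.IsStandardMetric EG G E M g) :
    (LieAlgebra.IsSimple ℝ (GroupLieAlgebra 𝓘(ℝ, EG) G) → SimplyConnectedSpace M →
      StdHom.IsIsotropyIrreducible G E M → ¬ StdHom.IsSymmetricPair EG G E M →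
      ∀ (α : ℝ) (nabla : StdHom.AffineConnection E M),
        StdHom.IsNablaAlpha EG G E M g α nabla → StdHom.IsNablaEinstein g nabla) ∧
    (∀ {EH : Type*} [NormedAddCommGroup EH] [NormedSpace ℝ EH] [FiniteDimensional ℝ EH]
      [CompleteSpace EH] {H : Type*} [TopologicalSpace H] [ChartedSpace EH H] [Group H]
      [LieGroup 𝓘(ℝ, EH) ∞ H] [T2Space H] [CompactSpace H] [SimplyConnectedSpace H]
      (q : ℕ) (e : G ≃* (Fin q → H)) (o : M),
      LieAlgebra.IsSimple ℝ (GroupLieAlgebra 𝓘(ℝ, EH) H) → 2 ≤ q →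
      StdHom.IsLieGroupPower EG EH e →
      (∀ a : G, a • o = o ↔ ∃ h : H, e a = fun _ ↦ h) →
      ∀ (α : ℝ) (nabla : StdHom.AffineConnection E M),
        StdHom.IsNablaAlpha EG G E M g α nabla → StdHom.IsNablaEinstein g nabla) := by
  refine ⟨fun hsimple _ hirr _ α nabla hn ↦ ?_, ?_⟩
  · obtain ⟨K, hK⟩ := StdHom.KillingFrame.exists_isStandard hM hg
      (StdHom.center_trivial_of_isSimple hsimple)
    exact hK.isNablaEinstein hn fun p ↦ hK.exists_trace_eq_of_irreducible hirr p
  · intro EH _ _ _ _ H _ _ _ _ _ _ _ q e o hsimple hq he ho α nabla hn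
    obtain ⟨K, hK⟩ := StdHom.KillingFrame.exists_isStandard hM hg
      (he.center_trivial (StdHom.center_trivial_of_isSimple hsimple))
    refine hK.isNablaEinstein hn fun p ↦ ⟨-(1 - 2 * (q : ℝ)⁻¹), fun X Y hX _ ↦ ?_⟩
    -- The stabilizer is known to be the diagonal only at `o`; at `p` it is a conjugate, and `Ad a`
    -- transports the trace identity.
    obtain ⟨a, ha⟩ := hM.transitive.exists_smul_eq p o
    rw [← hK.trace_Ad ha, he.trace_eq hK o ho (by omega), hK.ip_eq, StdHom.negKilling_Ad]
    rw [hK.P_Ad ha, hX]
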